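/- Let $(X,\Sigma,\mu)$ be an atomless standard probability space (that is, $X$ is a standard Borel space with its Borel $\sigma$-algebra $\Sigma$ and $\mu$ is a Borel probability measure with $\mu(\{x\})=0$ for all $x\in X$; e.g. $[0,1]$ with Lebesgue measure). Let ${\sf Meas}_\mu$ be the measure algebra of $\mu$, i.e., the quotient of the Boolean algebra $\Sigma$ by the ideal of $\mu$-null sets, equipped with the metric $d([A],[B])=\mu(A\triangle B)$. Let ${\sf Aut}({\sf Meas}_\mu)$ be the group of all bijections of ${\sf Meas}_\mu$ that preserve the Boolean operations $\vee,\wedge,\neg$ and the metric $d$, equipped with the topology of pointwise convergence on the metric space $({\sf Meas}_\mu,d)$. Theorem. ${\sf Aut}({\sf Meas}_\mu)$ is a Polish group with the automatic continuity property: every group homomorphism ${\sf Aut}({\sf Meas}_\mu)\to H$ into any Polish group $H$ is continuous. -/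

import Mathlib

open MeasureTheory
open scoped symmDiff

universe u v

/-- The measure algebra `Meas_μ`: the quotient of the `σ`-algebra of measurable sets by the ideal
of `μ`-null sets. It is presented as the metric quotient of the measurable sets, with the
pseudodistance `μ (A ∆ B)`; see `MeasAlg.mk_eq_mk` and `MeasAlg.dist_mk`. -/
def MeasAlg {X : Type*} [MeasurableSpace X] (μ : Measure X) : Type _ :=
  SeparationQuotient (MeasuredSets μ)

namespace MeasAlg

section Algebra

variable {X : Type*} [MeasurableSpace X] {μ : Measure X}

/-- The class `[A]` of the measurable set `A`. -/
noncomputable def mk (A : Set X) (hA : MeasurableSet A) : MeasAlg μ :=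
  SeparationQuotient.mk (⟨A, hA⟩ : MeasuredSets μ)

theorem inseparable_iff (s t : MeasuredSets μ) : Inseparable s t ↔ s.1 =ᵐ[μ] t.1 := by
  rw [EMetric.inseparable_iff, MeasuredSets.edist_def, measure_symmDiff_eq_zero_iff]
  rfl

/-- Two measurable sets have the same class exactly when their difference is null. -/
theorem mk_eq_mk {A B : Set X} (hA : MeasurableSet A) (hB : MeasurableSet B) :
    (mk A hA : MeasAlg μ) = mk B hB ↔ μ (A ∆ B) = 0 := by
  rw [measure_symmDiff_eq_zero_iff]
  exact SeparationQuotient.mk_eq_mk.trans (inseparable_iff _ _)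

theorem ind {p : MeasAlg μ → Prop} (h : ∀ A (hA : MeasurableSet A), p (mk A hA)) (a : MeasAlg μ) :
    p a :=
  Quotient.inductionOn a fun s => h s.1 s.2

/-- `[A] ∨ [B] = [A ∪ B]`. -/
noncomputable instance : Max (MeasAlg μ) where
  max := Quotient.map₂ (fun s t => (⟨s.1 ∪ t.1, s.2.union t.2⟩ : MeasuredSets μ))
    fun s s' hs t t' ht => (inseparable_iff _ _).2
      (((inseparable_iff s s').1 hs).union ((inseparable_iff t t').1 ht))

/-- `[A] ∧ [B] = [A ∩ B]`. -/
noncomputable instance : Min (MeasAlg μ) where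
  min := Quotient.map₂ (fun s t => (⟨s.1 ∩ t.1, s.2.inter t.2⟩ : MeasuredSets μ))
    fun s s' hs t t' ht => (inseparable_iff _ _).2
      (((inseparable_iff s s').1 hs).inter ((inseparable_iff t t').1 ht))

/-- `¬ [A] = [X \ A]`. -/
noncomputable instance : Compl (MeasAlg μ) where
  compl := Quotient.map (fun s => (⟨s.1ᶜ, s.2.compl⟩ : MeasuredSets μ))
    fun s s' hs => (inseparable_iff _ _).2 ((inseparable_iff s s').1 hs).compl

noncomputable instance : Bot (MeasAlg μ) := ⟨mk ∅ .empty⟩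

noncomputable instance : Top (MeasAlg μ) := ⟨mk Set.univ .univ⟩

theorem mk_sup_mk {A B : Set X} (hA : MeasurableSet A) (hB : MeasurableSet B) :
    (mk A hA ⊔ mk B hB : MeasAlg μ) = mk (A ∪ B) (hA.union hB) := rfl

theorem mk_inf_mk {A B : Set X} (hA : MeasurableSet A) (hB : MeasurableSet B) :
    (mk A hA ⊓ mk B hB : MeasAlg μ) = mk (A ∩ B) (hA.inter hB) := rfl

theorem compl_mk {A : Set X} (hA : MeasurableSet A) :
    ((mk A hA)ᶜ : MeasAlg μ) = mk Aᶜ hA.compl := rfl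

theorem bot_def : (⊥ : MeasAlg μ) = mk ∅ .empty := rfl

theorem top_def : (⊤ : MeasAlg μ) = mk Set.univ .univ := rfl

theorem mk_congr {A B : Set X} (hA : MeasurableSet A) (hB : MeasurableSet B) (h : A = B) :
    (mk A hA : MeasAlg μ) = mk B hB := by subst h; rfl

noncomputable instance : Lattice (MeasAlg μ) :=
  Lattice.mk'
    (fun a b => by
      induction a using ind; induction b using ind
      exact mk_congr _ _ (Set.union_comm _ _))
    (fun a b c => by
      induction a using ind; induction b using ind; induction c using ind
      exact mk_congr _ _ (Set.union_assoc _ _ _))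
    (fun a b => by
      induction a using ind; induction b using ind
      exact mk_congr _ _ (Set.inter_comm _ _))
    (fun a b c => by
      induction a using ind; induction b using ind; induction c using ind
      exact mk_congr _ _ (Set.inter_assoc _ _ _))
    (fun a b => by
      induction a using ind; induction b using ind
      exact mk_congr _ _ (Set.union_eq_left.2 Set.inter_subset_left))
    (fun a b => by
      induction a using ind; induction b using ind
      exact mk_congr _ _ (Set.inter_eq_left.2 Set.subset_union_left))

noncomputable instance : DistribLattice (MeasAlg μ) :=
  DistribLattice.ofInfSupLe fun a b c => le_of_eq <| by
    induction a using ind; induction b using ind; induction c using ind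
    exact mk_congr _ _ (Set.inter_union_distrib_left _ _ _)

noncomputable instance : BooleanAlgebra (MeasAlg μ) where
  inf_compl_le_bot a := le_of_eq <| by
    induction a using ind
    exact mk_congr _ _ (Set.inter_compl_self _)
  top_le_sup_compl a := le_of_eq <| by
    induction a using ind
    exact mk_congr _ _ (Set.union_compl_self _).symm
  le_top a := sup_eq_right.1 <| by
    induction a using ind
    exact mk_congr _ _ (Set.union_univ _)
  bot_le a := sup_eq_right.1 <| by
    induction a using ind
    exact mk_congr _ _ (Set.empty_union _)

end Algebra

section Metric

variable {X : Type*} [MeasurableSpace X] (μ : Measure X) [IsFiniteMeasure μ]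

noncomputable instance : MetricSpace (MeasAlg μ) :=
  inferInstanceAs (MetricSpace (SeparationQuotient (MeasuredSets μ)))

/-- The metric of the measure algebra is `d([A], [B]) = μ (A ∆ B)`. -/
theorem dist_mk {A B : Set X} (hA : MeasurableSet A) (hB : MeasurableSet B) :
    dist (mk A hA : MeasAlg μ) (mk B hB) = μ.real (A ∆ B) := rfl

/-- The group `Aut(Meas_μ)` of automorphisms of the metric Boolean algebra `Meas_μ`: the isometric
bijections that preserve the Boolean operations, as a subgroup of the isometry group. -/
def aut : Subgroup (MeasAlg μ ≃ᵢ MeasAlg μ) where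
  carrier := {g | (∀ a b, g (a ⊔ b) = g a ⊔ g b) ∧ (∀ a b, g (a ⊓ b) = g a ⊓ g b) ∧
    ∀ a, g aᶜ = (g a)ᶜ}
  one_mem' := ⟨fun _ _ => rfl, fun _ _ => rfl, fun _ => rfl⟩
  mul_mem' := by
    rintro g h ⟨hg₁, hg₂, hg₃⟩ ⟨hh₁, hh₂, hh₃⟩
    simp only [Set.mem_ofPred_eq, IsometryEquiv.mul_apply]
    exact ⟨fun a b => by rw [hh₁, hg₁], fun a b => by rw [hh₂, hg₂], fun a => by rw [hh₃, hg₃]⟩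
  inv_mem' := by
    rintro g ⟨hg₁, hg₂, hg₃⟩
    refine ⟨fun a b => g.injective ?_, fun a b => g.injective ?_, fun a => g.injective ?_⟩
    · simp only [hg₁, IsometryEquiv.apply_inv_self]
    · simp only [hg₂, IsometryEquiv.apply_inv_self]
    · simp only [hg₃, IsometryEquiv.apply_inv_self]

/-- The topology on `Aut(Meas_μ)` of pointwise convergence on the metric space `Meas_μ`. -/
noncomputable instance : TopologicalSpace (aut μ) :=
  TopologicalSpace.induced (fun (g : aut μ) (a : MeasAlg μ) => g.1 a) Pi.topologicalSpace

end Metric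

end MeasAlg

/-- The automatic continuity property of a topological group `G`: it is a Polish group, and every
group homomorphism from `G` into any Polish group is continuous. -/
structure AutomaticContinuityProperty.{w₁, w₂} (G : Type w₂) [Group G] [TopologicalSpace G] :
    Prop where
  isTopologicalGroup : IsTopologicalGroup G
  polishSpace : PolishSpace G
  continuous_hom : ∀ (H : Type w₁) [Group H] [TopologicalSpace H] [IsTopologicalGroup H]
    [PolishSpace H] (π : G →* H), Continuous π

/-!
The proof follows the Steinhaus principle: a homomorphism `π` from a topological group `G` into a
Polish group is continuous once there is an `m` such that, for every symmetric set `W` with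
countably many translates covering `G`, the power `W ^ m` is a neighbourhood of the identity. Indeed
this applies to `W = π ⁻¹' V` for each symmetric neighbourhood `V` of `1`, and `π` maps `W ^ m` into
`V ^ m`. Here `m = 92 = 8 + 84` works, because an automorphism close to the identity is the product
of two automorphisms to which different arguments apply.

*Automorphisms of small support* lie in `W ^ 84` (`ProbAlg.exists_small_supp_mem`). Among disjoint
elements `X n` there is one on which `W ^ 2` induces every automorphism: otherwise failures on the
`X n`, glued together, would lie in no translate of `W`. A counting argument over the subsets of `ℕ`
produces a nontrivial swap (an involution exchanging two disjoint elements) in `W ^ 2` below that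
`X n`; conjugating it there and moving other swaps there yields all swaps of small domain in
`W ^ 14`. Finally an automorphism of small support is a product of six swaps of small domain
(`ProbAlg.mem_of_suppIn`), by peeling off swaps repeatedly and telescoping over disjoint copies of
the remainders.

*Automorphisms preserving a dyadic algebra* `T.alg`, the countable dense algebra generated by a
dyadic tree `T` of halvings, form a group which is Polish for pointwise convergence on the discrete
algebra (`ProbAlg.TreeAut`). In this finer topology the group has ample generics, and the method of
Kechris and Rosendal shows that `W ^ 8` contains the stabilizer of some level of `T`
(`LevelSystem.exists_stab_subset_pow`). What that argument uses is isolated in `LevelSystem`: open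
subgroups `stab n` forming a basis at the identity, normalized by subgroups `norm n`, with an
approximation and an amalgamation property. Genericity of a tuple is stated as an extension
property, so that generic tuples are conjugate by a back-and-forth argument and generic extensions
of generic tuples are residual.

*The decomposition* is `ProbAlg.Tree.exists_stab_suppIn`: an automorphism almost fixing the nodes of
a level of `T` agrees, off a small set, with an automorphism preserving `T.alg` and fixing these
nodes. This is a back-and-forth argument in which the automorphism is corrected on smaller and
smaller sets, using that partitions can be rounded to the dyadic algebra.

Everything is carried out in an abstract separable atomless probability algebra (`ProbAlg`); the
measure algebra of an atomless standard probability space is an instance.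
-/

open Filter Topology
open scoped Pointwise

/-! ### Probability algebras -/

/-- The measure of an element of a metric Boolean algebra: its distance to `⊥`. -/
noncomputable def vol {B : Type*} [BooleanAlgebra B] [MetricSpace B] (a : B) : ℝ := dist a ⊥

/-- A separable atomless probability algebra: a `σ`-complete Boolean algebra with a strictly
positive `σ`-additive probability measure `vol` without atoms, complete and separable for the
metric `vol (a ∆ b)`. -/
class ProbAlg (B : Type*) [BooleanAlgebra B] [MetricSpace B] : Prop where
  dist_eq_vol : ∀ a b : B, dist a b = vol (a ∆ b)
  vol_top : vol (⊤ : B) = 1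
  vol_sup : ∀ a b : B, Disjoint a b → vol (a ⊔ b) = vol a + vol b
  exists_isLUB : ∀ {ι : Type} [Countable ι] (f : ι → B), ∃ s, IsLUB (Set.range f) s
  hasSum_vol : ∀ {ι : Type} [Countable ι] (f : ι → B) (s : B), Pairwise (Function.onFun Disjoint f) →
    IsLUB (Set.range f) s → HasSum (fun i => vol (f i)) (vol s)
  exists_le_vol_eq : ∀ (a : B) (t : ℝ), 0 ≤ t → t ≤ vol a → ∃ b ≤ a, vol b = t
  complete : CompleteSpace B
  separable : TopologicalSpace.SeparableSpace B

namespace ProbAlg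

section Vol

variable {B : Type*} [BooleanAlgebra B] [MetricSpace B] [ProbAlg B]

instance : CompleteSpace B := complete

instance : TopologicalSpace.SeparableSpace B := separable

/-- The supremum of a countable family. -/
noncomputable def join {ι : Type} [Countable ι] (f : ι → B) : B := (exists_isLUB f).choose

theorem isLUB_join {ι : Type} [Countable ι] (f : ι → B) : IsLUB (Set.range f) (join f) :=
  (exists_isLUB f).choose_spec

theorem le_join {ι : Type} [Countable ι] (f : ι → B) (i : ι) : f i ≤ join f :=
  (isLUB_join f).1 ⟨i, rfl⟩

theorem join_le_iff {ι : Type} [Countable ι] {f : ι → B} {b : B} :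
    join f ≤ b ↔ ∀ i, f i ≤ b := by
  rw [isLUB_le_iff (isLUB_join f)]; simp [upperBounds]

theorem disjoint_join_left {ι : Type} [Countable ι] {f : ι → B} {b : B} :
    Disjoint (join f) b ↔ ∀ i, Disjoint (f i) b := by
  simp only [← le_compl_iff_disjoint_right, join_le_iff]

theorem disjoint_join_right {ι : Type} [Countable ι] {f : ι → B} {b : B} :
    Disjoint b (join f) ↔ ∀ i, Disjoint b (f i) := by
  simp only [disjoint_comm (a := b), disjoint_join_left]

/-- An element below `join f` is determined by its traces on the family `f`. -/
theorem le_of_inf_le {ι : Type} [Countable ι] {f : ι → B} {x y : B} (hx : x ≤ join f)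
    (h : ∀ i, x ⊓ f i ≤ y) : x ≤ y := by
  have h1 : join f ≤ xᶜ ⊔ y := join_le_iff.2 fun i => by
    rw [sup_comm, ← himp_eq, le_himp_iff']; exact h i
  have h2 : x ⊓ (xᶜ ⊔ y) = x := inf_eq_left.2 (hx.trans h1)
  rw [inf_sup_left, inf_compl_self, bot_sup_eq] at h2
  exact inf_eq_left.1 h2

omit [ProbAlg B] in
theorem vol_nonneg (a : B) : 0 ≤ vol a := dist_nonneg

omit [ProbAlg B] in
@[simp] theorem vol_bot : vol (⊥ : B) = 0 := dist_self _

omit [ProbAlg B] in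
theorem vol_eq_zero {a : B} : vol a = 0 ↔ a = ⊥ := dist_eq_zero

omit [ProbAlg B] in
theorem vol_pos {a : B} (h : a ≠ ⊥) : 0 < vol a :=
  lt_of_le_of_ne (vol_nonneg a) fun h' => h (vol_eq_zero.1 h'.symm)

theorem vol_inf_add_vol_sdiff (a b : B) : vol (a ⊓ b) + vol (a \ b) = vol a := by
  rw [← vol_sup _ _ disjoint_inf_sdiff, sup_inf_sdiff]

theorem vol_sdiff {a b : B} (h : b ≤ a) : vol (a \ b) = vol a - vol b := by
  have := vol_inf_add_vol_sdiff a b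
  rw [inf_eq_right.2 h] at this
  linarith

theorem vol_mono {a b : B} (h : a ≤ b) : vol a ≤ vol b := by
  have := vol_sdiff h
  have := vol_nonneg (b \ a)
  linarith

theorem vol_compl (a : B) : vol aᶜ = 1 - vol a := by
  rw [← top_sdiff, vol_sdiff le_top, vol_top]

theorem vol_sup_le (a b : B) : vol (a ⊔ b) ≤ vol a + vol b := by
  have h : a ⊔ b = a ⊔ b \ a := by simp
  rw [h, vol_sup _ _ disjoint_sdiff_self_right]
  linarith [vol_mono (sdiff_le : b \ a ≤ b)]

theorem eq_of_le_of_vol_le {a b : B} (h : a ≤ b) (hv : vol b ≤ vol a) : a = b := by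
  have h1 := vol_sdiff h
  have h2 : vol (b \ a) = 0 := le_antisymm (by linarith) (vol_nonneg _)
  exact le_antisymm h (sdiff_eq_bot_iff.1 (vol_eq_zero.1 h2))

theorem dist_eq_add (a b : B) : dist a b = vol (a \ b) + vol (b \ a) := by
  rw [dist_eq_vol, symmDiff, vol_sup]
  exact disjoint_sdiff_sdiff

theorem vol_le_add_dist (a b : B) : vol a ≤ vol b + dist a b := by
  have h1 := vol_inf_add_vol_sdiff a b
  have h2 := vol_mono (inf_le_right : a ⊓ b ≤ b)
  have h3 := vol_nonneg (b \ a)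
  rw [dist_eq_add]; linarith

theorem dist_compl (a b : B) : dist aᶜ bᶜ = dist a b := by
  rw [dist_eq_vol, dist_eq_vol, compl_symmDiff_compl]

theorem dist_sup_le (a b c d : B) : dist (a ⊔ b) (c ⊔ d) ≤ dist a c + dist b d := by
  rw [dist_eq_vol, dist_eq_vol a c, dist_eq_vol b d]
  refine (vol_mono ?_).trans (vol_sup_le _ _)
  rw [symmDiff_le_iff]
  constructor
  · refine sup_le ?_ ?_
    · exact (le_symmDiff_sup_right a c).trans
        (sup_le (le_sup_of_le_right (le_sup_left)) (le_sup_of_le_left le_sup_left))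
    · exact (le_symmDiff_sup_right b d).trans
        (sup_le (le_sup_of_le_right (le_sup_right)) (le_sup_of_le_left le_sup_right))
  · refine sup_le ?_ ?_
    · exact (le_symmDiff_sup_left a c).trans
        (sup_le (le_sup_of_le_right (le_sup_left)) (le_sup_of_le_left le_sup_left))
    · exact (le_symmDiff_sup_left b d).trans
        (sup_le (le_sup_of_le_right (le_sup_right)) (le_sup_of_le_left le_sup_right))

theorem dist_inf_le (a b c d : B) : dist (a ⊓ b) (c ⊓ d) ≤ dist a c + dist b d := by
  rw [← dist_compl, compl_inf, compl_inf, ← dist_compl a, ← dist_compl b]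
  exact dist_sup_le _ _ _ _

theorem tendsto_sup {ι : Type*} {l : Filter ι} {f g : ι → B} {a b : B}
    (hf : Tendsto f l (𝓝 a)) (hg : Tendsto g l (𝓝 b)) :
    Tendsto (fun i => f i ⊔ g i) l (𝓝 (a ⊔ b)) := by
  rw [tendsto_iff_dist_tendsto_zero] at hf hg ⊢
  exact squeeze_zero (fun _ => dist_nonneg) (fun i => dist_sup_le _ _ _ _) (by simpa using hf.add hg)

theorem tendsto_compl {ι : Type*} {l : Filter ι} {f : ι → B} {a : B}
    (hf : Tendsto f l (𝓝 a)) : Tendsto (fun i => (f i)ᶜ) l (𝓝 aᶜ) := by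
  rw [tendsto_iff_dist_tendsto_zero] at hf ⊢
  simpa only [dist_compl] using hf

theorem tendsto_inf {ι : Type*} {l : Filter ι} {f g : ι → B} {a b : B}
    (hf : Tendsto f l (𝓝 a)) (hg : Tendsto g l (𝓝 b)) :
    Tendsto (fun i => f i ⊓ g i) l (𝓝 (a ⊓ b)) := by
  simpa [compl_sup] using tendsto_compl (tendsto_sup (tendsto_compl hf) (tendsto_compl hg))

theorem vol_join {ι : Type} [Countable ι] {f : ι → B}
    (hf : Pairwise (Function.onFun Disjoint f)) : HasSum (fun i => vol (f i)) (vol (join f)) :=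
  hasSum_vol f _ hf (isLUB_join f)

theorem vol_finset_sup {ι : Type*} (s : Finset ι) (f : ι → B)
    (h : ∀ i ∈ s, ∀ j ∈ s, i ≠ j → Disjoint (f i) (f j)) :
    vol (s.sup f) = ∑ i ∈ s, vol (f i) := by
  classical
  induction s using Finset.induction_on with
  | empty => simp
  | insert i s hi ih =>
    rw [Finset.sup_insert, vol_sup, Finset.sum_insert hi, ih]
    · exact fun i hi j hj => h i (Finset.mem_insert_of_mem hi) j (Finset.mem_insert_of_mem hj)
    · rw [Finset.disjoint_sup_right]
      intro j hj
      exact h _ (Finset.mem_insert_self _ _) _ (Finset.mem_insert_of_mem hj)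
        fun h => hi (h ▸ hj)

theorem vol_finset_sup_le {ι : Type*} (s : Finset ι) (f : ι → B) :
    vol (s.sup f) ≤ ∑ i ∈ s, vol (f i) := by
  classical
  induction s using Finset.induction_on with
  | empty => simp
  | insert i s hi ih =>
    rw [Finset.sup_insert, Finset.sum_insert hi]
    linarith [vol_sup_le (f i) (s.sup f)]

/-- Countable subadditivity of the measure. -/
theorem vol_join_le {f : ℕ → B} {s : ℝ}
    (hf : HasSum (fun i => vol (f i)) s) : vol (join f) ≤ s := by
  -- disjointify the family
  let g : ℕ → B := disjointed f
  have hg : IsLUB (Set.range g) (join f) := by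
    refine ⟨?_, fun b hb => join_le_iff.2 fun i => ?_⟩
    · rintro _ ⟨i, rfl⟩
      exact (disjointed_le f i).trans (le_join f i)
    · refine (le_partialSups f i).trans ?_
      rw [← partialSups_disjointed]
      exact partialSups_le _ _ _ fun k _ => hb ⟨k, rfl⟩
  exact hasSum_le (fun i => vol_mono (disjointed_le f i))
    (hasSum_vol g _ (disjoint_disjointed f) hg) hf

/-- Below an element there are disjoint elements with prescribed measures, as long as the sum of
the measures is not too large. -/
theorem exists_disjoint_vol_eq (z : B) {v : ℕ → ℝ} (hv : ∀ k, 0 ≤ v k) {s : ℝ} (hs : HasSum v s)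
    (hz : s ≤ vol z) :
    ∃ F : ℕ → B, Pairwise (Function.onFun Disjoint F) ∧ (∀ k, F k ≤ z) ∧ ∀ k, vol (F k) = v k := by
  -- recursively, `(used, new)` with `new` disjoint from `used`
  have step : ∀ (e : B) (t : ℝ), ∃ b : B, 0 ≤ t → e ≤ z → t ≤ vol z - vol e →
      b ≤ z \ e ∧ vol b = t := by
    intro e t
    by_cases h : 0 ≤ t ∧ e ≤ z ∧ t ≤ vol z - vol e
    · obtain ⟨b, hb, hbt⟩ := exists_le_vol_eq (z \ e) t h.1 (by rw [vol_sdiff h.2.1]; exact h.2.2)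
      exact ⟨b, fun _ _ _ => ⟨hb, hbt⟩⟩
    · exact ⟨⊥, fun h1 h2 h3 => (h ⟨h1, h2, h3⟩).elim⟩
  choose nxt hnxt using step
  let U : ℕ → B := fun n => Nat.rec ⊥ (fun k e => e ⊔ nxt e (v k)) n
  let F : ℕ → B := fun k => nxt (U k) (v k)
  have hU : ∀ k, U (k + 1) = U k ⊔ F k := fun k => rfl
  have key : ∀ k, U k ≤ z ∧ vol (U k) = ∑ i ∈ Finset.range k, v i := by
    intro k
    induction k with
    | zero => exact ⟨bot_le, by simp [U]⟩
    | succ k ih =>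
      have hle : v k ≤ vol z - vol (U k) := by
        have := sum_le_hasSum (Finset.range (k + 1)) (fun i _ => hv i) hs
        rw [Finset.sum_range_succ] at this
        rw [ih.2]; linarith
      obtain ⟨h1, h2⟩ := hnxt (U k) (v k) (hv k) ih.1 hle
      rw [hU, Finset.sum_range_succ]
      refine ⟨sup_le ih.1 (h1.trans sdiff_le), ?_⟩
      rw [vol_sup, ih.2, h2]
      exact disjoint_sdiff_self_right.mono_right h1
  have key2 : ∀ k, F k ≤ z \ U k ∧ vol (F k) = v k := fun k => by
    refine hnxt (U k) (v k) (hv k) (key k).1 ?_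
    have := sum_le_hasSum (Finset.range (k + 1)) (fun i _ => hv i) hs
    rw [Finset.sum_range_succ] at this
    rw [(key k).2]; linarith
  have hmono : Monotone U := monotone_nat_of_le_succ fun k => by rw [hU]; exact le_sup_left
  have hlt : ∀ i j, i < j → Disjoint (F i) (F j) := fun i j hij => by
    have h1 : F i ≤ U j := by
      refine le_trans ?_ (hmono (Nat.succ_le_of_lt hij))
      rw [Nat.succ_eq_add_one, hU]; exact le_sup_right
    exact disjoint_sdiff_self_right.mono h1 (key2 j).1
  refine ⟨F, fun i j hij => ?_, fun k => (key2 k).1.trans sdiff_le, fun k => (key2 k).2⟩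
  rcases lt_or_gt_of_ne hij with h | h
  · exact hlt i j h
  · exact (hlt j i h).symm

end Vol

end ProbAlg

namespace ProbAlg

/-! ### The automorphism group and its topology -/

/-- The group of isometric automorphisms of a metric Boolean algebra. -/
def Aut (B : Type*) [BooleanAlgebra B] [MetricSpace B] : Subgroup (B ≃ᵢ B) where
  carrier := {g | (∀ a b, g (a ⊔ b) = g a ⊔ g b) ∧ (∀ a b, g (a ⊓ b) = g a ⊓ g b) ∧
    ∀ a, g aᶜ = (g a)ᶜ}
  one_mem' := ⟨fun _ _ => rfl, fun _ _ => rfl, fun _ => rfl⟩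
  mul_mem' := by
    rintro g h ⟨hg₁, hg₂, hg₃⟩ ⟨hh₁, hh₂, hh₃⟩
    simp only [Set.mem_ofPred_eq, IsometryEquiv.mul_apply]
    exact ⟨fun a b => by rw [hh₁, hg₁], fun a b => by rw [hh₂, hg₂], fun a => by rw [hh₃, hg₃]⟩
  inv_mem' := by
    rintro g ⟨hg₁, hg₂, hg₃⟩
    refine ⟨fun a b => g.injective ?_, fun a b => g.injective ?_, fun a => g.injective ?_⟩
    · simp only [hg₁, IsometryEquiv.apply_inv_self]
    · simp only [hg₂, IsometryEquiv.apply_inv_self]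
    · simp only [hg₃, IsometryEquiv.apply_inv_self]

section Action

variable {B : Type*} [BooleanAlgebra B] [MetricSpace B]

instance : MulAction (Aut B) B where
  smul g a := g.1 a
  one_smul _ := rfl
  mul_smul _ _ _ := rfl

/-- The topology of pointwise convergence. -/
instance : TopologicalSpace (Aut B) :=
  TopologicalSpace.induced (fun (g : Aut B) (a : B) => g.1 a) Pi.topologicalSpace

theorem aut_ext {g h : Aut B} (H : ∀ a : B, g • a = h • a) : g = h :=
  Subtype.ext (IsometryEquiv.ext H)

theorem smul_sup (g : Aut B) (a b : B) : g • (a ⊔ b) = g • a ⊔ g • b := g.2.1 a b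

theorem smul_inf (g : Aut B) (a b : B) : g • (a ⊓ b) = g • a ⊓ g • b := g.2.2.1 a b

theorem smul_compl (g : Aut B) (a : B) : g • aᶜ = (g • a)ᶜ := g.2.2.2 a

@[simp] theorem smul_bot (g : Aut B) : g • (⊥ : B) = ⊥ := by
  have := smul_inf g ⊥ ⊥ᶜ
  rwa [smul_compl, inf_compl_self, inf_compl_self] at this

@[simp] theorem smul_top (g : Aut B) : g • (⊤ : B) = ⊤ := by
  rw [← compl_bot, smul_compl, smul_bot]

theorem smul_le_smul {g : Aut B} {a b : B} (h : a ≤ b) : g • a ≤ g • b := by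
  rw [← sup_eq_right, ← smul_sup, sup_eq_right.2 h]

theorem smul_le_iff {g : Aut B} {a b : B} : g • a ≤ b ↔ a ≤ g⁻¹ • b :=
  ⟨fun h => by simpa using smul_le_smul (g := g⁻¹) h,
    fun h => by simpa using smul_le_smul (g := g) h⟩

theorem disjoint_smul {g : Aut B} {a b : B} : Disjoint (g • a) (g • b) ↔ Disjoint a b := by
  rw [disjoint_iff, disjoint_iff, ← smul_inf, smul_eq_iff_eq_inv_smul, smul_bot]

theorem disjoint_smul_left {g : Aut B} {a b : B} :
    Disjoint (g • a) b ↔ Disjoint a (g⁻¹ • b) := by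
  rw [← disjoint_smul (g := g⁻¹), inv_smul_smul]

theorem dist_smul (g : Aut B) (a b : B) : dist (g • a) (g • b) = dist a b := g.1.dist_eq a b

@[simp] theorem vol_smul (g : Aut B) (a : B) : vol (g • a) = vol a := by
  rw [vol, vol, ← smul_bot g, dist_smul, smul_bot]

theorem smul_finset_sup {ι : Type*} (g : Aut B) (s : Finset ι) (f : ι → B) :
    g • s.sup f = s.sup fun i => g • f i := by
  classical
  induction s using Finset.induction_on with
  | empty => simp
  | insert i s hi ih => rw [Finset.sup_insert, Finset.sup_insert, smul_sup, ih]

theorem eq_of_smul_le [ProbAlg B] {g : Aut B} {a b : B} (h : g • a ≤ b) (hv : vol b ≤ vol a) :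
    g • a = b := eq_of_le_of_vol_le h (by rwa [vol_smul])

theorem smul_join [ProbAlg B] {ι : Type} [Countable ι] (g : Aut B) (f : ι → B) :
    g • join f = join fun i => g • f i := by
  refine le_antisymm ?_ (join_le_iff.2 fun i => smul_le_smul (le_join f i))
  rw [smul_le_iff, join_le_iff]
  exact fun i => smul_le_iff.1 (le_join (fun i => g • f i) i)

/-- A measure preserving order isomorphism is an automorphism. -/
def autOfOrderIso [ProbAlg B] (e : B ≃o B) (he : ∀ a, vol (e a) = vol a) : Aut B :=
  ⟨⟨e.toEquiv, Isometry.of_dist_eq fun a b => by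
    have hc : ∀ a, e aᶜ = (e a)ᶜ := fun a => ((isCompl_compl (x := a)).map e).compl_eq.symm
    have hs : ∀ a b, e (a \ b) = e a \ e b := fun a b => by
      rw [sdiff_eq, sdiff_eq, e.map_inf, hc]
    change dist (e a) (e b) = dist a b
    rw [dist_eq_add, dist_eq_add, ← hs, ← hs, he, he]⟩,
    fun a b => map_sup e a b, fun a b => map_inf e a b,
    fun a => ((isCompl_compl (x := a)).map e).compl_eq.symm⟩

@[simp] theorem autOfOrderIso_smul [ProbAlg B] (e : B ≃o B) (he : ∀ a, vol (e a) = vol a) (a : B) :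
    autOfOrderIso e he • a = e a := rfl

/-- A surjective isometry preserving suprema is an automorphism. -/
theorem exists_aut_of_isometry [ProbAlg B] (f f' : B → B) (hff' : ∀ a, f (f' a) = a)
    (hf'f : ∀ a, f' (f a) = a) (hd : ∀ a b, dist (f a) (f b) = dist a b)
    (hs : ∀ a b, f (a ⊔ b) = f a ⊔ f b) : ∃ g : Aut B, (∀ a, g • a = f a) ∧ ∀ a, g⁻¹ • a = f' a := by
  have hle : ∀ a b, f a ≤ f b ↔ a ≤ b := fun a b => by
    rw [← sup_eq_right, ← hs, ← sup_eq_right]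
    exact ⟨fun h => by rw [← hf'f (a ⊔ b), h, hf'f], fun h => by rw [h]⟩
  let e : B ≃o B := ⟨⟨f, f', hf'f, hff'⟩, fun {a b} => hle a b⟩
  have hbot : f ⊥ = ⊥ := map_bot e
  have he : ∀ a, vol (e a) = vol a := fun a => by
    rw [vol, ← hbot]; exact hd _ _
  refine ⟨autOfOrderIso e he, fun a => rfl, fun a => ?_⟩
  rw [inv_smul_eq_iff]
  exact (hff' a).symm

end Action

section Topology

variable {B : Type*} [BooleanAlgebra B] [MetricSpace B]

theorem continuous_eval (a : B) : Continuous fun g : Aut B => g • a :=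
  (continuous_apply a).comp continuous_induced_dom

theorem tendsto_aut_iff {ι : Type*} {l : Filter ι} {f : ι → Aut B} {g : Aut B} :
    Tendsto f l (𝓝 g) ↔ ∀ a : B, Tendsto (fun i => f i • a) l (𝓝 (g • a)) := by
  rw [nhds_induced, tendsto_comap_iff, tendsto_pi_nhds]
  rfl

instance : IsTopologicalGroup (Aut B) where
  continuous_mul := by
    rw [continuous_iff_continuousAt]
    rintro ⟨g, h⟩
    rw [ContinuousAt, tendsto_aut_iff]
    intro a
    have h1 : Tendsto (fun p : Aut B × Aut B => p.1 • (h • a)) (𝓝 (g, h)) (𝓝 (g • (h • a))) :=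
      ((continuous_eval (h • a)).comp continuous_fst).tendsto (g, h)
    have h2 : Tendsto (fun p : Aut B × Aut B => p.2 • a) (𝓝 (g, h)) (𝓝 (h • a)) :=
      ((continuous_eval a).comp continuous_snd).tendsto (g, h)
    rw [tendsto_iff_dist_tendsto_zero] at h1 h2 ⊢
    refine squeeze_zero (fun _ => dist_nonneg) (fun p => ?_) (by simpa using h2.add h1)
    change dist ((p.1 * p.2) • a) ((g * h) • a) ≤ _
    rw [mul_smul, mul_smul]
    refine (dist_triangle _ (p.1 • (h • a)) _).trans ?_
    rw [dist_smul]
  continuous_inv := by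
    rw [continuous_iff_continuousAt]
    intro g
    rw [ContinuousAt, tendsto_aut_iff]
    intro a
    have h1 := (continuous_eval (g⁻¹ • a)).tendsto g
    rw [tendsto_iff_dist_tendsto_zero] at h1 ⊢
    refine h1.congr fun h => ?_
    rw [← dist_smul h (h⁻¹ • a), smul_inv_smul, dist_comm, smul_inv_smul]

theorem tendsto_aut_of_dense {ι : Type*} {l : Filter ι} {f : ι → Aut B} {g : Aut B} {d : ℕ → B}
    (hd : DenseRange d) (h : ∀ n, Tendsto (fun i => f i • d n) l (𝓝 (g • d n))) :
    Tendsto f l (𝓝 g) := by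
  rw [tendsto_aut_iff]
  intro a
  rw [Metric.tendsto_nhds]
  intro ε hε
  obtain ⟨n, hn⟩ := hd.exists_dist_lt a (by positivity : 0 < ε / 3)
  filter_upwards [Metric.tendsto_nhds.1 (h n) (ε / 3) (by positivity)] with i hi
  calc dist (f i • a) (g • a)
      ≤ dist (f i • a) (f i • d n) + dist (f i • d n) (g • d n) + dist (g • d n) (g • a) :=
        dist_triangle4 _ _ _ _
    _ = dist a (d n) + dist (f i • d n) (g • d n) + dist a (d n) := by
        rw [dist_smul, dist_smul, dist_comm (d n) a]
    _ < ε := by linarith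

/-- If automorphisms and their inverses converge pointwise on a dense set, then they converge
to an automorphism. -/
theorem exists_tendsto_aut [ProbAlg B] {f : ℕ → Aut B} {d : ℕ → B} (hd : DenseRange d)
    (h : ∀ n, ∃ b, Tendsto (fun i => f i • d n) atTop (𝓝 b))
    (h' : ∀ n, ∃ b, Tendsto (fun i => (f i)⁻¹ • d n) atTop (𝓝 b)) :
    ∃ g : Aut B, Tendsto f atTop (𝓝 g) := by
  have key : ∀ f : ℕ → Aut B, (∀ n, ∃ b, Tendsto (fun i => f i • d n) atTop (𝓝 b)) →
      ∀ a : B, ∃ b, Tendsto (fun i => f i • a) atTop (𝓝 b) := by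
    intro f h a
    refine cauchySeq_tendsto_of_complete (Metric.cauchySeq_iff.2 fun ε hε => ?_)
    obtain ⟨n, hn⟩ := hd.exists_dist_lt a (by positivity : 0 < ε / 3)
    obtain ⟨b, hb⟩ := h n
    obtain ⟨N, hN⟩ := Metric.cauchySeq_iff.1 hb.cauchySeq (ε / 3) (by positivity)
    refine ⟨N, fun i hi j hj => ?_⟩
    calc dist (f i • a) (f j • a)
        ≤ dist (f i • a) (f i • d n) + dist (f i • d n) (f j • d n) + dist (f j • d n) (f j • a) :=
          dist_triangle4 _ _ _ _
      _ = dist a (d n) + dist (f i • d n) (f j • d n) + dist a (d n) := by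
          rw [dist_smul, dist_smul, dist_comm (d n) a]
      _ < ε := by linarith [hN i hi j hj]
  choose φ hφ using key f h
  choose ψ hψ using key _ h'
  have hdφ : ∀ a b, dist (φ a) (φ b) = dist a b := fun a b =>
    tendsto_nhds_unique ((hφ a).dist (hφ b)) (by simp only [dist_smul]; exact tendsto_const_nhds)
  have h1 : ∀ a, φ (ψ a) = a := fun a => by
    refine tendsto_nhds_unique (hφ (ψ a)) ?_
    have := hψ a
    rw [tendsto_iff_dist_tendsto_zero] at this ⊢
    refine this.congr fun i => ?_
    rw [← dist_smul (f i), smul_inv_smul, dist_comm]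
  have h2 : ∀ a, ψ (φ a) = a := fun a => by
    refine tendsto_nhds_unique (hψ (φ a)) ?_
    have := hφ a
    rw [tendsto_iff_dist_tendsto_zero] at this ⊢
    refine this.congr fun i => ?_
    rw [← dist_smul (f i)⁻¹, inv_smul_smul, dist_comm]
  obtain ⟨g, hg, -⟩ := exists_aut_of_isometry φ ψ h1 h2 hdφ fun a b =>
    tendsto_nhds_unique (hφ _) (by simp only [smul_sup]; exact ProbAlg.tendsto_sup (hφ a) (hφ b))
  refine ⟨g, tendsto_aut_iff.2 fun a => ?_⟩
  rw [hg]; exact hφ a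

instance [ProbAlg B] : PolishSpace (Aut B) := by
  let d : ℕ → B := TopologicalSpace.denseSeq B
  have hd : DenseRange d := TopologicalSpace.denseRange_denseSeq B
  let Φ : Aut B → (ℕ → B) × (ℕ → B) := fun g => (fun n => g • d n, fun n => g⁻¹ • d n)
  have hc : Continuous Φ := (continuous_pi fun n => continuous_eval (d n)).prodMk
    (continuous_pi fun n => (continuous_eval (d n)).comp continuous_inv)
  have hind : IsInducing Φ := by
    refine isInducing_iff_nhds.2 fun g => le_antisymm (hc.tendsto g).le_comap ?_
    have : Tendsto id (comap Φ (𝓝 (Φ g))) (𝓝 g) := by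
      refine tendsto_aut_of_dense hd fun n => ?_
      have h1 : Tendsto Φ (comap Φ (𝓝 (Φ g))) (𝓝 (Φ g)) := tendsto_comap
      exact ((continuous_apply n).comp continuous_fst).continuousAt.tendsto.comp h1
    exact this
  have hinj : Function.Injective Φ := fun g h hgh => by
    have h1 : ∀ n, g • d n = h • d n := fun n => congrFun (congrArg Prod.fst hgh) n
    refine aut_ext fun a => ?_
    exact congrFun (hd.equalizer (g.1.isometry.continuous) (h.1.isometry.continuous)
      (funext h1)) a
  have hcl : IsClosed (Set.range Φ) := by
    refine IsSeqClosed.isClosed fun u p hu hp => ?_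
    choose f hf using hu
    have hf' : ∀ i, Φ (f i) = u i := hf
    have h1 : ∀ n, Tendsto (fun i => f i • d n) atTop (𝓝 (p.1 n)) := fun n => by
      have := ((continuous_apply n).comp continuous_fst).continuousAt.tendsto.comp hp
      refine this.congr fun i => ?_
      rw [Function.comp_apply, ← hf' i]; rfl
    have h2 : ∀ n, Tendsto (fun i => (f i)⁻¹ • d n) atTop (𝓝 (p.2 n)) := fun n => by
      have := ((continuous_apply n).comp continuous_snd).continuousAt.tendsto.comp hp
      refine this.congr fun i => ?_
      rw [Function.comp_apply, ← hf' i]; rfl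
    obtain ⟨g, hg⟩ := exists_tendsto_aut hd (fun n => ⟨_, h1 n⟩) (fun n => ⟨_, h2 n⟩)
    refine ⟨g, tendsto_nhds_unique ((hc.tendsto g).comp hg) (hp.congr fun i => (hf' i).symm)⟩
  exact IsClosedEmbedding.polishSpace ⟨⟨hind, hinj⟩, hcl⟩

end Topology

end ProbAlg

/-! ### Groups with generic tuples -/

/-- Dependent choice: a sequence is built by steps preserving the invariant `P k`, with `R k` holding
between successive terms. -/
theorem exists_seq_of_step {α : Type*} (P : ℕ → α → Prop) (R : ℕ → α → α → Prop) (a₀ : α)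
    (h₀ : P 0 a₀) (step : ∀ k a, P k a → ∃ b, P (k + 1) b ∧ R k a b) :
    ∃ s : ℕ → α, s 0 = a₀ ∧ (∀ k, P k (s k)) ∧ ∀ k, R k (s k) (s (k + 1)) := by
  choose! nxt h1 h2 using step
  let s : ℕ → α := fun n => Nat.rec a₀ nxt n
  have hP : ∀ k, P k (s k) := fun k => by
    induction k with
    | zero => exact h₀
    | succ k ih => exact h1 k _ ih
  exact ⟨s, rfl, hP, fun k => h2 k _ (hP k)⟩

/-- A level system on a topological group: open subgroups `stab n` forming a basis at the identity,
and subgroups `norm n` normalizing them. In the model, `stab n` fixes and `norm n` permutes the dyadic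
sets of level `n`, so that an element of `norm n` modulo `stab n` is a permutation of these sets. -/
structure LevelSystem (G : Type*) [Group G] [TopologicalSpace G] where
  /-- The open subgroups. -/
  stab : ℕ → Subgroup G
  /-- The groups normalizing them. -/
  norm : ℕ → Subgroup G
  anti : Antitone stab
  isOpen_stab : ∀ n, IsOpen (stab n : Set G)
  basis : ∀ U ∈ 𝓝 (1 : G), ∃ n, (stab n : Set G) ⊆ U
  stab_le_norm : ∀ n, stab n ≤ norm n
  conj_mem : ∀ n a g, a ∈ norm n → g ∈ stab n → a * g * a⁻¹ ∈ stab n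
  /-- Every element is congruent modulo `stab k` to an element of `norm n`, for all large `n`. -/
  approx : ∀ (x : G) (k : ℕ), ∃ M, k ≤ M ∧ ∀ n, M ≤ n → ∃ y ∈ norm n, x⁻¹ * y ∈ stab k
  /-- Amalgamation: `c` moves level `n'` to a copy inside level `L` which is independent of level `l`
  over level `n`. Permutations `a` of level `l` and `p` of level `n'` inducing the same permutation of
  level `n` are then both induced, up to conjugation by `c` in the case of `p`, by a permutation `e` of
  level `L`. -/
  amalg : ∀ n l n', n ≤ l → n ≤ n' → ∃ L, l ≤ L ∧ ∃ c ∈ stab n,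
    (∀ g ∈ stab L, c * g * c⁻¹ ∈ stab n') ∧
    ∀ a p, a ∈ norm n → a ∈ norm l → p ∈ norm n → p ∈ norm n' → p⁻¹ * a ∈ stab n →
      ∃ e, e ∈ norm l ∧ e ∈ norm L ∧ a⁻¹ * e ∈ stab l ∧ p⁻¹ * (c * e * c⁻¹) ∈ stab n'

namespace LevelSystem

section Generic

variable {G : Type*} [Group G] [TopologicalSpace G] (S : LevelSystem G)

/-- A tuple is generic if arbitrarily small conjugations bring all entries into some `norm n` with `n`
large, and the following extension property holds for its conjugates: if permutations `p i` of level
`n'` agree with the tuple on level `n`, then some element of `stab n` conjugates the tuple to one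
agreeing with `p` on level `n'`. -/
def Generic {ι : Type} (t : ι → G) : Prop :=
  (∀ N, ∃ h ∈ S.stab N, ∃ n, N ≤ n ∧ ∀ i, h * t i * h⁻¹ ∈ S.norm n) ∧
  ∀ (f : G) (n n' : ℕ) (p : ι → G), n ≤ n' → (∀ i, p i ∈ S.norm n) → (∀ i, p i ∈ S.norm n') →
    (∀ i, (p i)⁻¹ * (f * t i * f⁻¹) ∈ S.stab n) →
    ∃ h ∈ S.stab n, ∀ i, (p i)⁻¹ * (h * (f * t i * f⁻¹) * h⁻¹) ∈ S.stab n'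

variable {S}

theorem conj_mem' {n : ℕ} {a g : G} (ha : a ∈ S.norm n) (hg : g ∈ S.stab n) :
    a⁻¹ * g * a ∈ S.stab n := by
  simpa using S.conj_mem n a⁻¹ g (inv_mem ha) hg

variable [IsTopologicalGroup G]

theorem isOpen_norm (n : ℕ) : IsOpen (S.norm n : Set G) :=
  Subgroup.isOpen_mono (S.stab_le_norm n) (S.isOpen_stab n)

theorem exists_conj_le (f : G) (N : ℕ) : ∃ k, N ≤ k ∧ ∀ g ∈ S.stab k, f * g * f⁻¹ ∈ S.stab N := by
  have hc : Continuous fun g : G => f * g * f⁻¹ := by fun_prop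
  obtain ⟨k, hk⟩ := S.basis ((fun g : G => f * g * f⁻¹) ⁻¹' (S.stab N))
    (((S.isOpen_stab N).preimage hc).mem_nhds (by simp [one_mem]))
  exact ⟨max k N, le_max_right _ _, fun g hg => hk (S.anti (le_max_left k N) hg)⟩

theorem Generic.conj {ι : Type} {t : ι → G} (ht : S.Generic t) (f : G) :
    S.Generic fun i => f * t i * f⁻¹ := by
  constructor
  · intro N
    obtain ⟨k, hNk, hk⟩ := exists_conj_le (S := S) f N
    obtain ⟨M, hkM, hM⟩ := S.approx f k
    obtain ⟨h, hh, n, hn, hn'⟩ := ht.1 M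
    obtain ⟨y, hy, hfy⟩ := hM n hn
    refine ⟨y * h * f⁻¹, ?_, n, hNk.trans (hkM.trans hn), fun i => ?_⟩
    · have : y * h * f⁻¹ = f * ((f⁻¹ * y) * h) * f⁻¹ := by group
      rw [this]
      exact hk _ (mul_mem hfy (S.anti hkM hh))
    · have : y * h * f⁻¹ * (f * t i * f⁻¹) * (y * h * f⁻¹)⁻¹ = y * (h * t i * h⁻¹) * y⁻¹ := by group
      rw [this]
      exact mul_mem (mul_mem hy (hn' i)) (inv_mem hy)
  · intro f' n n' p hn hp hp' H
    have e : ∀ i, f' * (f * t i * f⁻¹) * f'⁻¹ = (f' * f) * t i * (f' * f)⁻¹ := fun i => by group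
    simp only [e] at H ⊢
    exact ht.2 (f' * f) n n' p hn hp hp' H

/-- Near any `x` there is an element which a small conjugation brings, together with a generic
tuple, into some `norm l`. -/
theorem Generic.exists_near {ι : Type} {t : ι → G} (ht : S.Generic t) (x : G) (k : ℕ) :
    ∃ x₁, x⁻¹ * x₁ ∈ S.stab k ∧ ∃ h ∈ S.stab k, ∃ l, k ≤ l ∧ (∀ i, h * t i * h⁻¹ ∈ S.norm l) ∧
      h * x₁ * h⁻¹ ∈ S.norm l := by
  obtain ⟨M, hkM, hM⟩ := S.approx x k
  obtain ⟨M', hM', hx⟩ := exists_conj_le (S := S) x⁻¹ M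
  obtain ⟨h, hh, l, hl, hl'⟩ := ht.1 M'
  obtain ⟨y, hy, hxy⟩ := hM l (hM'.trans hl)
  have hk : S.stab M' ≤ S.stab k := S.anti (hkM.trans hM')
  refine ⟨h⁻¹ * y * h, ?_, h, hk hh, l, hkM.trans (hM'.trans hl), hl', ?_⟩
  · have : x⁻¹ * (h⁻¹ * y * h) = (x⁻¹ * h⁻¹ * x⁻¹⁻¹) * (x⁻¹ * y) * h := by group
    rw [this]
    exact mul_mem (mul_mem (S.anti hkM (hx _ (inv_mem hh))) hxy) (hk hh)
  · have : h * (h⁻¹ * y * h) * h⁻¹ = y := by group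
    rwa [this]

theorem dense_of_forall {O : Set G}
    (h : ∀ (x : G) (k : ℕ), ∃ y ∈ O, x⁻¹ * y ∈ S.stab k) : Dense O := by
  rw [dense_iff_inter_open]
  rintro U hU ⟨x, hx⟩
  have hc : Continuous fun g : G => x * g := by fun_prop
  obtain ⟨k, hk⟩ := S.basis ((fun g : G => x * g) ⁻¹' U)
    ((hU.preimage hc).mem_nhds (by simpa using hx))
  obtain ⟨y, hy, hxy⟩ := h x k
  exact ⟨y, by simpa using hk hxy, hy⟩

/-- Near any `x` congruent to `p₀` modulo `stab n` there is a `y` which, together with the generic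
tuple, satisfies the instance of the extension property given by `p₀` and `p`. -/
theorem Generic.exists_amalgam {ι : Type} {t : ι → G} (ht : S.Generic t) {n n' : ℕ} (hn : n ≤ n')
    {p : ι → G} {p₀ x : G} (hp : ∀ i, p i ∈ S.norm n) (hp' : ∀ i, p i ∈ S.norm n')
    (hp₀ : p₀ ∈ S.norm n) (hp₀' : p₀ ∈ S.norm n')
    (hpt : ∀ i, (p i)⁻¹ * t i ∈ S.stab n) (hpx : p₀⁻¹ * x ∈ S.stab n) (k : ℕ) (hk : n ≤ k) :
    ∃ y, x⁻¹ * y ∈ S.stab k ∧ ∃ h ∈ S.stab n, (∀ i, (p i)⁻¹ * (h * t i * h⁻¹) ∈ S.stab n') ∧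
      p₀⁻¹ * (h * y * h⁻¹) ∈ S.stab n' := by
  obtain ⟨x₁, hx₁, h₁, hh₁, l, hkl, hl, hl'⟩ := ht.exists_near x k
  have hkn : S.stab k ≤ S.stab n := S.anti hk
  have hlk : S.stab l ≤ S.stab k := S.anti hkl
  obtain ⟨L, hlL, c, hc, hcL, hcp⟩ := S.amalg n l n' (hk.trans hkl) hn
  -- conjugation by a small element does not change the congruence with `p`
  have hcong : ∀ q s : G, q ∈ S.norm n → q⁻¹ * s ∈ S.stab n →
      q⁻¹ * (h₁ * s * h₁⁻¹) ∈ S.stab n := fun q s hq hqs => by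
    have : q⁻¹ * (h₁ * s * h₁⁻¹) = (q⁻¹ * h₁ * q) * (q⁻¹ * s) * h₁⁻¹ := by group
    rw [this]
    exact mul_mem (mul_mem (conj_mem' hq (hkn hh₁)) hqs) (inv_mem (hkn hh₁))
  have hnorm : ∀ q s : G, q ∈ S.norm n → q⁻¹ * s ∈ S.stab n → s ∈ S.norm n := fun q s hq hqs => by
    have : s = q * (q⁻¹ * s) := by group
    rw [this]
    exact mul_mem hq (S.stab_le_norm n hqs)
  have ht' := fun i => hcong _ _ (hp i) (hpt i)
  have hx' : p₀⁻¹ * (h₁ * x₁ * h₁⁻¹) ∈ S.stab n := hcong _ _ hp₀ (by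
    have : p₀⁻¹ * x₁ = (p₀⁻¹ * x) * (x⁻¹ * x₁) := by group
    rw [this]
    exact mul_mem hpx (hkn hx₁))
  choose e he₁ he₂ he₃ he₄ using fun i =>
    hcp _ _ (hnorm _ _ (hp i) (ht' i)) (hl i) (hp i) (hp' i) (ht' i)
  obtain ⟨e₀, hf₁, hf₂, hf₃, hf₄⟩ := hcp _ _ (hnorm _ _ hp₀ hx') hl' hp₀ hp₀' hx'
  obtain ⟨h, hh, hhe⟩ := (ht.conj h₁).2 1 l L e hlL he₁ he₂ fun i => by
    have : (e i)⁻¹ * (1 * (h₁ * t i * h₁⁻¹) * 1⁻¹) = ((h₁ * t i * h₁⁻¹)⁻¹ * e i)⁻¹ := by group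
    rw [this]
    exact inv_mem (he₃ i)
  refine ⟨h₁⁻¹ * (h⁻¹ * e₀ * h) * h₁, ?_, c * h * h₁,
    mul_mem (mul_mem hc (hkn (hlk hh))) (hkn hh₁), fun i => ?_, ?_⟩
  · have : x⁻¹ * (h₁⁻¹ * (h⁻¹ * e₀ * h) * h₁) = (x⁻¹ * x₁) * (h₁⁻¹ *
        (((h₁ * x₁ * h₁⁻¹)⁻¹ * h⁻¹ * (h₁ * x₁ * h₁⁻¹)) * ((h₁ * x₁ * h₁⁻¹)⁻¹ * e₀) * h) * h₁) := by
      group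
    rw [this]
    exact mul_mem hx₁ (mul_mem (mul_mem (inv_mem hh₁) (hlk (mul_mem (mul_mem
      (conj_mem' hl' (inv_mem hh)) hf₃) hh))) hh₁)
  · have : (p i)⁻¹ * (c * h * h₁ * t i * (c * h * h₁)⁻¹) = ((p i)⁻¹ * (c * e i * c⁻¹)) *
        (c * ((e i)⁻¹ * (h * (1 * (h₁ * t i * h₁⁻¹) * 1⁻¹) * h⁻¹)) * c⁻¹) := by group
    rw [this]
    exact mul_mem (he₄ i) (hcL _ (hhe i))
  · have : p₀⁻¹ * (c * h * h₁ * (h₁⁻¹ * (h⁻¹ * e₀ * h) * h₁) * (c * h * h₁)⁻¹)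
        = p₀⁻¹ * (c * e₀ * c⁻¹) := by group
    rwa [this]

/-- The elements extending a generic tuple to a generic tuple form a residual set. -/
theorem Generic.eventually_cons [SecondCountableTopology G] {m : ℕ} {t : Fin m → G} (ht : S.Generic t) :
    {x : G | S.Generic (Fin.cons x t : Fin (m + 1) → G)} ∈ residual G := by
  have hinv : ∀ (f : G) (H : Set G), IsOpen H → IsOpen {x : G | f * x * f⁻¹ ∈ H} := fun f H hH =>
    hH.preimage (by fun_prop : Continuous fun x : G => f * x * f⁻¹)
  -- each instance of the first condition holds on a dense open set
  have h1 : ∀ N, {x : G | ∃ h ∈ S.stab N, ∃ n, N ≤ n ∧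
      ∀ i, h * (Fin.cons x t : Fin (m + 1) → G) i * h⁻¹ ∈ S.norm n} ∈ residual G := by
    intro N
    refine residual_of_dense_open ?_ (dense_of_forall (S := S) fun x k => ?_)
    · have : {x : G | ∃ h ∈ S.stab N, ∃ n, N ≤ n ∧
          ∀ i, h * (Fin.cons x t : Fin (m + 1) → G) i * h⁻¹ ∈ S.norm n} =
          ⋃ h ∈ S.stab N, ⋃ n ≥ N, ⋃ (_ : ∀ i, h * t i * h⁻¹ ∈ S.norm n),
            {x | h * x * h⁻¹ ∈ (S.norm n : Set G)} := by
        ext x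
        simp only [Fin.forall_fin_succ, Fin.cons_zero, Fin.cons_succ, Set.mem_iUnion, Set.mem_ofPred_eq,
          SetLike.mem_coe, exists_prop]
        grind
      rw [this]
      exact isOpen_biUnion fun h _ => isOpen_biUnion fun n _ => isOpen_iUnion fun _ =>
        hinv h _ (isOpen_norm n)
    · obtain ⟨x₁, hx₁, h, hh, l, hl, hl', hl''⟩ := ht.exists_near x (max k N)
      refine ⟨x₁, ⟨h, S.anti (le_max_right k N) hh, l, (le_max_right _ _).trans hl, ?_⟩,
        S.anti (le_max_left k N) hx₁⟩
      simpa only [Fin.forall_fin_succ, Fin.cons_zero, Fin.cons_succ] using ⟨hl'', hl'⟩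
  -- so does each instance of the extension property
  have h2 : ∀ (f : G) (n n' : ℕ) (p : Fin (m + 1) → G), n ≤ n' → (∀ i, p i ∈ S.norm n) →
      (∀ i, p i ∈ S.norm n') →
      {x : G | (∀ i, (p i)⁻¹ * (f * (Fin.cons x t : Fin (m + 1) → G) i * f⁻¹) ∈ S.stab n) →
        ∃ h ∈ S.stab n, ∀ i, (p i)⁻¹ * (h * (f * (Fin.cons x t : Fin (m + 1) → G) i * f⁻¹) * h⁻¹)
          ∈ S.stab n'} ∈ residual G := by
    intro f n n' p hn hp hp'
    by_cases hcond : ∀ i : Fin m, (p i.succ)⁻¹ * (f * t i * f⁻¹) ∈ S.stab n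
    swap
    · refine mem_of_superset univ_mem fun x _ hx => (hcond fun i => ?_).elim
      simpa using hx i.succ
    refine residual_of_dense_open ?_ (dense_of_forall (S := S) fun x k => ?_)
    · have : {x : G | (∀ i, (p i)⁻¹ * (f * (Fin.cons x t : Fin (m + 1) → G) i * f⁻¹) ∈ S.stab n) →
          ∃ h ∈ S.stab n, ∀ i, (p i)⁻¹ * (h * (f * (Fin.cons x t : Fin (m + 1) → G) i * f⁻¹) * h⁻¹)
            ∈ S.stab n'} =
          {x | f * x * f⁻¹ ∈ {y | (p 0)⁻¹ * y ∈ (S.stab n : Set G)}ᶜ} ∪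
          ⋃ h ∈ S.stab n, ⋃ (_ : ∀ i : Fin m, (p i.succ)⁻¹ * (h * (f * t i * f⁻¹) * h⁻¹) ∈ S.stab n'),
            {x | (h * f) * x * (h * f)⁻¹ ∈ {y | (p 0)⁻¹ * y ∈ (S.stab n' : Set G)}} := by
        ext x
        have e : ∀ h : G, h * f * x * (h * f)⁻¹ = h * (f * x * f⁻¹) * h⁻¹ := fun h => by group
        simp only [Fin.forall_fin_succ, Fin.cons_zero, Fin.cons_succ, Set.mem_iUnion,
          Set.mem_ofPred_eq, SetLike.mem_coe, exists_prop, Set.mem_union, Set.mem_compl_iff, e]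
        grind
      rw [this]
      have hcl : ∀ k, IsClopen (S.stab k : Set G) := fun k =>
        ⟨(S.stab k).isClosed_of_isOpen (S.isOpen_stab k), S.isOpen_stab k⟩
      have hcont : Continuous fun y : G => (p 0)⁻¹ * y := by fun_prop
      refine (hinv f _ ((hcl n).preimage hcont).compl.isOpen).union ?_
      exact isOpen_biUnion fun h _ => isOpen_iUnion fun _ =>
        hinv (h * f) _ ((hcl n').preimage hcont).isOpen
    · by_cases hx : (p 0)⁻¹ * (f * x * f⁻¹) ∈ S.stab n
      swap
      · exact ⟨x, fun hall => (hx (by simpa using hall 0)).elim, by simp [one_mem]⟩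
      obtain ⟨k', hk', hconj⟩ := exists_conj_le (S := S) f⁻¹ k
      obtain ⟨y, hy, h, hh, hht, hhy⟩ := (ht.conj f).exists_amalgam hn (fun i => hp i.succ)
        (fun i => hp' i.succ) (hp 0) (hp' 0) hcond hx (max k' n) (le_max_right _ _)
      refine ⟨f⁻¹ * y * f, fun _ => ⟨h, hh, ?_⟩, ?_⟩
      · have e : f * (f⁻¹ * y * f) * f⁻¹ = y := by group
        simp only [Fin.forall_fin_succ, Fin.cons_zero, Fin.cons_succ, e]
        exact ⟨hhy, hht⟩
      · have : x⁻¹ * (f⁻¹ * y * f) = f⁻¹ * ((f * x * f⁻¹)⁻¹ * y) * f⁻¹⁻¹ := by group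
        rw [this]
        exact hconj _ (S.anti (le_max_left k' n) hy)
  -- it is enough to let the parameters of the second condition range over a dense sequence
  let d : ℕ → G := TopologicalSpace.denseSeq G
  have hd : ∀ U : Set G, IsOpen U → U.Nonempty → ∃ j, d j ∈ U := fun U hU hne => by
    obtain ⟨_, hy, j, rfl⟩ := (TopologicalSpace.denseRange_denseSeq G).inter_open_nonempty U hU hne
    exact ⟨j, hy⟩
  have h3 : ∀ᶠ x in residual G, ∀ (j n n' : ℕ) (q : Fin (m + 1) → ℕ), n ≤ n' →
      (∀ i, d (q i) ∈ S.norm n) → (∀ i, d (q i) ∈ S.norm n') →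
      (∀ i, (d (q i))⁻¹ * (d j * (Fin.cons x t : Fin (m + 1) → G) i * (d j)⁻¹) ∈ S.stab n) →
        ∃ h ∈ S.stab n, ∀ i, (d (q i))⁻¹ *
          (h * (d j * (Fin.cons x t : Fin (m + 1) → G) i * (d j)⁻¹) * h⁻¹) ∈ S.stab n' := by
    simp only [eventually_countable_forall]
    intro j n n' q hn hp hp'
    exact h2 (d j) n n' (fun i => d (q i)) hn hp hp'
  filter_upwards [eventually_countable_forall.2 h1, h3] with x hx1 hx3
  refine ⟨hx1, fun f n n' p hn hp hp' H => ?_⟩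
  obtain ⟨j, hj⟩ := hd {y | y * f⁻¹ ∈ S.stab n}
    ((S.isOpen_stab n).preimage (by fun_prop : Continuous fun y : G => y * f⁻¹))
    ⟨f, by simp [one_mem]⟩
  choose q hq using fun i => hd {y | (p i)⁻¹ * y ∈ S.stab n'}
    ((S.isOpen_stab n').preimage (by fun_prop : Continuous fun y : G => (p i)⁻¹ * y))
    ⟨p i, by simp [one_mem]⟩
  have hj' : d j * f⁻¹ ∈ S.stab n := hj
  have hq' : ∀ i, (p i)⁻¹ * d (q i) ∈ S.stab n' := hq
  have hqp : ∀ i, d (q i) = p i * ((p i)⁻¹ * d (q i)) := fun i => by group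
  obtain ⟨h, hh, hhx⟩ := hx3 j n n' q hn
    (fun i => by rw [hqp]; exact mul_mem (hp i) (S.stab_le_norm n (S.anti hn (hq' i))))
    (fun i => by rw [hqp]; exact mul_mem (hp' i) (S.stab_le_norm n' (hq' i)))
    (fun i => by
      have : (d (q i))⁻¹ * (d j * (Fin.cons x t : Fin (m + 1) → G) i * (d j)⁻¹) =
        ((p i)⁻¹ * d (q i))⁻¹ * ((p i)⁻¹ * (d j * f⁻¹) * p i) *
        ((p i)⁻¹ * (f * (Fin.cons x t : Fin (m + 1) → G) i * f⁻¹)) * (d j * f⁻¹)⁻¹ := by group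
      rw [this]
      exact mul_mem (mul_mem (mul_mem (inv_mem (S.anti hn (hq' i))) (conj_mem' (hp i) hj')) (H i))
        (inv_mem hj'))
  refine ⟨h * (d j * f⁻¹), mul_mem hh hj', fun i => ?_⟩
  have : (p i)⁻¹ * (h * (d j * f⁻¹) * (f * (Fin.cons x t : Fin (m + 1) → G) i * f⁻¹) *
      (h * (d j * f⁻¹))⁻¹) = ((p i)⁻¹ * d (q i)) * ((d (q i))⁻¹ *
      (h * (d j * (Fin.cons x t : Fin (m + 1) → G) i * (d j)⁻¹) * h⁻¹)) := by group
  rw [this]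
  exact mul_mem (hq' i) (hhx i)

end Generic

end LevelSystem

/-! ### Small powers of sets with countably many translates covering the group -/

namespace LevelSystem

section Polish

variable {G : Type*} [Group G] [TopologicalSpace G] {S : LevelSystem G} [IsTopologicalGroup G]

theorem isClosed_stab (n : ℕ) : IsClosed (S.stab n : Set G) :=
  (S.stab n).isClosed_of_isOpen (S.isOpen_stab n)

omit [IsTopologicalGroup G] in
theorem eq_one_of_forall_mem_stab [T2Space G] {x : G} (h : ∀ n, x ∈ S.stab n) : x = 1 := by
  by_contra hx
  obtain ⟨n, hn⟩ := S.basis {x}ᶜ (isOpen_compl_singleton.mem_nhds fun h => hx h.symm)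
  exact hn (h n) rfl

/-- Two generic tuples which agree modulo `stab n` are conjugate by an element of `stab n`. The
conjugating element is found by going back and forth between the two tuples. -/
theorem Generic.exists_conj_eq [PolishSpace G] {ι : Type} (t : Bool → ι → G)
    (ht : ∀ b, S.Generic (t b)) {n₀ : ℕ} (hn : ∀ i, t false i ∈ S.norm n₀)
    (hcong : ∀ i, (t false i)⁻¹ * t true i ∈ S.stab n₀) :
    ∃ h ∈ S.stab n₀, ∀ i, h * t false i * h⁻¹ = t true i := by
  let := TopologicalSpace.upgradeIsCompletelyMetrizable G
  -- at a stage `(b, X, Y, n)` the tuples `t b` and `t (!b)`, conjugated by `X⁻¹` and `Y⁻¹`, agree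
  -- modulo `stab n`; each step applies genericity and exchanges the roles of the two tuples
  let P : ℕ → Bool × G × G × ℕ → Prop := fun k s => k ≤ s.2.2.2 ∧ n₀ ≤ s.2.2.2 ∧
    s.2.1 ∈ S.stab n₀ ∧ s.2.2.1 ∈ S.stab n₀ ∧
    ∀ i, s.2.1⁻¹ * t s.1 i * s.2.1 ∈ S.norm s.2.2.2 ∧
      (s.2.1⁻¹ * t s.1 i * s.2.1)⁻¹ * (s.2.2.1⁻¹ * t (!s.1) i * s.2.2.1) ∈ S.stab s.2.2.2
  let R : ℕ → Bool × G × G × ℕ → Bool × G × G × ℕ → Prop := fun k s s' => s'.1 = (!s.1) ∧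
    s.2.2.1⁻¹ * s'.2.1 ∈ S.stab s.2.2.2 ∧
    ∃ K ≤ s'.2.2.2, s.2.1⁻¹ * s'.2.2.1 ∈ S.stab K ∧
      ∀ γ ∈ S.stab K, dist s.2.1 (s.2.1 * γ) < (1 / 2) ^ k
  have small : ∀ (X : G) (k n : ℕ), ∃ K, n ≤ K ∧ ∀ γ ∈ S.stab K, dist X (X * γ) < (1 / 2) ^ k := by
    intro X k n
    have hc : Continuous fun γ : G => X * γ := by fun_prop
    obtain ⟨K, hK⟩ := S.basis ((fun γ : G => X * γ) ⁻¹' Metric.ball X ((1 / 2) ^ k))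
      ((Metric.isOpen_ball.preimage hc).mem_nhds (by simp))
    refine ⟨max K n, le_max_right _ _, fun γ hγ => ?_⟩
    have := hK (S.anti (le_max_left K n) hγ)
    rw [dist_comm]; exact this
  obtain ⟨s, hs0, hP, hR⟩ := exists_seq_of_step P R (false, 1, 1, n₀) (by
    refine ⟨Nat.zero_le _, le_rfl, one_mem _, one_mem _, fun i => ?_⟩
    simpa using ⟨hn i, hcong i⟩) (by
    rintro k ⟨b, X, Y, n⟩ ⟨hkn, hn0, hX, hY, H⟩
    dsimp only at hkn hn0 hX hY H
    obtain ⟨K, hK, hK'⟩ := small X k (n + 1)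
    obtain ⟨c, hc, n', hn', hcn⟩ := ((ht b).conj X⁻¹).1 K
    simp only [inv_inv] at hcn
    have hcn0 : c ∈ S.stab n := S.anti ((Nat.le_succ n).trans hK) hc
    obtain ⟨c', hc', H'⟩ := (ht (!b)).2 Y⁻¹ n n' (fun i => c * (X⁻¹ * t b i * X) * c⁻¹)
      ((Nat.le_succ n).trans (hK.trans hn'))
      (fun i => mul_mem (mul_mem (S.stab_le_norm n hcn0) (H i).1)
        (inv_mem (S.stab_le_norm n hcn0))) hcn (fun i => by
        have : (c * (X⁻¹ * t b i * X) * c⁻¹)⁻¹ * (Y⁻¹ * t (!b) i * Y⁻¹⁻¹) =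
          (c * ((X⁻¹ * t b i * X)⁻¹ * c⁻¹ * (X⁻¹ * t b i * X))) *
            ((X⁻¹ * t b i * X)⁻¹ * (Y⁻¹ * t (!b) i * Y)) := by group
        rw [this]
        exact mul_mem (mul_mem hcn0 (conj_mem' (H i).1 (inv_mem hcn0))) (H i).2)
    have e1 : ∀ i, (Y * c'⁻¹)⁻¹ * t (!b) i * (Y * c'⁻¹) = c' * (Y⁻¹ * t (!b) i * Y⁻¹⁻¹) * c'⁻¹ :=
      fun i => by group
    have e2 : ∀ i, (X * c⁻¹)⁻¹ * t b i * (X * c⁻¹) = c * (X⁻¹ * t b i * X) * c⁻¹ :=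
      fun i => by group
    refine ⟨(!b, Y * c'⁻¹, X * c⁻¹, n'), ⟨?_, ?_, ?_, ?_, fun i => ?_⟩, rfl, ?_, K, hn', ?_, hK'⟩
    · show k + 1 ≤ n'
      omega
    · show n₀ ≤ n'
      omega
    · exact mul_mem hY (inv_mem (S.anti hn0 hc'))
    · exact mul_mem hX (inv_mem (S.anti hn0 hcn0))
    · dsimp only
      rw [Bool.not_not, e1, e2]
      have h3 := H' i
      constructor
      · have := mul_mem (hcn i) (S.stab_le_norm n' h3)
        rwa [mul_inv_cancel_left] at this
      · have := inv_mem h3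
        rwa [show ((c * (X⁻¹ * t b i * X) * c⁻¹)⁻¹ * (c' * (Y⁻¹ * t (!b) i * Y⁻¹⁻¹) * c'⁻¹))⁻¹ =
          (c' * (Y⁻¹ * t (!b) i * Y⁻¹⁻¹) * c'⁻¹)⁻¹ * (c * (X⁻¹ * t b i * X) * c⁻¹) by group] at this
    · simpa using inv_mem hc'
    · simpa using inv_mem hc)
  have hb : ∀ k, (s k).1 = (k.bodd) := fun k => by
    induction k with
    | zero => rw [hs0]; rfl
    | succ k ih => rw [(hR k).1, ih, Nat.bodd_succ]
  -- each of the two subsequences of conjugators converges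
  have hXY : ∀ k, dist (s k).2.1 (s (k + 1)).2.2.1 < (1 / 2) ^ k := fun k => by
    obtain ⟨-, -, K, hK, h1, h2⟩ := hR k
    simpa using h2 _ h1
  have hXX : ∀ k, dist (s k).2.1 (s (k + 2)).2.1 < (1 / 2) ^ k := fun k => by
    obtain ⟨-, -, K, hK, h1, h2⟩ := hR k
    have h3 := S.anti hK (hR (k + 1)).2.1
    have := h2 _ (mul_mem h1 h3)
    rwa [show (s k).2.1 * ((s k).2.1⁻¹ * (s (k + 1)).2.2.1 * ((s (k + 1)).2.2.1⁻¹ *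
      (s (k + 1 + 1)).2.1)) = (s (k + 2)).2.1 by group] at this
  have hlim : ∀ r, ∃ v, Tendsto (fun j => (s (2 * j + r)).2.1) atTop (𝓝 v) := fun r =>
    cauchySeq_tendsto_of_complete <| cauchySeq_of_le_geometric (1 / 2) 1 (by norm_num) fun j => by
      rw [one_mul, show 2 * (j + 1) + r = 2 * j + r + 2 by ring]
      refine (hXX (2 * j + r)).le.trans ?_
      exact pow_le_pow_of_le_one (by norm_num) (by norm_num) (by omega)
  obtain ⟨v₀, hv₀⟩ := hlim 0
  obtain ⟨v₁, hv₁⟩ := hlim 1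
  have hv₁' : Tendsto (fun j => (s (2 * j + 2)).2.2.1) atTop (𝓝 v₁) := by
    rw [tendsto_iff_dist_tendsto_zero] at hv₁ ⊢
    have h2 : Tendsto (fun j : ℕ => ((1 : ℝ) / 2) ^ j) atTop (𝓝 0) :=
      tendsto_pow_atTop_nhds_zero_of_lt_one (by norm_num) (by norm_num)
    have h3 := h2.add hv₁
    rw [add_zero] at h3
    refine squeeze_zero (fun _ => dist_nonneg) (fun j => ?_) h3
    refine (dist_triangle _ (s (2 * j + 1)).2.1 _).trans (add_le_add ?_ le_rfl)
    rw [dist_comm]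
    refine (hXY (2 * j + 1)).le.trans ?_
    exact pow_le_pow_of_le_one (by norm_num) (by norm_num) (by omega)
  have hmem₀ : v₀ ∈ S.stab n₀ :=
    (isClosed_stab n₀).mem_of_tendsto hv₀ (Eventually.of_forall fun j => (hP _).2.2.1)
  have hmem₁ : v₁ ∈ S.stab n₀ :=
    (isClosed_stab n₀).mem_of_tendsto hv₁ (Eventually.of_forall fun j => (hP _).2.2.1)
  have hv₀' : Tendsto (fun j => (s (2 * j + 2)).2.1) atTop (𝓝 v₀) := hv₀.comp (tendsto_add_atTop_nat 1)
  have key : ∀ i, (v₀⁻¹ * t false i * v₀)⁻¹ * (v₁⁻¹ * t true i * v₁) = 1 := fun i => by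
    refine eq_one_of_forall_mem_stab (S := S) fun m => ?_
    have hc : Continuous fun p : G × G =>
      (p.1⁻¹ * t false i * p.1)⁻¹ * (p.2⁻¹ * t true i * p.2) := by fun_prop
    refine (isClosed_stab m).mem_of_tendsto ((hc.tendsto (v₀, v₁)).comp (hv₀'.prodMk_nhds hv₁')) ?_
    filter_upwards [eventually_ge_atTop m] with j hj
    obtain ⟨h1, -, -, -, h2⟩ := hP (2 * j + 2)
    have h3 := (h2 i).2
    have h4 : (s (2 * j + 2)).1 = false := by rw [hb]; simp
    rw [h4] at h3
    exact S.anti (by omega) h3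
  refine ⟨v₁ * v₀⁻¹, mul_mem hmem₁ (inv_mem hmem₀), fun i => ?_⟩
  have := inv_mul_eq_one.1 (key i)
  calc v₁ * v₀⁻¹ * t false i * (v₁ * v₀⁻¹)⁻¹ = v₁ * (v₀⁻¹ * t false i * v₀) * v₁⁻¹ := by group
    _ = t true i := by rw [this]; group

theorem mul_left_mem_residual {O : Set G} (hO : O ∈ residual G) (g : G) :
    {x | g * x ∈ O} ∈ residual G :=
  tendsto_residual_of_isOpenMap (continuous_const_mul g) (isOpenMap_mul_left g) hO

/-- A set with countably many translates covering the group is, after a translation, everywhere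
nonmeager in some `stab n`. -/
theorem exists_nonmeager [PolishSpace G] {W : Set G} {k : ℕ → G} (hk : ∀ g, ∃ i, (k i)⁻¹ * g ∈ W) :
    ∃ n, ∃ w₀ ∈ W, ∀ U : Set G, IsOpen U → (∃ u ∈ U, u ∈ S.stab n) → ∀ O ∈ residual G,
      ∃ w ∈ W, w₀⁻¹ * w ∈ U ∧ w₀⁻¹ * w ∈ O := by
  have hW : Wᶜ ∉ residual G := fun h => by
    have h1 : ∀ᶠ g in residual G, ∀ i, (k i)⁻¹ * g ∈ Wᶜ :=
      eventually_countable_forall.2 fun i => mul_left_mem_residual h _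
    obtain ⟨g, hg⟩ := (dense_of_mem_residual h1).nonempty
    obtain ⟨i, hi⟩ := hk g
    exact hg i hi
  -- remove the open sets in which `W` is meagre
  let C : Set (Set G) := {U | IsOpen U ∧ (W ∩ U)ᶜ ∈ residual G}
  have hC : (W ∩ ⋃₀ C)ᶜ ∈ residual G := by
    obtain ⟨T, hT, hTC, hTU⟩ := TopologicalSpace.isOpen_sUnion_countable C fun U hU => hU.1
    have h1 : (⋂ U ∈ T, (W ∩ U)ᶜ) ∈ residual G :=
      (countable_bInter_mem hT).2 fun U hU => (hTC hU).2
    refine mem_of_superset h1 ?_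
    rw [← hTU]
    rintro x hx ⟨hxW, U, hU, hxU⟩
    exact Set.mem_iInter₂.1 hx U hU ⟨hxW, hxU⟩
  have hCo : IsOpen (⋃₀ C) := isOpen_sUnion fun U hU => hU.1
  let V := interior (⋃₀ C)ᶜ
  have hVne : V.Nonempty := by
    by_contra hne
    have hd : Dense (⋃₀ C) := interior_eq_empty_iff_dense_compl.1
      (Set.not_nonempty_iff_eq_empty.1 hne) |>.mono (by simp)
    refine hW (mem_of_superset (inter_mem hC (residual_of_dense_open hCo hd)) ?_)
    rintro x ⟨h1, h2⟩ h3
    exact h1 ⟨h3, h2⟩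
  have hVC : ∀ x ∈ V, x ∉ ⋃₀ C := fun x hx => interior_subset hx
  obtain ⟨w₀, hw₀W, hw₀V⟩ : ∃ w ∈ W, w ∈ V := by
    by_contra! hne
    obtain ⟨x, hx⟩ := hVne
    refine hVC x hx ⟨V, ⟨isOpen_interior, ?_⟩, hx⟩
    rw [show W ∩ V = ∅ from Set.eq_empty_of_forall_notMem fun w hw => hne w hw.1 hw.2]
    simp
  obtain ⟨n, hn⟩ := S.basis ((fun γ : G => w₀ * γ) ⁻¹' V)
    ((isOpen_interior.preimage (continuous_const_mul w₀)).mem_nhds (show w₀ * 1 ∈ V by rwa [mul_one]))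
  refine ⟨n, w₀, hw₀W, fun U hU ⟨u, huU, hun⟩ O hO => ?_⟩
  by_contra! hne
  refine hVC (w₀ * u) (hn hun) ⟨{x | w₀⁻¹ * x ∈ U} ∩ V, ⟨?_, ?_⟩, by simpa using huU, hn hun⟩
  · exact (hU.preimage (continuous_const_mul w₀⁻¹)).inter isOpen_interior
  · refine mem_of_superset (mul_left_mem_residual hO w₀⁻¹) ?_
    rintro x hx ⟨hxW, hxU, -⟩
    exact hne x hxW hxU hx

/-- A symmetric set with countably many translates covering a group with a level system: its
eighth power contains an open subgroup.

Given `g ∈ stab n₀`, there are elements `x k` and `z k` with `w₀ * x k ∈ W` and `w₀ * (g⁻¹ * z k) ∈ W`,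
and small elements `h k` which conjugate `x k` to `z k` and commute with all earlier `x j` and `z j`.
For `a : Set ℕ` let `f a` be the product of the `h k` over `k ∈ a`. As there are uncountably many `a`,
some `f a` and `f b` with `a ≠ b` lie in the same translate of `W`. At the first `n` where `a` and `b`
differ, say `n ∈ a`, the element `(f b)⁻¹ * f a` of `W ^ 2` conjugates `x n` to `z n`, which
expresses `g` as an element of `W ^ 8`. -/
theorem exists_stab_subset_pow [PolishSpace G] {W : Set G} (hsymm : ∀ w ∈ W, w⁻¹ ∈ W) {k : ℕ → G}
    (hk : ∀ g, ∃ i, (k i)⁻¹ * g ∈ W) : ∃ n, (S.stab n : Set G) ⊆ W ^ 8 := by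
  obtain ⟨n₀, w₀, hw₀, hmeet⟩ := exists_nonmeager (S := S) hk
  refine ⟨n₀, fun g hg => ?_⟩
  let := TopologicalSpace.upgradeIsCompletelyMetrizable G
  -- stages: a generic tuple, the finitely many partial products, and the latest `x`, `z`, `h`
  let Q := (Σ m, (Fin m → G)) × Finset G × G × G × G
  let P : ℕ → Q → Prop := fun _ s => S.Generic s.1.2
  let R : ℕ → Q → Q → Prop := fun k s s' =>
    (∀ x ∈ Set.range s.1.2, s'.2.2.2.2 * x * s'.2.2.2.2⁻¹ = x) ∧
    Set.range s.1.2 ⊆ Set.range s'.1.2 ∧ s'.2.2.1 ∈ Set.range s'.1.2 ∧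
    s'.2.2.2.1 ∈ Set.range s'.1.2 ∧ s'.2.2.2.2 * s'.2.2.1 * s'.2.2.2.2⁻¹ = s'.2.2.2.1 ∧
    w₀ * s'.2.2.1 ∈ W ∧ w₀ * (g⁻¹ * s'.2.2.2.1) ∈ W ∧ ∀ u ∈ s.2.1, u ∈ s'.2.1 ∧
    u * s'.2.2.2.2 ∈ s'.2.1 ∧ dist u (u * s'.2.2.2.2) < (1 / 2) ^ k
  obtain ⟨s, hs0, -, hR⟩ := exists_seq_of_step P R
    (⟨0, Fin.elim0⟩, ({1} : Finset G), 1, 1, 1) (by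
    refine ⟨fun N => ⟨1, one_mem _, N, le_rfl, fun i => i.elim0⟩,
      fun f n n' p hn _ _ _ => ⟨1, one_mem _, fun i => i.elim0⟩⟩) (by
    classical
    rintro k ⟨⟨m, t⟩, F, -⟩ (ht : S.Generic t)
    obtain ⟨M, hM⟩ := S.basis (⋂ u ∈ F, (fun γ : G => u * γ) ⁻¹' Metric.ball u ((1 / 2) ^ k)) (by
      rw [Filter.biInter_finset_mem]
      intro u _
      exact (Metric.isOpen_ball.preimage (continuous_const_mul u)).mem_nhds (by simp))
    obtain ⟨h₁, hh₁, l, hl, hl'⟩ := ht.1 M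
    have hΓo : IsOpen {γ : G | h₁ * γ * h₁⁻¹ ∈ S.stab l} :=
      (S.isOpen_stab l).preimage (by fun_prop : Continuous fun γ : G => h₁ * γ * h₁⁻¹)
    obtain ⟨w, hwW, hw1, hw2⟩ := hmeet _ hΓo ⟨1, by simp [one_mem], one_mem _⟩ _ ht.eventually_cons
    set x := w₀⁻¹ * w with hx
    have hx2 : S.Generic (Fin.cons x t : Fin (m + 1) → G) := hw2
    obtain ⟨w', hw'W, hw'1, hw'2⟩ := hmeet {γ | g * γ ∈ {γ : G | h₁ * γ * h₁⁻¹ ∈ S.stab l}}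
      (hΓo.preimage (continuous_const_mul g)) ⟨g⁻¹, by simp [one_mem], inv_mem hg⟩ _
      (mul_left_mem_residual (inter_mem ht.eventually_cons hx2.eventually_cons) g)
    set z := g * (w₀⁻¹ * w') with hz
    have hz2 : S.Generic (Fin.cons z t : Fin (m + 1) → G) := hw'2.1
    have hz3 : S.Generic (Fin.cons z (Fin.cons x t : Fin (m + 1) → G) : Fin (m + 2) → G) := hw'2.2
    have hxl : h₁ * x * h₁⁻¹ ∈ S.stab l := hw1
    have hzl : h₁ * z * h₁⁻¹ ∈ S.stab l := hw'1
    obtain ⟨h₂, hh₂, H⟩ := Generic.exists_conj_eq (S := S)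
      (fun b i => h₁ * (Fin.cons (cond b z x) t : Fin (m + 1) → G) i * h₁⁻¹)
      (Bool.forall_bool.2 ⟨hx2.conj h₁, hz2.conj h₁⟩) (n₀ := l)
      (by
        simp only [cond_false, Fin.forall_fin_succ, Fin.cons_zero, Fin.cons_succ]
        exact ⟨S.stab_le_norm l hxl, hl'⟩)
      (by
        simp only [cond_false, cond_true, Fin.forall_fin_succ, Fin.cons_zero, Fin.cons_succ]
        refine ⟨mul_mem (inv_mem hxl) hzl, fun i => ?_⟩
        rw [inv_mul_cancel]; exact one_mem _)
    simp only [cond_false, cond_true, Fin.forall_fin_succ, Fin.cons_zero, Fin.cons_succ] at H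
    have hconj : ∀ y y', h₂ * (h₁ * y * h₁⁻¹) * h₂⁻¹ = h₁ * y' * h₁⁻¹ →
        (h₁⁻¹ * h₂ * h₁) * y * (h₁⁻¹ * h₂ * h₁)⁻¹ = y' := fun y y' hyy => by
      have : (h₁⁻¹ * h₂ * h₁) * y * (h₁⁻¹ * h₂ * h₁)⁻¹ =
        h₁⁻¹ * (h₂ * (h₁ * y * h₁⁻¹) * h₂⁻¹) * h₁ := by group
      rw [this, hyy]; group
    have hmem : h₁⁻¹ * h₂ * h₁ ∈ S.stab M :=
      mul_mem (mul_mem (inv_mem hh₁) (S.anti hl hh₂)) hh₁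
    refine ⟨(⟨m + 2, Fin.cons z (Fin.cons x t : Fin (m + 1) → G)⟩,
      F ∪ F.image (fun u => u * (h₁⁻¹ * h₂ * h₁)), x, z, h₁⁻¹ * h₂ * h₁), hz3, ?_, ?_, ?_, ?_,
      hconj _ _ H.1, ?_, ?_, ?_⟩
    · rintro _ ⟨i, rfl⟩
      exact hconj _ _ (H.2 i)
    · rintro _ ⟨i, rfl⟩
      exact ⟨i.succ.succ, by simp⟩
    · exact ⟨Fin.succ 0, by simp⟩
    · exact ⟨0, by simp⟩
    · simpa [hx] using hwW
    · simpa [hz] using hw'W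
    · intro u hu
      refine ⟨Finset.mem_union_left _ hu, Finset.mem_union_right _ (Finset.mem_image_of_mem _ hu), ?_⟩
      have := Set.mem_iInter₂.1 (hM hmem) u hu
      rw [dist_comm]; exact this)
  let x : ℕ → G := fun k => (s (k + 1)).2.2.1
  let z : ℕ → G := fun k => (s (k + 1)).2.2.2.1
  let h : ℕ → G := fun k => (s (k + 1)).2.2.2.2
  have hrange : Monotone fun k => Set.range (s k).1.2 :=
    monotone_nat_of_le_succ fun k => (hR k).2.1
  have hcx : ∀ j k, j < k → h k * x j * (h k)⁻¹ = x j := fun j k hjk =>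
    (hR k).1 _ (hrange (Nat.succ_le_of_lt hjk) (hR j).2.2.1)
  have hcz : ∀ j k, j < k → h k * z j * (h k)⁻¹ = z j := fun j k hjk =>
    (hR k).1 _ (hrange (Nat.succ_le_of_lt hjk) (hR j).2.2.2.1)
  have hxz : ∀ k, h k * x k * (h k)⁻¹ = z k := fun k => (hR k).2.2.2.2.1
  classical
  -- the infinite products of the `h k` over `k ∈ a`
  let u : Set ℕ → ℕ → G := fun a n => Nat.rec 1 (fun k p => if k ∈ a then p * h k else p) n
  have hu : ∀ a k, u a (k + 1) = if k ∈ a then u a k * h k else u a k := fun a k => rfl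
  have huF : ∀ a k, u a k ∈ (s k).2.1 := fun a k => by
    induction k with
    | zero => rw [hs0]; exact Finset.mem_singleton_self _
    | succ k ih =>
      obtain ⟨h1, h2, -⟩ := (hR k).2.2.2.2.2.2.2 _ ih
      rw [hu]; split_ifs
      exacts [h2, h1]
  have hlim : ∀ a, ∃ f, Tendsto (u a) atTop (𝓝 f) := fun a =>
    cauchySeq_tendsto_of_complete <| cauchySeq_of_le_geometric (1 / 2) 1 (by norm_num) fun k => by
      rw [one_mul, hu]; split_ifs
      · exact ((hR k).2.2.2.2.2.2.2 _ (huF a k)).2.2.le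
      · rw [dist_self]; positivity
  choose f hf using hlim
  choose idx hidx using fun a => hk (f a)
  obtain ⟨a, b, hab, hne⟩ : ∃ a b, idx a = idx b ∧ a ≠ b := by
    have := Function.cantor_injective idx
    simpa [Function.Injective] using this
  -- look at the first place where `a` and `b` differ
  have hex : ∃ n, ¬ (n ∈ a ↔ n ∈ b) := by
    by_contra! hall
    exact hne (Set.ext hall)
  let n := Nat.find hex
  have hn : ¬ (n ∈ a ↔ n ∈ b) := Nat.find_spec hex
  wlog hna : n ∈ a ∧ n ∉ b generalizing a b
  · have hswap : ∀ m, (m ∈ b ↔ m ∈ a) ↔ (m ∈ a ↔ m ∈ b) := fun m => Iff.comm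
    have hex' : ∃ n, ¬ (n ∈ b ↔ n ∈ a) := by simpa only [hswap] using hex
    have hnn : Nat.find hex' = n := Nat.find_congr' (fun {m} => not_congr (hswap m))
    refine this b a hab.symm (Ne.symm hne) hex' ?_ ?_
    · rw [hnn]; tauto
    · rw [hnn]; tauto
  have huab : ∀ m ≤ n, u a m = u b m := fun m hm => by
    induction m with
    | zero => rfl
    | succ m ih =>
      have h1 : m ∈ a ↔ m ∈ b := by
        by_contra h1
        exact Nat.find_min hex (Nat.lt_of_succ_le hm) h1
      rw [hu, hu, ih (by omega)]
      simp only [h1]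
  have ha : ∀ k, u a (n + 1 + k) * x n * (u a (n + 1 + k))⁻¹ = u a n * z n * (u a n)⁻¹ := fun k => by
    induction k with
    | zero =>
      rw [add_zero, hu, if_pos hna.1, ← hxz n]; group
    | succ k ih =>
      rw [← add_assoc, hu, ← ih]
      split_ifs
      · nth_rewrite 2 [← hcx n (n + 1 + k) (by omega)]; group
      · rfl
  have hb : ∀ k, u b (n + 1 + k) * z n * (u b (n + 1 + k))⁻¹ = u a n * z n * (u a n)⁻¹ := fun k => by
    induction k with
    | zero =>
      rw [add_zero, hu, if_neg hna.2, huab n le_rfl]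
    | succ k ih =>
      rw [← add_assoc, hu, ← ih]
      split_ifs
      · nth_rewrite 2 [← hcz n (n + 1 + k) (by omega)]; group
      · rfl
  have hpass : ∀ (c : Set ℕ) (y y' : G), (∀ k, u c (n + 1 + k) * y * (u c (n + 1 + k))⁻¹ = y') →
      f c * y * (f c)⁻¹ = y' := fun c y y' hc => by
    have hcont : Continuous fun p : G => p * y * p⁻¹ := by fun_prop
    refine tendsto_nhds_unique ((hcont.tendsto (f c)).comp
      ((hf c).comp (tendsto_add_atTop_nat (n + 1)))) ?_
    refine tendsto_const_nhds.congr fun k => ?_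
    rw [← hc k, add_comm (n + 1) k]
    rfl
  have hfa := hpass a _ _ ha
  have hfb := hpass b _ _ hb
  have hz : z n = ((f b)⁻¹ * f a) * x n * ((f b)⁻¹ * f a)⁻¹ := by
    have : z n = (f b)⁻¹ * (f b * z n * (f b)⁻¹) * f b := by group
    rw [this, hfb, ← hfa]; group
  have hW2 : (f b)⁻¹ * f a ∈ W ^ 2 := by
    have : (f b)⁻¹ * f a = ((k (idx b))⁻¹ * f b)⁻¹ * ((k (idx b))⁻¹ * f a) := by group
    rw [this, pow_two]
    refine Set.mul_mem_mul (hsymm _ (hidx b)) ?_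
    rw [← hab]; exact hidx a
  have hW2' : ((f b)⁻¹ * f a)⁻¹ ∈ W ^ 2 := by
    have : ((f b)⁻¹ * f a)⁻¹ = ((k (idx b))⁻¹ * f a)⁻¹ * ((k (idx b))⁻¹ * f b) := by group
    rw [this, pow_two]
    refine Set.mul_mem_mul ?_ (hidx b)
    rw [← hab]; exact hsymm _ (hidx a)
  have hxW : w₀ * x n ∈ W := (hR n).2.2.2.2.2.1
  have hzW : w₀ * (g⁻¹ * z n) ∈ W := (hR n).2.2.2.2.2.2.1
  have hg' : g = ((f b)⁻¹ * f a) * (w₀⁻¹ * (w₀ * x n)) * ((f b)⁻¹ * f a)⁻¹ *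
      ((w₀ * (g⁻¹ * z n))⁻¹ * w₀) := by
    have : ((f b)⁻¹ * f a) * (w₀⁻¹ * (w₀ * x n)) * ((f b)⁻¹ * f a)⁻¹ = z n := by rw [hz]; group
    rw [this]; group
  rw [hg', show W ^ 8 = W ^ 2 * (W * W) * W ^ 2 * (W * W) by
    rw [← pow_two, ← pow_add, ← pow_add, ← pow_add]]
  exact Set.mul_mem_mul (Set.mul_mem_mul (Set.mul_mem_mul hW2
    (Set.mul_mem_mul (hsymm _ hw₀) hxW)) hW2') (Set.mul_mem_mul (hsymm _ hzW) hw₀)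

end Polish

end LevelSystem

namespace ProbAlg

variable {B : Type*} [BooleanAlgebra B] [MetricSpace B] [ProbAlg B]

/-! ### Extending isomorphisms of dense subalgebras -/

/-- A measure preserving correspondence between dense subsets, compatible with suprema, extends to
an automorphism. -/
theorem exists_aut_of_dense {ι : Type*} {φ ψ : ι → B} (hφ : DenseRange φ) (hψ : DenseRange ψ)
    (hd : ∀ i j, dist (φ i) (φ j) = dist (ψ i) (ψ j))
    (hs : ∀ i j, ∃ k, φ k = φ i ⊔ φ j ∧ ψ k = ψ i ⊔ ψ j) : ∃ g : Aut B, ∀ i, g • φ i = ψ i := by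
  -- approximations of an arbitrary element
  have happ : ∀ {φ : ι → B}, DenseRange φ → ∀ x : B, ∃ s : ℕ → ι, Tendsto (fun n => φ (s n)) atTop (𝓝 x) := by
    intro φ hφ x
    obtain ⟨u, hu, hux⟩ := mem_closure_iff_seq_limit.1 (hφ x)
    choose s hs using hu
    exact ⟨s, by simpa only [hs] using hux⟩
  have hlim : ∀ {φ ψ : ι → B}, (∀ i j, dist (φ i) (φ j) = dist (ψ i) (ψ j)) → ∀ (s : ℕ → ι) (x : B),
      Tendsto (fun n => φ (s n)) atTop (𝓝 x) → ∃ y, Tendsto (fun n => ψ (s n)) atTop (𝓝 y) := by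
    intro φ ψ hd s x hx
    refine cauchySeq_tendsto_of_complete (Metric.cauchySeq_iff.2 fun ε hε => ?_)
    obtain ⟨N, hN⟩ := Metric.cauchySeq_iff.1 hx.cauchySeq ε hε
    exact ⟨N, fun m hm n hn => by rw [← hd]; exact hN m hm n hn⟩
  choose s hs1 using happ hφ
  choose t ht1 using happ hψ
  choose f hf using fun x => hlim hd (s x) x (hs1 x)
  choose f' hf' using fun x => hlim (fun i j => (hd i j).symm) (t x) x (ht1 x)
  -- any approximation computes the extension
  have huniq : ∀ {φ ψ : ι → B}, (∀ i j, dist (φ i) (φ j) = dist (ψ i) (ψ j)) → ∀ (s t : ℕ → ι) (x y : B),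
      Tendsto (fun n => φ (s n)) atTop (𝓝 x) → Tendsto (fun n => ψ (s n)) atTop (𝓝 y) →
      Tendsto (fun n => φ (t n)) atTop (𝓝 x) → Tendsto (fun n => ψ (t n)) atTop (𝓝 y) := by
    intro φ ψ hd s t x y h1 h2 h3
    have h4 := h3.dist h1
    rw [dist_self] at h4
    rw [tendsto_iff_dist_tendsto_zero] at h2 ⊢
    refine squeeze_zero (fun _ => dist_nonneg) (fun n => ?_) (by simpa using h4.add h2)
    rw [hd]
    exact dist_triangle _ _ _
  have hfd : ∀ a b, dist (f a) (f b) = dist a b := fun a b =>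
    tendsto_nhds_unique ((hf a).dist (hf b)) (by simp only [← hd]; exact (hs1 a).dist (hs1 b))
  have h1 : ∀ a, f (f' a) = a := fun a =>
    tendsto_nhds_unique (huniq hd _ _ _ _ (hs1 _) (hf _) (hf' a)) (ht1 a)
  have h2 : ∀ a, f' (f a) = a := fun a =>
    tendsto_nhds_unique (huniq (fun i j => (hd i j).symm) _ _ _ _ (ht1 _) (hf' _) (hf a)) (hs1 a)
  have h3 : ∀ a b, f (a ⊔ b) = f a ⊔ f b := fun a b => by
    choose k hk using hs
    have h4 : Tendsto (fun n => φ (k (s a n) (s b n))) atTop (𝓝 (a ⊔ b)) := by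
      simp only [(hk _ _).1]
      exact tendsto_sup (hs1 a) (hs1 b)
    have h5 : Tendsto (fun n => ψ (k (s a n) (s b n))) atTop (𝓝 (f a ⊔ f b)) := by
      simp only [(hk _ _).2]
      exact tendsto_sup (hf a) (hf b)
    exact tendsto_nhds_unique (huniq hd _ _ _ _ (hs1 _) (hf _) h4) h5
  obtain ⟨g, hg, -⟩ := exists_aut_of_isometry f f' h1 h2 hfd h3
  refine ⟨g, fun i => ?_⟩
  rw [hg]
  exact tendsto_nhds_unique (huniq hd _ (fun _ => i) _ _ (hs1 _) (hf _) tendsto_const_nhds)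
    tendsto_const_nhds

omit [MetricSpace B] [ProbAlg B] in
theorem finset_sup_sdiff {κ : Type*} [DecidableEq κ] {q : κ → B} (hq : Pairwise (Function.onFun Disjoint q))
    (S T : Finset κ) : S.sup q \ T.sup q = (S \ T).sup q := by
  refine le_antisymm ?_ ?_
  · rw [sdiff_le_iff, Finset.sup_le_iff]
    intro x hx
    by_cases h : x ∈ T
    · exact le_sup_of_le_left (Finset.le_sup h)
    · exact le_sup_of_le_right (Finset.le_sup (Finset.mem_sdiff.2 ⟨hx, h⟩))
  · rw [le_sdiff]
    refine ⟨Finset.sup_mono Finset.sdiff_subset, ?_⟩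
    rw [Finset.disjoint_sup_left]
    intro x hx
    rw [Finset.disjoint_sup_right]
    intro y hy
    exact hq fun h => (Finset.mem_sdiff.1 hx).2 (h ▸ hy)

omit [MetricSpace B] [ProbAlg B] in
theorem finset_sup_inf {κ : Type*} [DecidableEq κ] {q : κ → B} (hq : Pairwise (Function.onFun Disjoint q))
    (S T : Finset κ) : S.sup q ⊓ T.sup q = (S ∩ T).sup q := by
  rw [← sdiff_sdiff_right_self, finset_sup_sdiff hq, finset_sup_sdiff hq, Finset.sdiff_sdiff_self_left]

/-- Two dense refining sequences of finite partitions whose atoms have the same measures are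
conjugate by an automorphism. -/
theorem exists_aut_of_refining {κ : ℕ → Type} [∀ k, Fintype (κ k)] [∀ k, DecidableEq (κ k)]
    (π : ∀ k, κ (k + 1) → κ k) {q r : ∀ k, κ k → B}
    (hq : ∀ k, Pairwise (Function.onFun Disjoint (q k)))
    (hr : ∀ k, Pairwise (Function.onFun Disjoint (r k)))
    (hqπ : ∀ k x, q k x = {y | π k y = x}.toFinset.sup (q (k + 1)))
    (hrπ : ∀ k x, r k x = {y | π k y = x}.toFinset.sup (r (k + 1)))
    (hqd : DenseRange fun i : Σ k, Finset (κ k) => i.2.sup (q i.1))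
    (hrd : DenseRange fun i : Σ k, Finset (κ k) => i.2.sup (r i.1))
    (hv : ∀ k x, vol (q k x) = vol (r k x)) : ∃ g : Aut B, ∀ k x, g • q k x = r k x := by
  -- passing to a later level
  have lift1 : ∀ k (S : Finset (κ k)), ∃ S' : Finset (κ (k + 1)),
      S'.sup (q (k + 1)) = S.sup (q k) ∧ S'.sup (r (k + 1)) = S.sup (r k) := by
    intro k S
    have : ∀ q : ∀ k, κ k → B, (∀ k x, q k x = {y | π k y = x}.toFinset.sup (q (k + 1))) →
        (S.biUnion fun x => {y | π k y = x}.toFinset).sup (q (k + 1)) = S.sup (q k) := fun q hq => by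
      rw [Finset.sup_biUnion]
      exact Finset.sup_congr rfl fun x _ => (hq k x).symm
    exact ⟨_, this q hqπ, this r hrπ⟩
  have lift : ∀ k m (S : Finset (κ k)), k ≤ m → ∃ S' : Finset (κ m),
      S'.sup (q m) = S.sup (q k) ∧ S'.sup (r m) = S.sup (r k) := by
    intro k m S hkm
    induction m, hkm using Nat.le_induction with
    | base => exact ⟨S, rfl, rfl⟩
    | succ m _ ih =>
      obtain ⟨S', h1, h2⟩ := ih
      obtain ⟨S'', h3, h4⟩ := lift1 m S'
      exact ⟨S'', h3.trans h1, h4.trans h2⟩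
  have common : ∀ i j : Σ k, Finset (κ k), ∃ m, ∃ S T : Finset (κ m),
      (S.sup (q m) = i.2.sup (q i.1) ∧ S.sup (r m) = i.2.sup (r i.1)) ∧
      T.sup (q m) = j.2.sup (q j.1) ∧ T.sup (r m) = j.2.sup (r j.1) := fun i j => by
    obtain ⟨S, hS⟩ := lift i.1 (max i.1 j.1) i.2 (le_max_left _ _)
    obtain ⟨T, hT⟩ := lift j.1 (max i.1 j.1) j.2 (le_max_right _ _)
    exact ⟨_, S, T, hS, hT⟩
  obtain ⟨g, hg⟩ := exists_aut_of_dense hqd hrd (fun i j => by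
    obtain ⟨m, S, T, ⟨h1, h2⟩, h3, h4⟩ := common i j
    rw [← h1, ← h2, ← h3, ← h4, dist_eq_add, dist_eq_add]
    simp only [finset_sup_sdiff (hq m), finset_sup_sdiff (hr m)]
    rw [vol_finset_sup _ _ fun i _ j _ h => hq m h, vol_finset_sup _ _ fun i _ j _ h => hq m h,
      vol_finset_sup _ _ fun i _ j _ h => hr m h, vol_finset_sup _ _ fun i _ j _ h => hr m h]
    simp only [hv]) (fun i j => by
    obtain ⟨m, S, T, ⟨h1, h2⟩, h3, h4⟩ := common i j
    refine ⟨⟨m, S ∪ T⟩, ?_, ?_⟩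
    · simp only [Finset.sup_union, h1, h3]
    · simp only [Finset.sup_union, h2, h4])
  refine ⟨g, fun k x => ?_⟩
  simpa using hg ⟨k, {x}⟩

/-! ### Dyadic trees -/

/-- An element can be halved so that one of the halves is not cut by a given element `c`. -/
theorem exists_half (a c : B) : ∃ b ≤ a, vol b = vol a / 2 ∧ (b ≤ c ∨ a ⊓ c ≤ b) := by
  have h1 := vol_inf_add_vol_sdiff a c
  have h2 := vol_nonneg a
  have h3 := vol_nonneg (a ⊓ c)
  by_cases h : vol a / 2 ≤ vol (a ⊓ c)
  · obtain ⟨b, hb, hv⟩ := exists_le_vol_eq (a ⊓ c) (vol a / 2) (by linarith) h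
    exact ⟨b, hb.trans inf_le_left, hv, Or.inl (hb.trans inf_le_right)⟩
  · obtain ⟨b, hb, hv⟩ := exists_le_vol_eq (a \ c) (vol a / 2 - vol (a ⊓ c)) (by linarith)
      (by linarith)
    refine ⟨a ⊓ c ⊔ b, sup_le inf_le_left (hb.trans sdiff_le), ?_, Or.inr le_sup_left⟩
    rw [vol_sup, hv]
    · ring
    · exact disjoint_inf_sdiff.mono_right hb

/-- A dyadic tree below `e`: successive halvings, indexed by binary words, generating a dense set
of elements below `e`. -/
structure Tree (e : B) where
  /-- The node indexed by a binary word. -/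
  node : ∀ n, (Fin n → Bool) → B
  node_zero : ∀ w, node 0 w = e
  node_succ : ∀ n w, node n w = node (n + 1) (Fin.snoc w true) ⊔ node (n + 1) (Fin.snoc w false)
  disj : ∀ n, Pairwise (Function.onFun Disjoint (node n))
  vol_node : ∀ n w, vol (node n w) = vol e / 2 ^ n
  dense : ∀ x ≤ e, ∀ ε > 0, ∃ n, ∃ S : Finset (Fin n → Bool), dist x (S.sup (node n)) < ε

/-- A sequence taking each value of `d` infinitely often. -/
theorem exists_seq_forall_frequently {α : Type*} (d : ℕ → α) : ∃ s : ℕ → α, ∀ m N, ∃ n ≥ N, s n = d m :=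
  ⟨fun n => d n.unpair.1, fun m N => ⟨Nat.pair m N, Nat.right_le_pair m N, by simp⟩⟩

/-- Every element has a dyadic tree. The halvings of level `n` avoid cutting an element `c n`, where `c`
takes each value of a dense sequence infinitely often; each such level at least halves the measure of
the nodes cut by that value. -/
theorem nonempty_tree (e : B) : Nonempty (Tree e) := by
  classical
  choose half half_le vol_half half_cut using fun a c : B => exists_half a c
  obtain ⟨c, hc⟩ := exists_seq_forall_frequently (TopologicalSpace.denseSeq B)
  obtain ⟨q, hq0, hq⟩ : ∃ q : ∀ n, (Fin n → Bool) → B, (∀ w, q 0 w = e) ∧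
      ∀ n w, q (n + 1) w = if w (Fin.last n) then half (q n (Fin.init w)) (c n)
        else q n (Fin.init w) \ half (q n (Fin.init w)) (c n) :=
    ⟨fun n => Nat.rec (fun _ => e) (fun n q w =>
      if w (Fin.last n) then half (q (Fin.init w)) (c n)
      else q (Fin.init w) \ half (q (Fin.init w)) (c n)) n, fun _ => rfl, fun _ _ => rfl⟩
  have ht : ∀ n w, q (n + 1) (Fin.snoc w true) = half (q n w) (c n) := fun n w => by
    rw [hq, Fin.snoc_last, if_pos rfl, Fin.init_snoc]
  have hf : ∀ n w, q (n + 1) (Fin.snoc w false) = q n w \ half (q n w) (c n) := fun n w => by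
    rw [hq, Fin.snoc_last, if_neg (by simp), Fin.init_snoc]
  have hvol : ∀ n w, vol (q n w) = vol e / 2 ^ n := fun n => by
    induction n with
    | zero => intro w; simp [hq0]
    | succ n ih =>
      intro w
      rw [hq]
      split_ifs
      · rw [vol_half, ih]; ring
      · rw [vol_sdiff (half_le _ _), vol_half, ih]; ring
  have hdisj : ∀ n, Pairwise (Function.onFun Disjoint (q n)) := fun n => by
    induction n with
    | zero => intro w w' h; exact (h (Subsingleton.elim _ _)).elim
    | succ n ih =>
      have hle : ∀ w, q (n + 1) w ≤ q n (Fin.init w) := fun w => by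
        rw [hq]; split_ifs
        exacts [half_le _ _, sdiff_le]
      intro w w' h
      by_cases hi : (Fin.init w : Fin n → Bool) = Fin.init w'
      · have hl : w (Fin.last n) ≠ w' (Fin.last n) := fun hl => h (by
          rw [← Fin.snoc_init_self w, ← Fin.snoc_init_self w', hi, hl])
        change Disjoint (q (n + 1) w) (q (n + 1) w')
        rw [hq, hq, hi]
        cases h1 : w (Fin.last n) <;> cases h2 : w' (Fin.last n) <;>
          simp_all [disjoint_sdiff_self_left, disjoint_sdiff_self_right]
      · exact (ih hi).mono (hle w) (hle w')
  have hsucc : ∀ n w, q n w = q (n + 1) (Fin.snoc w true) ⊔ q (n + 1) (Fin.snoc w false) := fun n w => by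
    rw [ht, hf, sup_sdiff_cancel_right (half_le _ _)]
  have hsum : ∀ (n : ℕ) (f : (Fin (n + 1) → Bool) → ℕ),
      ∑ w, f w = ∑ w : Fin n → Bool, (f (Fin.snoc w true) + f (Fin.snoc w false)) := fun n f => by
    rw [← (Fin.snocEquiv fun _ : Fin (n + 1) => Bool).sum_comp f, Fintype.sum_prod_type,
      Fintype.sum_bool, ← Finset.sum_add_distrib]
    rfl
  have hcover : ∀ n, Finset.univ.sup (q n) = e := fun n => by
    induction n with
    | zero => simp [hq0]
    | succ n ih =>
      refine le_antisymm (Finset.sup_le fun w _ => ?_) ?_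
      · rw [← ih]
        refine le_trans ?_ (Finset.le_sup (Finset.mem_univ (Fin.init w)))
        rw [hq]; split_ifs
        exacts [half_le _ _, sdiff_le]
      · rw [← ih]
        refine Finset.sup_le fun w _ => ?_
        rw [hsucc]
        exact sup_le (Finset.le_sup (Finset.mem_univ _)) (Finset.le_sup (Finset.mem_univ _))
  refine ⟨⟨q, hq0, hsucc, hdisj, hvol, ?_⟩⟩
  intro x hx ε hε
  obtain ⟨m, hm⟩ := (TopologicalSpace.denseRange_denseSeq B).exists_dist_lt x (by positivity : 0 < ε / 3)
  set d := TopologicalSpace.denseSeq B m with hd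
  -- the number of nodes at level `n` which are cut by `d`
  let bad : ∀ n, (Fin n → Bool) → ℕ := fun n w => if q n w ≤ d ∨ Disjoint (q n w) d then 0 else 1
  let N : ℕ → ℕ := fun n => ∑ w, bad n w
  have hN2 : ∀ n, N (n + 1) ≤ 2 * N n := fun n => by
    rw [show N (n + 1) = _ from hsum n _, Finset.mul_sum]
    refine Finset.sum_le_sum fun w _ => ?_
    dsimp only [bad]
    by_cases hg : q n w ≤ d ∨ Disjoint (q n w) d
    · have h1 := hsucc n w
      have h2 : ∀ y, y ≤ q n w → (y ≤ d ∨ Disjoint y d) := fun y hy =>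
        hg.imp hy.trans fun h => h.mono_left hy
      rw [if_pos (h2 _ (h1 ▸ le_sup_left)), if_pos (h2 _ (h1 ▸ le_sup_right))]
      simp
    · rw [if_neg hg]; split_ifs <;> simp
  have hN1 : ∀ n, c n = d → N (n + 1) ≤ N n := fun n hn => by
    rw [show N (n + 1) = _ from hsum n _]
    refine Finset.sum_le_sum fun w _ => ?_
    dsimp only [bad]
    by_cases hg : q n w ≤ d ∨ Disjoint (q n w) d
    · have h1 := hsucc n w
      have h2 : ∀ y, y ≤ q n w → (y ≤ d ∨ Disjoint y d) := fun y hy =>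
        hg.imp hy.trans fun h => h.mono_left hy
      rw [if_pos (h2 _ (h1 ▸ le_sup_left)), if_pos (h2 _ (h1 ▸ le_sup_right))]
      simp
    · rw [if_neg hg, ht, hf, hn]
      rcases half_cut (q n w) d with h | h
      · rw [if_pos (Or.inl h)]; split_ifs <;> simp
      · have h3 : Disjoint (q n w \ half (q n w) d) d := by
          rw [disjoint_iff, sdiff_inf_right_comm, sdiff_eq_bot_iff]; exact h
        rw [add_comm, if_pos (Or.inr h3)]; split_ifs <;> simp
  -- their total measure
  let β : ℕ → ℝ := fun n => N n * (vol e / 2 ^ n)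
  have hβ0 : ∀ n, 0 ≤ β n := fun n => mul_nonneg (Nat.cast_nonneg _) (div_nonneg (vol_nonneg _) (by positivity))
  have hβ : ∀ n, β (n + 1) ≤ β n := fun n => by
    have h1 : ((N (n + 1) : ℕ) : ℝ) ≤ 2 * N n := by exact_mod_cast hN2 n
    calc β (n + 1) ≤ (2 * N n) * (vol e / 2 ^ (n + 1)) :=
          mul_le_mul_of_nonneg_right h1 (div_nonneg (vol_nonneg _) (by positivity))
      _ = β n := by simp only [β]; ring
  have hβ' : ∀ n, c n = d → β (n + 1) ≤ β n / 2 := fun n hn => by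
    have h1 : ((N (n + 1) : ℕ) : ℝ) ≤ N n := by exact_mod_cast hN1 n hn
    calc β (n + 1) ≤ N n * (vol e / 2 ^ (n + 1)) :=
          mul_le_mul_of_nonneg_right h1 (div_nonneg (vol_nonneg _) (by positivity))
      _ = β n / 2 := by simp only [β]; ring
  have hβanti : Antitone β := antitone_nat_of_succ_le hβ
  have hβk : ∀ k : ℕ, ∃ n, β n ≤ β 0 / 2 ^ k := fun k => by
    induction k with
    | zero => exact ⟨0, by simp⟩
    | succ k ih =>
      obtain ⟨n, hn⟩ := ih
      obtain ⟨n', hn', hcn⟩ := hc m n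
      refine ⟨n' + 1, (hβ' n' hcn).trans ?_⟩
      rw [pow_succ, ← div_div]
      linarith [hβanti hn']
  obtain ⟨k, hk⟩ := exists_pow_lt_of_lt_one (div_pos (by positivity) (by linarith [hβ0 0]) : 0 < ε / 3 / (β 0 + 1)) (by norm_num : (1 / 2 : ℝ) < 1)
  obtain ⟨n, hn⟩ := hβk k
  have hβε : β n < ε / 3 := by
    refine hn.trans_lt ?_
    have h0 := hβ0 0
    rw [lt_div_iff₀ (by linarith)] at hk
    have h1 : (0 : ℝ) < (1 / 2) ^ k := by positivity
    calc β 0 / 2 ^ k = (1 / 2) ^ k * β 0 := by rw [one_div_pow]; ring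
      _ < ε / 3 := by linarith
  let low : B := ({w | q n w ≤ d} : Finset (Fin n → Bool)).sup (q n)
  let b : B := ({w | ¬ (q n w ≤ d ∨ Disjoint (q n w) d)} : Finset (Fin n → Bool)).sup (q n)
  have hlowd : low ≤ d ⊓ e := le_inf (Finset.sup_le fun w hw => by simpa using hw)
    ((Finset.sup_mono (Finset.subset_univ _)).trans (hcover n).le)
  have hle : d ⊓ e ≤ low ⊔ b := by
    rw [← hcover n, Finset.sup_inf_distrib_left]
    refine Finset.sup_le fun w _ => ?_
    by_cases h1 : q n w ≤ d
    · exact inf_le_right.trans (le_sup_of_le_left (Finset.le_sup (f := q n) (by simpa using h1)))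
    by_cases h2 : Disjoint (q n w) d
    · rw [inf_comm, h2.eq_bot]; exact bot_le
    · exact inf_le_right.trans (le_sup_of_le_right (Finset.le_sup (f := q n) (by simp [h1, h2])))
  have hvb : vol b ≤ β n := by
    refine (vol_finset_sup_le _ _).trans ?_
    simp only [hvol, Finset.sum_const, nsmul_eq_mul]
    refine mul_le_mul_of_nonneg_right ?_ (div_nonneg (vol_nonneg _) (by positivity))
    simp only [N, bad]
    rw [Finset.card_filter]
    push_cast
    refine Finset.sum_le_sum fun w _ => ?_
    by_cases hg : q n w ≤ d ∨ Disjoint (q n w) d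
    · rw [if_neg (not_not.2 hg), if_pos hg]
    · rw [if_pos hg, if_neg hg]
  have h1 : dist (d ⊓ e) low ≤ β n := by
    rw [dist_eq_add, sdiff_eq_bot_iff.2 hlowd, vol_bot, add_zero]
    exact (vol_mono (sdiff_le_iff.2 hle)).trans hvb
  have h2 : dist x (d ⊓ e) ≤ dist x d := by
    conv_lhs => rw [← inf_eq_left.2 hx]
    simpa using dist_inf_le x e d e
  have h3 : dist x low < ε := calc dist x low ≤ dist x (d ⊓ e) + dist (d ⊓ e) low := dist_triangle _ _ _
    _ < ε := by linarith
  exact ⟨n, _, h3⟩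

end ProbAlg

namespace ProbAlg

variable {B : Type*} [BooleanAlgebra B] [MetricSpace B] [ProbAlg B]

/-! ### Gluing automorphisms -/

/-- Automorphisms which match the members of two partitions can be glued together. -/
theorem exists_glue {ι : Type} [Countable ι] {b c : ι → B} (hb : Pairwise (Function.onFun Disjoint b))
    (hc : Pairwise (Function.onFun Disjoint c)) (hb1 : join b = ⊤) (hc1 : join c = ⊤)
    (g : ι → Aut B) (hg : ∀ i, g i • b i = c i) : ∃ h : Aut B, ∀ i, ∀ x ≤ b i, h • x = g i • x := by
  have hjoin : ∀ {c f : ι → B}, Pairwise (Function.onFun Disjoint c) → (∀ i, f i ≤ c i) → ∀ i,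
      join f ⊓ c i = f i := by
    intro c f hc hf i
    refine le_antisymm (le_of_inf_le (f := f) inf_le_left fun j => ?_) (le_inf (le_join f i) (hf i))
    by_cases hij : i = j
    · rw [hij]; exact inf_le_right
    · have : Disjoint (join f ⊓ c i) (f j) := (hc hij).mono inf_le_right (hf j)
      rw [this.eq_bot]; exact bot_le
  have htop : ∀ {b : ι → B}, join b = ⊤ → ∀ x : B, join (fun i => x ⊓ b i) = x := by
    intro b hb x
    refine le_antisymm (join_le_iff.2 fun i => inf_le_left) ?_
    exact le_of_inf_le (f := b) (hb ▸ le_top) fun i => le_join (fun i => x ⊓ b i) i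
  have hg' : ∀ i, (g i)⁻¹ • c i = b i := fun i => by rw [← hg, inv_smul_smul]
  let F : B → B := fun x => join fun i => g i • (x ⊓ b i)
  let F' : B → B := fun x => join fun i => (g i)⁻¹ • (x ⊓ c i)
  have hF : ∀ x i, F x ⊓ c i = g i • (x ⊓ b i) := fun x =>
    hjoin hc fun i => by rw [← hg]; exact smul_le_smul inf_le_right
  have hF' : ∀ x i, F' x ⊓ b i = (g i)⁻¹ • (x ⊓ c i) := fun x =>
    hjoin hb fun i => by rw [← hg']; exact smul_le_smul inf_le_right
  have hmono : ∀ {g : ι → Aut B} {b : ι → B} {x y : B}, x ≤ y →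
      join (fun i => g i • (x ⊓ b i)) ≤ join fun i => g i • (y ⊓ b i) := by
    intro g b x y hxy
    exact join_le_iff.2 fun i => (smul_le_smul (inf_le_inf_right _ hxy)).trans
      (le_join (fun i => g i • (y ⊓ b i)) i)
  have h1 : ∀ x, F' (F x) = x := fun x => by
    simp only [F', hF, inv_smul_smul]; exact htop hb1 x
  have h2 : ∀ x, F (F' x) = x := fun x => by
    simp only [F, hF', smul_inv_smul]; exact htop hc1 x
  let e : B ≃o B := ⟨⟨F, F', h1, h2⟩, fun {x y} =>
    ⟨fun h => by rw [← h1 x, ← h1 y]; exact hmono h, fun h => hmono h⟩⟩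
  have he : ∀ x, vol (e x) = vol x := fun x => by
    have h3 := vol_join (f := fun i => g i • (x ⊓ b i)) fun i j hij => by
      have : Disjoint (c i) (c j) := hc hij
      rw [← hg, ← hg j] at this
      exact this.mono (smul_le_smul inf_le_right) (smul_le_smul inf_le_right)
    have h4 := vol_join (f := fun i => x ⊓ b i) fun i j hij =>
      (hb hij).mono inf_le_right inf_le_right
    simp only [vol_smul] at h3
    rw [htop hb1] at h4
    exact h3.unique h4
  refine ⟨autOfOrderIso e he, fun i x hx => ?_⟩
  rw [autOfOrderIso_smul]
  refine le_antisymm (join_le_iff.2 fun j => ?_) ?_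
  · by_cases hij : i = j
    · rw [← hij, inf_eq_left.2 hx]
    · have : Disjoint x (b j) := (hb hij).mono_left hx
      rw [this.eq_bot, smul_bot]; exact bot_le
  · have := le_join (fun j => g j • (x ⊓ b j)) i
    rwa [inf_eq_left.2 hx] at this

theorem aut_eq_of_agree {ι : Type} [Countable ι] {b : ι → B} (hb : join b = ⊤) {g h : Aut B}
    (H : ∀ i, ∀ x ≤ b i, g • x = h • x) : g = h := by
  refine aut_ext fun x => ?_
  have hx : join (fun i => x ⊓ b i) = x := by
    refine le_antisymm (join_le_iff.2 fun i => inf_le_left) ?_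
    exact le_of_inf_le (f := b) (hb ▸ le_top) fun i => le_join (fun i => x ⊓ b i) i
  rw [← hx, smul_join, smul_join]
  congr 1
  exact funext fun i => H i _ inf_le_right

/-! ### Supports -/

/-- The automorphism `g` is supported in `e`: it fixes everything disjoint from `e`. -/
def SuppIn (g : Aut B) (e : B) : Prop := ∀ x, Disjoint x e → g • x = x

section

omit [ProbAlg B]

theorem SuppIn.mono {g : Aut B} {e e' : B} (h : SuppIn g e) (he : e ≤ e') : SuppIn g e' :=
  fun x hx => h x (hx.mono_right he)

theorem suppIn_one (e : B) : SuppIn (1 : Aut B) e := fun x _ => one_smul _ x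

theorem SuppIn.mul {g h : Aut B} {e : B} (hg : SuppIn g e) (hh : SuppIn h e) : SuppIn (g * h) e :=
  fun x hx => by rw [mul_smul, hh x hx, hg x hx]

theorem SuppIn.inv {g : Aut B} {e : B} (hg : SuppIn g e) : SuppIn g⁻¹ e :=
  fun x hx => by rw [inv_smul_eq_iff, hg x hx]

theorem SuppIn.conj {g : Aut B} {e : B} (hg : SuppIn g e) (f : Aut B) :
    SuppIn (f * g * f⁻¹) (f • e) := fun x hx => by
  have h1 : Disjoint (f⁻¹ • x) e := by rwa [disjoint_smul_left, inv_inv]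
  rw [mul_smul, mul_smul, hg _ h1, smul_inv_smul]

theorem SuppIn.smul_eq {g : Aut B} {e : B} (hg : SuppIn g e) : g • e = e := by
  have := hg eᶜ disjoint_compl_left
  rwa [smul_compl, compl_inj_iff] at this

theorem SuppIn.smul_le {g : Aut B} {e x : B} (hg : SuppIn g e) (hx : x ≤ e) : g • x ≤ e := by
  rw [← hg.smul_eq]; exact smul_le_smul hx

end

/-- Two automorphisms supported in `e` are equal if they agree below the members of a family
covering `e`. -/
theorem SuppIn.eq_of_agree {ι : Type} [Countable ι] {e : B} {b : ι → B} (hb : e ≤ join b)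
    {g h : Aut B} (hg : SuppIn g e) (hh : SuppIn h e) (H : ∀ i, ∀ x ≤ b i, g • x = h • x) :
    g = h := by
  refine aut_eq_of_agree (b := fun i : Option ι => i.elim eᶜ b) ?_ fun i x hx => ?_
  · refine top_le_iff.1 ?_
    rw [← sup_compl_eq_top (x := e)]
    refine sup_le (hb.trans (join_le_iff.2 fun i => ?_)) ?_
    · exact le_join (fun i : Option ι => i.elim eᶜ b) (some i)
    · exact le_join (fun i : Option ι => i.elim eᶜ b) none
  · cases i with
    | none =>
      have : Disjoint x e := disjoint_compl_left.mono_left hx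
      rw [hg x this, hh x this]
    | some i => exact H i x hx

/-- Gluing inside `join b = join c`, with the identity outside. -/
theorem exists_glue_supp {ι : Type} [Countable ι] {b c : ι → B}
    (hb : Pairwise (Function.onFun Disjoint b)) (hc : Pairwise (Function.onFun Disjoint c))
    (hbc : join b = join c) (g : ι → Aut B) (hg : ∀ i, g i • b i = c i) :
    ∃ h : Aut B, (∀ i, ∀ x ≤ b i, h • x = g i • x) ∧ SuppIn h (join b) := by
  have hpair : ∀ {b : ι → B} {e : B}, Pairwise (Function.onFun Disjoint b) → e = join b →
      Pairwise (Function.onFun Disjoint fun i : Option ι => i.elim eᶜ b) := by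
    intro b e hb he i j hij
    subst he
    have h1 : ∀ i, Disjoint (join b)ᶜ (b i) := fun i => disjoint_compl_left.mono_right (le_join b i)
    cases i <;> cases j
    · exact (hij rfl).elim
    · exact h1 _
    · exact (h1 _).symm
    · exact hb fun h => hij (congrArg some h)
  have htop : ∀ {b : ι → B} {e : B}, e = join b → join (fun i : Option ι => i.elim eᶜ b) = ⊤ := by
    intro b e he
    refine top_le_iff.1 ?_
    rw [← sup_compl_eq_top (x := e)]
    refine sup_le (he.le.trans (join_le_iff.2 fun i => ?_)) ?_
    · exact le_join (fun i : Option ι => i.elim eᶜ b) (some i)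
    · exact le_join (fun i : Option ι => i.elim eᶜ b) none
  obtain ⟨h, hh⟩ := exists_glue (hpair hb rfl) (hpair hc hbc) (htop rfl) (htop hbc)
    (fun i : Option ι => i.elim 1 g) fun i => by
      cases i
      · exact one_smul _ _
      · exact hg _
  refine ⟨h, fun i => hh (some i), fun x hx => ?_⟩
  rw [hh none x (le_compl_iff_disjoint_right.2 hx)]
  exact one_smul _ _

theorem join_le_join_iff {ι κ : Type} [Countable ι] [Countable κ] {f : ι → B} {g : κ → B}
    (h : ∀ i, ∃ j, f i ≤ g j) : join f ≤ join g :=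
  join_le_iff.2 fun i => (h i).elim fun j hj => hj.trans (le_join g j)

theorem join_bool (f : Bool → B) : join f = f true ⊔ f false :=
  le_antisymm (join_le_iff.2 (Bool.forall_bool.2 ⟨le_sup_right, le_sup_left⟩))
    (sup_le (le_join f true) (le_join f false))

omit [MetricSpace B] [ProbAlg B] in
theorem pairwise_bool {f : Bool → B} (h : Disjoint (f true) (f false)) :
    Pairwise (Function.onFun Disjoint f) := by
  intro i j hij
  cases i <;> cases j <;> first | exact (hij rfl).elim | exact h | exact h.symm

omit [ProbAlg B] in
/-- Commuting of automorphisms with disjoint supports. -/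
theorem SuppIn.commute {g h : Aut B} {e e' : B} (hg : SuppIn g e) (hh : SuppIn h e')
    (hd : Disjoint e e') : g * h = h * g := by
  refine aut_ext fun x => ?_
  rw [mul_smul, mul_smul]
  have hx : x = (x ⊓ e) ⊔ (x \ e) := (sup_inf_sdiff x e).symm
  have h1 : Disjoint (x ⊓ e) e' := hd.mono_left inf_le_right
  have h2 : Disjoint (g • (x ⊓ e)) e' := hd.mono_left (hg.smul_le inf_le_right)
  have h3 : Disjoint (x \ e) e := disjoint_sdiff_self_left
  have h4 : Disjoint (h • (x \ e)) e := by
    have : h⁻¹ • e = e := hh.inv e hd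
    rwa [disjoint_smul_left, this]
  rw [hx, smul_sup, smul_sup, smul_sup, smul_sup, hh _ h1, hg _ h3, hh _ h2, hg _ h4]

/-! ### Homogeneity -/

omit [ProbAlg B] in
theorem Tree.sup_node {e : B} (T : Tree e) (n : ℕ) : Finset.univ.sup (T.node n) = e := by
  induction n with
  | zero => simp [T.node_zero]
  | succ n ih =>
    refine Eq.trans (le_antisymm (Finset.sup_le fun w _ => ?_) (Finset.sup_le fun w _ => ?_)) ih
    · refine le_trans ?_ (Finset.le_sup (Finset.mem_univ (Fin.init w)))
      rw [T.node_succ n (Fin.init w)]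
      cases h : w (Fin.last n)
      · refine le_sup_of_le_right (le_of_eq ?_)
        rw [← h, Fin.snoc_init_self]
      · refine le_sup_of_le_left (le_of_eq ?_)
        rw [← h, Fin.snoc_init_self]
    · rw [T.node_succ]
      exact sup_le (Finset.le_sup (Finset.mem_univ _)) (Finset.le_sup (Finset.mem_univ _))

omit [ProbAlg B] in
theorem Tree.node_le {e : B} (T : Tree e) (n : ℕ) (w : Fin n → Bool) : T.node n w ≤ e := by
  conv_rhs => rw [← T.sup_node n]
  exact Finset.le_sup (Finset.mem_univ w)

omit [ProbAlg B] in
/-- Passing to a later level of a tree. -/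
theorem Tree.exists_sup_eq {e : B} (T : Tree e) {n m : ℕ} (h : n ≤ m) (S : Finset (Fin n → Bool)) :
    ∃ S' : Finset (Fin m → Bool), S'.sup (T.node m) = S.sup (T.node n) := by
  classical
  induction m, h using Nat.le_induction with
  | base => exact ⟨S, rfl⟩
  | succ m _ ih =>
    obtain ⟨S', h⟩ := ih
    refine ⟨S'.biUnion fun w => {Fin.snoc w true, Fin.snoc w false}, ?_⟩
    rw [← h, Finset.sup_biUnion]
    refine Finset.sup_congr rfl fun w _ => ?_
    rw [Finset.sup_insert, Finset.sup_singleton, ← T.node_succ]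

/-- Elements of the same measure are conjugate. -/
theorem exists_smul_eq {b c : B} (h : vol b = vol c) : ∃ g : Aut B, g • b = c := by
  classical
  obtain ⟨Tb⟩ := nonempty_tree b
  obtain ⟨Tb'⟩ := nonempty_tree bᶜ
  obtain ⟨Tc⟩ := nonempty_tree c
  obtain ⟨Tc'⟩ := nonempty_tree cᶜ
  let q : ∀ {b : B}, Tree b → Tree bᶜ → ∀ k, Bool × (Fin k → Bool) → B := fun T T' k x =>
    cond x.1 (T.node k x.2) (T'.node k x.2)
  have hdisj : ∀ {b : B} (T : Tree b) (T' : Tree bᶜ) k, Pairwise (Function.onFun Disjoint (q T T' k)) := by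
    rintro b T T' k ⟨i, w⟩ ⟨j, w'⟩ hij
    have h1 : ∀ w w', Disjoint (T.node k w) (T'.node k w') := fun w w' =>
      disjoint_compl_right.mono (T.node_le k w) (T'.node_le k w')
    cases i <;> cases j
    · exact T'.disj k fun h => hij (Prod.ext rfl h)
    · exact (h1 _ _).symm
    · exact h1 _ _
    · exact T.disj k fun h => hij (Prod.ext rfl h)
  have hsucc : ∀ {b : B} (T : Tree b) (T' : Tree bᶜ) k x, q T T' k x =
      ({y | (y.1, (Fin.init y.2 : Fin k → Bool)) = x} : Set (Bool × (Fin (k + 1) → Bool))).toFinset.sup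
        (q T T' (k + 1)) := by
    rintro b T T' k ⟨i, w⟩
    have : ({y | (y.1, (Fin.init y.2 : Fin k → Bool)) = (i, w)} :
        Set (Bool × (Fin (k + 1) → Bool))).toFinset = {(i, Fin.snoc w true), (i, Fin.snoc w false)} := by
      ext ⟨j, w'⟩
      simp only [Set.mem_toFinset, Set.mem_ofPred_eq, Prod.mk.injEq, Finset.mem_insert,
        Finset.mem_singleton]
      constructor
      · rintro ⟨rfl, rfl⟩
        cases h : w' (Fin.last k)
        · exact Or.inr ⟨rfl, by rw [← h, Fin.snoc_init_self]⟩
        · exact Or.inl ⟨rfl, by rw [← h, Fin.snoc_init_self]⟩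
      · rintro (⟨rfl, rfl⟩ | ⟨rfl, rfl⟩) <;> exact ⟨rfl, Fin.init_snoc _ _⟩
    rw [this, Finset.sup_insert, Finset.sup_singleton]
    cases i
    · exact T'.node_succ k w
    · exact T.node_succ k w
  have hdense : ∀ {b : B} (T : Tree b) (T' : Tree bᶜ),
      DenseRange fun i : Σ k, Finset (Bool × (Fin k → Bool)) => i.2.sup (q T T' i.1) := by
    intro b T T' x
    rw [Metric.mem_closure_iff]
    intro ε hε
    obtain ⟨n, S, hS⟩ := T.dense (x ⊓ b) inf_le_right (ε / 2) (by positivity)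
    obtain ⟨n', S', hS'⟩ := T'.dense (x ⊓ bᶜ) inf_le_right (ε / 2) (by positivity)
    obtain ⟨R, hR⟩ := T.exists_sup_eq (le_max_left n n') S
    obtain ⟨R', hR'⟩ := T'.exists_sup_eq (le_max_right n n') S'
    refine ⟨_, ⟨⟨max n n', R.image (Prod.mk true) ∪ R'.image (Prod.mk false)⟩, rfl⟩, ?_⟩
    dsimp only
    rw [Finset.sup_union, Finset.sup_image, Finset.sup_image]
    change dist x (R.sup (T.node _) ⊔ R'.sup (T'.node _)) < ε
    rw [hR, hR']
    have hx : x = x ⊓ b ⊔ x ⊓ bᶜ := by rw [← inf_sup_left, sup_compl_eq_top, inf_top_eq]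
    conv_lhs => rw [hx]
    refine (dist_sup_le _ _ _ _).trans_lt ?_
    linarith
  obtain ⟨g, hg⟩ := exists_aut_of_refining (κ := fun k => Bool × (Fin k → Bool))
    (fun k y => (y.1, Fin.init y.2)) (hdisj Tb Tb') (hdisj Tc Tc') (hsucc Tb Tb') (hsucc Tc Tc')
    (hdense Tb Tb') (hdense Tc Tc') (by
      rintro k ⟨i, w⟩
      cases i
      · change vol (Tb'.node k w) = vol (Tc'.node k w)
        rw [Tb'.vol_node, Tc'.vol_node, vol_compl, vol_compl, h]
      · change vol (Tb.node k w) = vol (Tc.node k w)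
        rw [Tb.vol_node, Tc.vol_node, h])
  refine ⟨g, ?_⟩
  have := hg 0 (true, Fin.elim0)
  change g • Tb.node 0 _ = Tc.node 0 _ at this
  rwa [Tb.node_zero, Tc.node_zero] at this

/-- Elements of the same measure below `z` are conjugate by an automorphism supported in `z`. -/
theorem exists_smul_eq_supp {b c z : B} (h : vol b = vol c) (hb : b ≤ z) (hc : c ≤ z) :
    ∃ g : Aut B, g • b = c ∧ SuppIn g z := by
  obtain ⟨g₁, h₁⟩ := exists_smul_eq h
  obtain ⟨g₂, h₂⟩ := exists_smul_eq (b := z \ b) (c := z \ c) (by rw [vol_sdiff hb, vol_sdiff hc, h])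
  obtain ⟨g, hg, hg'⟩ := exists_glue_supp (b := fun i : Bool => cond i b (z \ b))
    (c := fun i : Bool => cond i c (z \ c)) (pairwise_bool disjoint_sdiff_self_right)
    (pairwise_bool disjoint_sdiff_self_right)
    (by rw [join_bool, join_bool]; simp [hb, hc])
    (fun i => cond i g₁ g₂) (Bool.forall_bool.2 ⟨h₂, h₁⟩)
  refine ⟨g, (hg true b le_rfl).trans h₁, hg'.mono ?_⟩
  rw [join_bool]
  exact sup_le hb sdiff_le

/-- The involution exchanging `b` with `θ • b` along `θ`. -/
theorem exists_swap_along {b : B} (θ : Aut B) (h : Disjoint b (θ • b)) :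
    ∃ ρ : Aut B, SuppIn ρ (b ⊔ θ • b) ∧ ρ * ρ = 1 ∧ (∀ x ≤ b, ρ • x = θ • x) ∧
      ∀ x ≤ θ • b, ρ • x = θ⁻¹ • x := by
  obtain ⟨ρ, h1, h2⟩ := exists_glue_supp (b := fun i : Bool => cond i b (θ • b))
    (c := fun i : Bool => cond i (θ • b) b) (pairwise_bool h) (pairwise_bool h.symm)
    (by rw [join_bool, join_bool]; exact sup_comm _ _) (fun i => cond i θ θ⁻¹)
    (Bool.forall_bool.2 ⟨inv_smul_smul _ _, rfl⟩)
  have ht : ∀ x ≤ b, ρ • x = θ • x := h1 true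
  have hf : ∀ x ≤ θ • b, ρ • x = θ⁻¹ • x := h1 false
  rw [join_bool] at h2
  refine ⟨ρ, h2, (h2.mul h2).eq_of_agree (b := fun i : Bool => cond i b (θ • b)) ?_ (suppIn_one _)
    fun i x hx => ?_, ht, hf⟩
  · rw [join_bool]
  · rw [mul_smul, one_smul]
    cases i
    · have hx' : x ≤ θ • b := hx
      rw [hf x hx', ht, smul_inv_smul]
      simpa using smul_le_smul (g := θ⁻¹) hx'
    · have hx' : x ≤ b := hx
      rw [ht x hx', hf _ (smul_le_smul hx'), inv_smul_smul]

end ProbAlg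

namespace ProbAlg

variable {B : Type*} [BooleanAlgebra B] [MetricSpace B] [ProbAlg B]

/-! ### Swaps -/

/-- The automorphism `ρ` is a swap with domain `d`: an involution exchanging `d` with the disjoint
element `ρ • d` and fixing everything else. -/
structure IsSwap (ρ : Aut B) (d : B) : Prop where
  disj : Disjoint d (ρ • d)
  mul_self : ρ * ρ = 1
  supp : SuppIn ρ (d ⊔ ρ • d)

namespace IsSwap

variable {ρ ρ' : Aut B} {d d' e e' z : B}

omit [ProbAlg B] in
theorem smul_smul_self (h : IsSwap ρ d) (x : B) : ρ • ρ • x = x := by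
  rw [← mul_smul, h.mul_self, one_smul]

omit [ProbAlg B] in
theorem inv_eq (h : IsSwap ρ d) : ρ⁻¹ = ρ := inv_eq_of_mul_eq_one_left h.mul_self

omit [ProbAlg B] in
theorem conj (h : IsSwap ρ d) (f : Aut B) : IsSwap (f * ρ * f⁻¹) (f • d) := by
  have e : (f * ρ * f⁻¹) • (f • d) = f • (ρ • d) := by
    rw [mul_smul, mul_smul, inv_smul_smul]
  refine ⟨?_, ?_, ?_⟩
  · rw [e, disjoint_smul]; exact h.disj
  · rw [show f * ρ * f⁻¹ * (f * ρ * f⁻¹) = f * (ρ * ρ) * f⁻¹ by group, h.mul_self]; group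
  · rw [e, ← smul_sup]; exact h.supp.conj f

theorem ext (h : IsSwap ρ d) (h' : IsSwap ρ' d) (H : ∀ x ≤ d, ρ • x = ρ' • x) : ρ = ρ' := by
  have hd : ρ • d = ρ' • d := H d le_rfl
  refine h.supp.eq_of_agree (b := fun i : Bool => cond i d (ρ • d)) ?_
    (by rw [hd]; exact h'.supp) fun i x hx => ?_
  · exact (join_bool fun i : Bool => cond i d (ρ • d)).ge
  · cases i
    · have h1 : ρ • x ≤ d := by
        have := smul_le_smul (g := ρ) (show x ≤ ρ • d from hx)
        rwa [h.smul_smul_self] at this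
      have h2 := H _ h1
      rw [h.smul_smul_self] at h2
      conv_rhs => rw [h2]
      rw [h'.smul_smul_self]
    · exact H x hx

/-- A swap splits along a splitting of its domain. -/
theorem split (h : IsSwap ρ (e ⊔ e')) (he : Disjoint e e') : ∃ ρ₁ ρ₂, ρ = ρ₁ * ρ₂ ∧ IsSwap ρ₁ e ∧
    IsSwap ρ₂ e' ∧ (∀ x ≤ e, ρ₁ • x = ρ • x) ∧ ∀ x ≤ e', ρ₂ • x = ρ • x := by
  have hd := h.disj
  rw [smul_sup] at hd
  have h1 : Disjoint e (ρ • e) := hd.mono le_sup_left le_sup_left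
  have h2 : Disjoint e' (ρ • e') := hd.mono le_sup_right le_sup_right
  have h3 : Disjoint e (ρ • e') := hd.mono le_sup_left le_sup_right
  have h4 : Disjoint e' (ρ • e) := hd.mono le_sup_right le_sup_left
  have h5 : Disjoint (ρ • e) (ρ • e') := disjoint_smul.2 he
  obtain ⟨ρ₁, s₁, m₁, a₁, b₁⟩ := exists_swap_along ρ h1
  obtain ⟨ρ₂, s₂, m₂, a₂, b₂⟩ := exists_swap_along ρ h2
  rw [h.inv_eq] at b₁ b₂
  have f₁ : ρ₁ • e = ρ • e := a₁ e le_rfl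
  have f₂ : ρ₂ • e' = ρ • e' := a₂ e' le_rfl
  refine ⟨ρ₁, ρ₂, ?_, ⟨by rwa [f₁], m₁, by rwa [f₁]⟩, ⟨by rwa [f₂], m₂, by rwa [f₂]⟩, a₁, a₂⟩
  let b : Bool × Bool → B := fun i => cond i.1 (cond i.2 e e') (cond i.2 (ρ • e) (ρ • e'))
  have hsup : e ⊔ e' ⊔ ρ • (e ⊔ e') ≤ join b := by
    rw [smul_sup]
    exact sup_le (sup_le (le_join b (true, true)) (le_join b (true, false)))
      (sup_le (le_join b (false, true)) (le_join b (false, false)))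
  refine h.supp.eq_of_agree hsup ((s₁.mono ?_).mul (s₂.mono ?_)) ?_
  · rw [smul_sup]; exact sup_le (le_sup_of_le_left le_sup_left) (le_sup_of_le_right le_sup_left)
  · rw [smul_sup]; exact sup_le (le_sup_of_le_left le_sup_right) (le_sup_of_le_right le_sup_right)
  · rintro ⟨i, j⟩ x hx
    rw [mul_smul]
    cases i <;> cases j
    · have hx' : x ≤ ρ • e' := hx
      have hρ : ρ • x ≤ e' := by
        have := smul_le_smul (g := ρ) hx'
        rwa [h.smul_smul_self] at this
      rw [b₂ x hx', s₁ _ (disjoint_sup_right.2 ⟨he.symm.mono_left hρ, h4.mono_left hρ⟩)]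
    · have hx' : x ≤ ρ • e := hx
      rw [s₂ x (disjoint_sup_right.2 ⟨h4.symm.mono_left hx', h5.mono_left hx'⟩), b₁ x hx']
    · have hx' : x ≤ e' := hx
      rw [a₂ x hx', s₁ _ ?_]
      exact disjoint_sup_right.2 ⟨h3.symm.mono_left (smul_le_smul hx'),
        h5.symm.mono_left (smul_le_smul hx')⟩
    · have hx' : x ≤ e := hx
      rw [s₂ x (disjoint_sup_right.2 ⟨he.mono_left hx', h3.mono_left hx'⟩), a₁ x hx']

omit [ProbAlg B] in
theorem mul (h : IsSwap ρ d) (h' : IsSwap ρ' d') (hdd : Disjoint (d ⊔ ρ • d) (d' ⊔ ρ' • d')) :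
    IsSwap (ρ * ρ') (d ⊔ d') := by
  have hc : ρ * ρ' = ρ' * ρ := h.supp.commute h'.supp hdd
  have e1 : (ρ * ρ') • d = ρ • d := by
    rw [mul_smul, h'.supp d (hdd.mono_left le_sup_left)]
  have e2 : (ρ * ρ') • d' = ρ' • d' := by
    rw [hc, mul_smul, h.supp d' (hdd.symm.mono_left le_sup_left)]
  refine ⟨?_, ?_, ?_⟩
  · rw [smul_sup, e1, e2, disjoint_sup_left, disjoint_sup_right, disjoint_sup_right]
    exact ⟨⟨h.disj, hdd.mono le_sup_left le_sup_right⟩,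
      (hdd.mono le_sup_right le_sup_left).symm, h'.disj⟩
  · rw [show ρ * ρ' * (ρ * ρ') = ρ * (ρ' * ρ) * ρ' by group, ← hc,
      show ρ * (ρ * ρ') * ρ' = (ρ * ρ) * (ρ' * ρ') by group, h.mul_self, h'.mul_self, one_mul]
  · rw [smul_sup, e1, e2]
    exact (h.supp.mono (sup_le_sup le_sup_left le_sup_left)).mul
      (h'.supp.mono (sup_le_sup le_sup_right le_sup_right))

/-- Swaps of the same size below `z` are conjugate by an automorphism supported in `z`. -/
theorem exists_conj_eq (h : IsSwap ρ d) (h' : IsSwap ρ' d') (hz : d ⊔ ρ • d ≤ z)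
    (hz' : d' ⊔ ρ' • d' ≤ z) (hv : vol d = vol d') : ∃ f, SuppIn f z ∧ f * ρ * f⁻¹ = ρ' := by
  -- first match the supports, then the domains
  obtain ⟨f₁, hf₁, hs₁⟩ := exists_smul_eq_supp (b := d ⊔ ρ • d) (c := d' ⊔ ρ' • d') (z := z)
    (by rw [vol_sup _ _ h.disj, vol_sup _ _ h'.disj, vol_smul, vol_smul, hv]) hz hz'
  have h1 := h.conj f₁
  set ρ₁ := f₁ * ρ * f₁⁻¹ with hρ₁
  have hu : f₁ • d ⊔ ρ₁ • f₁ • d = d' ⊔ ρ' • d' := by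
    rw [← hf₁, smul_sup, hρ₁, mul_smul, mul_smul, inv_smul_smul]
  obtain ⟨f₀, hf₀⟩ := exists_smul_eq (b := f₁ • d) (c := d') (by rw [vol_smul, hv])
  obtain ⟨f₂, hf₂, hs₂⟩ := exists_glue_supp (b := fun i : Bool => cond i (f₁ • d) (ρ₁ • f₁ • d))
    (c := fun i : Bool => cond i d' (ρ' • d')) (pairwise_bool h1.disj) (pairwise_bool h'.disj)
    (by rw [join_bool, join_bool]; exact hu) (fun i => cond i f₀ (ρ' * f₀ * ρ₁⁻¹))
    (Bool.forall_bool.2 ⟨by simp [mul_smul, hf₀], hf₀⟩)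
  rw [join_bool] at hs₂
  have ht : ∀ x ≤ f₁ • d, f₂ • x = f₀ • x := hf₂ true
  have hf : ∀ x ≤ ρ₁ • f₁ • d, f₂ • x = (ρ' * f₀ * ρ₁⁻¹) • x := hf₂ false
  refine ⟨f₂ * f₁, (hs₂.mono (hu.le.trans hz')).mul hs₁, ?_⟩
  rw [show f₂ * f₁ * ρ * (f₂ * f₁)⁻¹ = f₂ * ρ₁ * f₂⁻¹ by rw [hρ₁]; group]
  have hd : f₂ • f₁ • d = d' := by rw [ht _ le_rfl, hf₀]
  have h2 := h1.conj f₂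
  rw [hd] at h2
  refine h2.ext h' fun x hx => ?_
  have hy : f₂⁻¹ • x ≤ f₁ • d :=
    smul_le_iff.2 (by rw [inv_inv, hd]; exact hx)
  rw [mul_smul, mul_smul, hf _ (smul_le_smul hy), mul_smul, mul_smul, inv_smul_smul, ← ht _ hy,
    smul_inv_smul]

/-- The product of a disjointly supported family of swaps. -/
theorem join_of_agree {Y D : ℕ → B} {g : ℕ → Aut B} {P : Aut B}
    (hY : Pairwise (Function.onFun Disjoint Y)) (hg : ∀ j, IsSwap (g j) (D j))
    (hD : ∀ j, D j ⊔ g j • D j ≤ Y j) (hP : ∀ j, ∀ x ≤ Y j, P • x = g j • x)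
    (hPs : SuppIn P (join Y)) : IsSwap P (join D) := by
  have hDY : ∀ j, D j ≤ Y j := fun j => le_sup_left.trans (hD j)
  have hgY : ∀ j, SuppIn (g j) (Y j) := fun j => (hg j).supp.mono (hD j)
  have hPD : P • join D = join fun j => g j • D j := by
    rw [smul_join]
    congr 1
    exact funext fun j => hP j _ (hDY j)
  refine ⟨?_, ?_, ?_⟩
  · rw [hPD, disjoint_join_left]
    intro i
    rw [disjoint_join_right]
    intro j
    by_cases hij : i = j
    · rw [hij]; exact (hg j).disj
    · exact (hY hij).mono (hDY i) (le_sup_right.trans (hD j))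
  · refine (hPs.mul hPs).eq_of_agree le_rfl (suppIn_one _) fun j x hx => ?_
    rw [mul_smul, hP j x hx, hP j _ ((hgY j).smul_le hx), (hg j).smul_smul_self, one_smul]
  · -- below `Y j`, whatever is disjoint from the support is fixed
    intro x hx
    have hx1 : x = join fun i : Option ℕ => x ⊓ i.elim (join Y)ᶜ Y := by
      refine le_antisymm (le_of_inf_le (f := fun i : Option ℕ => i.elim (join Y)ᶜ Y) ?_ fun i =>
        le_join (fun i : Option ℕ => x ⊓ i.elim (join Y)ᶜ Y) i) (join_le_iff.2 fun i => inf_le_left)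
      refine le_top.trans ?_
      rw [← sup_compl_eq_top (x := join Y)]
      refine sup_le (join_le_iff.2 fun i => ?_) ?_
      · exact le_join (fun i : Option ℕ => i.elim (join Y)ᶜ Y) (some i)
      · exact le_join (fun i : Option ℕ => i.elim (join Y)ᶜ Y) none
    rw [hx1, smul_join]
    congr 1
    funext i
    cases i with
    | none => exact hPs _ (disjoint_compl_left.mono_left inf_le_right)
    | some j =>
      change P • (x ⊓ Y j) = x ⊓ Y j
      rw [hP j _ inf_le_right]
      refine (hg j).supp _ ((hx.mono_left inf_le_left).mono_right ?_)
      rw [hPD]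
      exact sup_le_sup (le_join D j) (le_join (fun j => g j • D j) j)

end IsSwap

/-- An automorphism mapping `b` to a disjoint element agrees with a swap below `b`. -/
theorem exists_isSwap_along {b : B} (θ : Aut B) (h : Disjoint b (θ • b)) :
    ∃ ρ : Aut B, IsSwap ρ b ∧ (∀ x ≤ b, ρ • x = θ • x) ∧ ∀ x ≤ θ • b, ρ • x = θ⁻¹ • x := by
  obtain ⟨ρ, h1, h2, h3, h4⟩ := exists_swap_along θ h
  have h5 : ρ • b = θ • b := h3 b le_rfl
  exact ⟨ρ, ⟨by rwa [h5], h2, by rwa [h5]⟩, h3, h4⟩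

end ProbAlg

namespace ProbAlg

variable {B : Type*} [BooleanAlgebra B] [MetricSpace B] [ProbAlg B]

/-! ### Automorphisms of small support as products of swaps -/

theorem smul_eq_self_of_le {g : Aut B} {x : B} (h : x ≤ g • x) : g • x = x :=
  (eq_of_le_of_vol_le h (vol_smul g x).le).symm

/-- A maximal element disjoint from its image: the automorphism moves nothing outside of the
element, its image and its preimage. -/
theorem exists_marker {a : Aut B} {e : B} (ha : SuppIn a e) :
    ∃ E ≤ e, Disjoint E (a • E) ∧ SuppIn a (E ⊔ a • E ⊔ a⁻¹ • E) := by
  -- exhaust by pieces of the elements `d j \ a • d j`, which are disjoint from their images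
  let d := TopologicalSpace.denseSeq B
  let N : ℕ → B → B := fun j F => (d j \ a • d j) \ (F ⊔ a • F ⊔ a⁻¹ • F)
  let F : ℕ → B := fun j => Nat.rec ⊥ (fun j F => F ⊔ N j F) j
  have hF : ∀ j, F (j + 1) = F j ⊔ N j (F j) := fun j => rfl
  have hmono : Monotone F := monotone_nat_of_le_succ fun j => by rw [hF]; exact le_sup_left
  have hN : ∀ j F, N j F ≤ e := fun j F => by
    refine sdiff_le.trans ?_
    rw [← sdiff_eq_bot_iff]
    have h1 : a • ((d j \ a • d j) \ e) = (d j \ a • d j) \ e := ha _ disjoint_sdiff_self_left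
    have h2 : (d j \ a • d j) \ e ≤ a • d j := by
      rw [← h1]; exact smul_le_smul (sdiff_le.trans sdiff_le)
    exact (disjoint_sdiff_self_left.mono_left sdiff_le).eq_bot_of_le h2
  have hFe : ∀ j, F j ≤ e := fun j => by
    induction j with
    | zero => exact bot_le
    | succ j ih => rw [hF]; exact sup_le ih (hN _ _)
  have hdisj : ∀ j, Disjoint (F j) (a • F j) := fun j => by
    induction j with
    | zero => exact disjoint_bot_left
    | succ j ih =>
      have h1 : Disjoint (N j (F j)) (F j ⊔ a • F j ⊔ a⁻¹ • F j) := disjoint_sdiff_self_left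
      rw [disjoint_sup_right, disjoint_sup_right] at h1
      rw [hF, smul_sup, disjoint_sup_left, disjoint_sup_right, disjoint_sup_right]
      refine ⟨⟨ih, ?_⟩, h1.1.2, ?_⟩
      · rw [disjoint_comm, disjoint_smul_left]; exact h1.2
      · exact disjoint_sdiff_self_left.mono sdiff_le (smul_le_smul (sdiff_le.trans sdiff_le))
  refine ⟨join F, join_le_iff.2 hFe, ?_, ?_⟩
  · rw [smul_join, disjoint_join_left]
    intro i
    rw [disjoint_join_right]
    intro j
    exact (hdisj (max i j)).mono (hmono (le_max_left i j)) (smul_le_smul (hmono (le_max_right i j)))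
  · intro x hx
    have h1 : ∀ y : B, (y \ a • y) ⊓ x = ⊥ := by
      have hd : ∀ j, (d j \ a • d j) ⊓ x = ⊥ := fun j => by
        have h2 : Disjoint x (F j ⊔ a • F j ⊔ a⁻¹ • F j) := hx.mono_right
          (sup_le_sup (sup_le_sup (le_join F j) (smul_le_smul (le_join F j)))
            (smul_le_smul (le_join F j)))
        have h3 : (d j \ a • d j) ⊓ x ≤ F (j + 1) := by
          rw [hF]
          refine le_sup_of_le_right (le_sdiff.2 ⟨inf_le_left, h2.mono_left inf_le_right⟩)
        refine Disjoint.eq_bot_of_le ?_ (h3.trans (le_join F (j + 1)))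
        exact hx.mono inf_le_right (le_sup_of_le_left le_sup_left)
      intro y
      obtain ⟨u, hu, huy⟩ := mem_closure_iff_seq_limit.1 (TopologicalSpace.denseRange_denseSeq B y)
      choose s hs using hu
      have hs' : ∀ n, d (s n) = u n := hs
      have hay : Tendsto (fun n => a • u n) atTop (𝓝 (a • y)) :=
        (a.1.isometry.continuous.tendsto y).comp huy
      have h4 : Tendsto (fun n => (u n ⊓ (a • u n)ᶜ) ⊓ x) atTop (𝓝 ((y ⊓ (a • y)ᶜ) ⊓ x)) :=
        tendsto_inf (tendsto_inf huy (tendsto_compl hay)) tendsto_const_nhds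
      rw [sdiff_eq]
      refine tendsto_nhds_unique h4 ?_
      simp only [← hs', ← sdiff_eq, hd]
      exact tendsto_const_nhds
    have h2 := h1 x
    rw [inf_eq_left.2 sdiff_le, sdiff_eq_bot_iff] at h2
    exact smul_eq_self_of_le h2

/-- An automorphism is the product of a swap and an automorphism of smaller support. The measure of
the support is prescribed, so that iteration produces a geometric series. -/
theorem exists_eq_swap_mul {a : Aut B} {e : B} (ha : SuppIn a e) : ∃ (κ a' : Aut B) (E e' : B),
    IsSwap κ E ∧ E ⊔ κ • E ≤ e ∧ e' ≤ e ∧ vol e' = 2 / 3 * vol e ∧ SuppIn a' e' ∧ a = κ * a' := by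
  obtain ⟨E, hE, hd, hs⟩ := exists_marker ha
  obtain ⟨κ, hκ, h1, h2⟩ := exists_isSwap_along a hd
  have hκE : κ • E = a • E := h1 E le_rfl
  have haE : a • E ≤ e := ha.smul_le hE
  have haE' : a⁻¹ • E ≤ e := ha.inv.smul_le hE
  have hd' : Disjoint (a⁻¹ • E) E := by rw [disjoint_smul_left, inv_inv]; exact hd
  have hsup : SuppIn (κ⁻¹ * a) (a • E ⊔ a⁻¹ • E) := by
    intro x hx
    have hκ' : SuppIn κ⁻¹ (E ⊔ a • E) := by rw [← hκE]; exact hκ.supp.inv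
    rw [← sup_inf_sdiff x E, smul_sup]
    congr 1
    · rw [mul_smul, ← h1 _ inf_le_right, inv_smul_smul]
    · have h3 : Disjoint (x \ E) (a • E ⊔ a⁻¹ • E) := hx.mono_left sdiff_le
      rw [disjoint_sup_right] at h3
      have h4 : Disjoint (x \ E) E := disjoint_sdiff_self_left
      rw [mul_smul, hs _ (disjoint_sup_right.2 ⟨disjoint_sup_right.2 ⟨h4, h3.1⟩, h3.2⟩),
        hκ' _ (disjoint_sup_right.2 ⟨h4, h3.1⟩)]
  have hle : a • E ⊔ a⁻¹ • E ≤ e := sup_le haE haE'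
  have hv : vol (a • E ⊔ a⁻¹ • E) ≤ 2 / 3 * vol e := by
    have h3 := vol_sup_le (a • E) (a⁻¹ • E)
    rw [vol_smul, vol_smul] at h3
    have h4 : vol (E ⊔ (a • E ⊔ a⁻¹ • E)) ≤ vol e := vol_mono (sup_le hE hle)
    rw [vol_sup _ _ (disjoint_sup_right.2 ⟨hd, hd'.symm⟩)] at h4
    linarith
  obtain ⟨b, hb, hbv⟩ := exists_le_vol_eq (e \ (a • E ⊔ a⁻¹ • E))
    (2 / 3 * vol e - vol (a • E ⊔ a⁻¹ • E)) (by linarith)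
    (by rw [vol_sdiff hle]; linarith [vol_nonneg e])
  refine ⟨κ, κ⁻¹ * a, E, a • E ⊔ a⁻¹ • E ⊔ b, hκ, ?_, ?_, ?_, hsup.mono le_sup_left, by group⟩
  · rw [hκE]; exact sup_le hE haE
  · exact sup_le hle (hb.trans sdiff_le)
  · rw [vol_sup _ _ (disjoint_sdiff_self_right.mono_right hb), hbv]; ring

/-- The product of a disjointly supported family of products of three swaps is a product of three
swaps. -/
theorem mem_mul_of_agree {A : Set (Aut B)} {ε : ℝ} (hA : ∀ ρ d, IsSwap ρ d → vol d < ε → ρ ∈ A)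
    {Y : ℕ → B} (hY : Pairwise (Function.onFun Disjoint Y)) (hYε : vol (join Y) < ε)
    {g : ℕ → Aut B} (hg : ∀ j, ∃ α β γ a b c, g j = α * β * γ ∧ (IsSwap α a ∧ a ⊔ α • a ≤ Y j) ∧
      (IsSwap β b ∧ b ⊔ β • b ≤ Y j) ∧ IsSwap γ c ∧ c ⊔ γ • c ≤ Y j)
    {P : Aut B} (hP : ∀ j, ∀ x ≤ Y j, P • x = g j • x) (hPs : SuppIn P (join Y)) :
    P ∈ A * A * A := by
  choose α β γ a b c hg hα hβ hγ using hg
  have key : ∀ (α : ℕ → Aut B) (a : ℕ → B), (∀ j, IsSwap (α j) (a j) ∧ a j ⊔ α j • a j ≤ Y j) →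
      ∃ Q ∈ A, (∀ j, ∀ x ≤ Y j, Q • x = α j • x) ∧ SuppIn Q (join Y) := by
    intro α a h
    obtain ⟨Q, hQ, hQs⟩ := exists_glue_supp hY hY rfl α fun j =>
      ((h j).1.supp.mono (h j).2).smul_eq
    have h1 := IsSwap.join_of_agree hY (fun j => (h j).1) (fun j => (h j).2) hQ hQs
    refine ⟨Q, hA Q _ h1 (lt_of_le_of_lt (vol_mono ?_) hYε), hQ, hQs⟩
    exact join_le_join_iff fun j => ⟨j, le_sup_left.trans (h j).2⟩
  obtain ⟨Q₁, hQ₁, h₁, s₁⟩ := key α a hα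
  obtain ⟨Q₂, hQ₂, h₂, s₂⟩ := key β b hβ
  obtain ⟨Q₃, hQ₃, h₃, s₃⟩ := key γ c hγ
  have : P = Q₁ * Q₂ * Q₃ := by
    refine hPs.eq_of_agree le_rfl ((s₁.mul s₂).mul s₃) fun j x hx => ?_
    have hx₃ : γ j • x ≤ Y j := ((hγ j).1.supp.mono (hγ j).2).smul_le hx
    have hx₂ : β j • γ j • x ≤ Y j := ((hβ j).1.supp.mono (hβ j).2).smul_le hx₃
    rw [hP j x hx, hg, mul_smul, mul_smul, mul_smul, mul_smul, h₃ j x hx, h₂ j _ hx₃, h₁ j _ hx₂]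
  rw [this]
  exact Set.mul_mem_mul (Set.mul_mem_mul hQ₁ hQ₂) hQ₃

/-- An automorphism of small support is a product of six swaps of small domain. With
`s = κ₀ * a₁`, `a₁ = κ₁ * a₂` and so on, copies of the automorphisms `aₖ` are placed on disjoint
elements `Fₖ`, and `s` is written as a telescoping product of the quotients of successive copies. -/
theorem mem_of_suppIn {A : Set (Aut B)} {ε : ℝ} (hA : ∀ ρ d, IsSwap ρ d → vol d < ε → ρ ∈ A)
    {s : Aut B} {e : B} (hs : SuppIn s e) (he : 3 * vol e < ε) (he1 : 3 * vol e ≤ 1) :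
    s ∈ (A * A * A) * (A * A * A) := by
  obtain ⟨t, ht0, htP, htR⟩ := exists_seq_of_step
    (P := fun k (t : Aut B × B) => SuppIn t.1 t.2 ∧ vol t.2 = (2 / 3) ^ k * vol e)
    (R := fun _ t t' => t'.2 ≤ t.2 ∧ ∃ κ E, IsSwap κ E ∧ E ⊔ κ • E ≤ t.2 ∧ t.1 = κ * t'.1)
    (s, e) ⟨hs, by simp⟩ (by
      rintro k ⟨a, e⟩ ⟨ha, hv⟩
      obtain ⟨κ, a', E, e', h1, h2, h3, h4, h5, h6⟩ := exists_eq_swap_mul ha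
      refine ⟨(a', e'), ⟨h5, ?_⟩, h3, κ, E, h1, h2, h6⟩
      dsimp only at hv ⊢
      rw [h4, hv]; ring)
  let a : ℕ → Aut B := fun k => (t k).1
  let r : ℕ → B := fun k => (t k).2
  have ha : ∀ k, SuppIn (a k) (r k) := fun k => (htP k).1
  have hr : ∀ k, r (k + 1) ≤ r k := fun k => (htR k).1
  choose κ E hκ hE hκa using fun k => (htR k).2
  have hκa' : ∀ k, a k = κ k * a (k + 1) := hκa
  have hv : HasSum (fun k => vol (r k)) (3 * vol e) := by
    have h1 := (hasSum_geometric_of_lt_one (by norm_num : (0 : ℝ) ≤ 2 / 3) (by norm_num)).mul_right (vol e)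
    rw [show (1 - 2 / 3 : ℝ)⁻¹ = 3 by norm_num] at h1
    exact h1.congr_fun fun k => (htP k).2
  -- disjoint copies of the supports
  obtain ⟨F, hF, θ, hθ, hθ0⟩ : ∃ F : ℕ → B, Pairwise (Function.onFun Disjoint F) ∧
      ∃ θ : ℕ → Aut B, (∀ k, θ k • r k = F k) ∧ θ 0 = 1 := by
    obtain ⟨F, hF, -, hFv⟩ := exists_disjoint_vol_eq (⊤ : B) (fun k => vol_nonneg (r k)) hv
      (by rw [vol_top]; exact he1)
    choose θ hθ using fun k => exists_smul_eq (hFv k).symm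
    refine ⟨fun k => (θ 0)⁻¹ • F k, fun i j hij => disjoint_smul.2 (hF hij),
      fun k => (θ 0)⁻¹ * θ k, fun k => ?_, inv_mul_cancel _⟩
    rw [mul_smul, hθ]
  have hF0 : F 0 = e := by
    rw [← hθ, hθ0, one_smul]
    exact congrArg Prod.snd ht0
  have hFε : vol (join F) < ε := by
    refine (vol_join_le (s := 3 * vol e) ?_).trans_lt he
    refine hv.congr_fun fun k => ?_
    rw [← hθ, vol_smul]
  let ã : ℕ → Aut B := fun k => θ k * a k * (θ k)⁻¹
  have hã : ∀ k, SuppIn (ã k) (F k) := fun k => by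
    have := (ha k).conj (θ k)
    rwa [hθ] at this
  have hã0 : ã 0 = s := by
    simp only [ã, hθ0, one_mul, inv_one, mul_one]
    exact congrArg Prod.fst ht0
  have hFix : ∀ i j, i ≠ j → ∀ x ≤ F i, ã j • x = x := fun i j hij x hx =>
    hã j x ((hF hij).mono_left hx)
  have hFixi : ∀ i j, i ≠ j → ∀ x ≤ F i, (ã j)⁻¹ • x = x := fun i j hij x hx =>
    (hã j).inv x ((hF hij).mono_left hx)
  -- the quotient of two successive copies is a product of three swaps
  have hp : ∀ k, ∃ α β γ x y z, ã k * (ã (k + 1))⁻¹ = α * β * γ ∧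
      (IsSwap α x ∧ x ⊔ α • x ≤ F k ⊔ F (k + 1)) ∧ (IsSwap β y ∧ y ⊔ β • y ≤ F k ⊔ F (k + 1)) ∧
      IsSwap γ z ∧ z ⊔ γ • z ≤ F k ⊔ F (k + 1) := by
    intro k
    let b := θ k * a (k + 1) * (θ k)⁻¹
    have hz : θ k • r (k + 1) ≤ F k := by rw [← hθ]; exact smul_le_smul (hr k)
    have hb : SuppIn b (θ k • r (k + 1)) := (ha (k + 1)).conj (θ k)
    let ψ := θ (k + 1) * (θ k)⁻¹
    have hψ : ψ • θ k • r (k + 1) = F (k + 1) := by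
      rw [mul_smul, inv_smul_smul, hθ]
    obtain ⟨ι, hι, hι1, hι2⟩ := exists_isSwap_along (b := θ k • r (k + 1)) ψ
      (by rw [hψ]; exact (hF (by simp)).mono_left hz)
    have hιd : ι • θ k • r (k + 1) = F (k + 1) := by rw [hι1 _ le_rfl, hψ]
    have hbι : ã (k + 1) = ι * b * ι := by
      have h1 : SuppIn (ι * b * ι) (F (k + 1)) := by
        have := hb.conj ι
        rwa [hιd, hι.inv_eq] at this
      refine (hã (k + 1)).eq_of_agree (b := fun _ : Unit => F (k + 1)) (le_join _ ()) h1 fun _ x hx => ?_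
      have hx' : x ≤ ψ • θ k • r (k + 1) := hψ ▸ hx
      have h2 : ψ⁻¹ • x ≤ θ k • r (k + 1) := smul_le_iff.2 (by rwa [inv_inv])
      rw [mul_smul (ι * b), mul_smul ι b, hι2 x hx', hι1 _ (hb.smul_le h2), ← mul_smul, ← mul_smul]
      congr 1
      simp only [ã, b, ψ]
      group
    refine ⟨θ k * κ k * (θ k)⁻¹, b * ι * b⁻¹, ι, θ k • E k, b • θ k • r (k + 1), θ k • r (k + 1),
      ?_, ⟨(hκ k).conj _, ?_⟩, ⟨hι.conj b, ?_⟩, hι, ?_⟩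
    · have h1 : ã k = θ k * κ k * (θ k)⁻¹ * b := by
        simp only [ã, b, hκa' k]; group
      rw [h1, hbι, mul_inv_rev, mul_inv_rev, hι.inv_eq]
      group
    · have h1 : (θ k * κ k * (θ k)⁻¹) • θ k • E k = θ k • κ k • E k := by
        rw [mul_smul, mul_smul, inv_smul_smul]
      rw [h1, ← smul_sup]
      refine le_sup_of_le_left ?_
      rw [← hθ]; exact smul_le_smul (hE k)
    · have h1 : (b * ι * b⁻¹) • b • θ k • r (k + 1) = b • F (k + 1) := by
        rw [mul_smul, mul_smul, inv_smul_smul, hιd]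
      rw [h1, hb.smul_eq, hb _ ((hF (by simp)).symm.mono_right hz)]
      exact sup_le_sup_right hz _
    · rw [hιd]; exact sup_le_sup_right hz _
  -- pairing the copies in the two possible ways
  have pairing : ∀ c : ℕ, ∃ P ∈ A * A * A,
      (∀ j, ∀ x ≤ F (2 * j + c) ⊔ F (2 * j + c + 1),
        P • x = (ã (2 * j + c) * (ã (2 * j + c + 1))⁻¹) • x) ∧
      SuppIn P (join fun j => F (2 * j + c) ⊔ F (2 * j + c + 1)) := by
    intro c
    have hY : Pairwise (Function.onFun Disjoint fun j => F (2 * j + c) ⊔ F (2 * j + c + 1)) := by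
      intro i j hij
      simp only [Function.onFun, disjoint_sup_left, disjoint_sup_right]
      exact ⟨⟨hF (by omega), hF (by omega)⟩, hF (by omega), hF (by omega)⟩
    have hs : ∀ j, SuppIn (ã (2 * j + c) * (ã (2 * j + c + 1))⁻¹)
        (F (2 * j + c) ⊔ F (2 * j + c + 1)) := fun j =>
      ((hã _).mono le_sup_left).mul ((hã _).inv.mono le_sup_right)
    obtain ⟨P, hP, hPs⟩ := exists_glue_supp hY hY rfl
      (fun j => ã (2 * j + c) * (ã (2 * j + c + 1))⁻¹) fun j => (hs j).smul_eq
    refine ⟨P, mem_mul_of_agree hA hY (lt_of_le_of_lt (vol_mono ?_) hFε)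
      (fun j => hp (2 * j + c)) hP hPs, hP, hPs⟩
    exact join_le_iff.2 fun j => sup_le (le_join F _) (le_join F _)
  obtain ⟨P, hPA, hP, hPs⟩ := pairing 0
  obtain ⟨Q, hQA, hQ, hQs⟩ := pairing 1
  have hsPQ : s = P * Q := by
    refine (hs.mono (hF0 ▸ le_join F 0)).eq_of_agree (b := F) le_rfl ((hPs.mono ?_).mul (hQs.mono ?_))
      fun k x hx => ?_
    · exact join_le_iff.2 fun j => sup_le (le_join F _) (le_join F _)
    · exact join_le_iff.2 fun j => sup_le (le_join F _) (le_join F _)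
    rw [mul_smul]
    rcases Nat.even_or_odd' k with ⟨j, rfl | rfl⟩
    · cases j with
      | zero =>
        have h1 : Q • x = x := hQs x (by
          rw [disjoint_join_right]
          intro j
          rw [disjoint_sup_right]
          exact ⟨(hF (by omega)).mono_left hx, (hF (by omega)).mono_left hx⟩)
        rw [h1, hP 0 x (hx.trans le_sup_left), mul_smul, hFixi 0 _ (by omega) x hx, ← hã0]
      | succ j =>
        have h1 : Q • x = (ã (2 * (j + 1)))⁻¹ • x := by
          rw [hQ j x (hx.trans le_sup_right), mul_smul]
          exact hFix (2 * (j + 1)) _ (by omega) _ ((hã _).inv.smul_le hx)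
        have h2 := (hã (2 * (j + 1))).inv.smul_le hx
        rw [h1, hP (j + 1) _ (h2.trans le_sup_left), mul_smul,
          hFixi (2 * (j + 1)) _ (by omega) _ h2]
        change s • x = ã (2 * (j + 1)) • (ã (2 * (j + 1)))⁻¹ • x
        rw [smul_inv_smul, ← hã0]
        exact hFix _ 0 (by omega) x hx
    · have h1 : Q • x = ã (2 * j + 1) • x := by
        rw [hQ j x (hx.trans le_sup_left), mul_smul, hFixi (2 * j + 1) _ (by omega) x hx]
      have h2 := (hã (2 * j + 1)).smul_le hx
      rw [h1, hP j _ (h2.trans le_sup_right), mul_smul]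
      change s • x = ã (2 * j) • (ã (2 * j + 1))⁻¹ • ã (2 * j + 1) • x
      rw [inv_smul_smul, hFix (2 * j + 1) _ (by omega) x hx, ← hã0]
      exact hFix _ 0 (by omega) x hx
  rw [hsPQ]
  exact Set.mul_mem_mul hPA hQA

end ProbAlg

namespace ProbAlg

variable {B : Type*} [BooleanAlgebra B] [MetricSpace B] [ProbAlg B]

/-! ### Automorphisms of small support in a countably syndetic set -/

variable {W : Set (Aut B)} {k : ℕ → Aut B}

/-- If countably many translates of the symmetric set `W` cover the group then on some member `z`
of any disjoint sequence every automorphism supported in `z` agrees with an element of `W ^ 2`. -/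
theorem exists_full (hsymm : ∀ w ∈ W, w⁻¹ ∈ W) (hk : ∀ g, ∃ i, (k i)⁻¹ * g ∈ W) {X : ℕ → B}
    (hX : Pairwise (Function.onFun Disjoint X)) :
    ∃ n, ∀ g, SuppIn g (X n) → ∃ w ∈ W ^ 2, ∀ x ≤ X n, w • x = g • x := by
  have h1 : ∃ n, ∀ g, SuppIn g (X n) → ∃ w ∈ W, ∀ x ≤ X n, (k n * w) • x = g • x := by
    by_contra! hne
    choose g hg hgn using hne
    obtain ⟨f, hf, -⟩ := exists_glue_supp hX hX rfl g fun i => (hg i).smul_eq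
    obtain ⟨i, hi⟩ := hk f
    obtain ⟨x, hx, hne⟩ := hgn i _ hi
    rw [mul_inv_cancel_left] at hne
    exact hne (hf i x hx)
  obtain ⟨n, hn⟩ := h1
  obtain ⟨w₀, hw₀, h₀⟩ := hn 1 (suppIn_one _)
  refine ⟨n, fun g hg => ?_⟩
  obtain ⟨w, hw, h⟩ := hn g hg
  refine ⟨w₀⁻¹ * w, ?_, fun x hx => ?_⟩
  · rw [pow_two]; exact Set.mul_mem_mul (hsymm _ hw₀) hw
  · have h2 : w₀⁻¹ * w = (k n * w₀)⁻¹ * (k n * w) := by group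
    rw [h2, mul_smul, h x hx, inv_smul_eq_iff, h₀ _ (hg.smul_le hx), one_smul]

omit [ProbAlg B] in
theorem inv_mem_pow (hsymm : ∀ w ∈ W, w⁻¹ ∈ W) {n : ℕ} {w : Aut B} (hw : w ∈ W ^ n) :
    w⁻¹ ∈ W ^ n := by
  induction n generalizing w with
  | zero => simpa using hw
  | succ n ih =>
    rw [pow_succ] at hw
    obtain ⟨x, hx, y, hy, rfl⟩ := Set.mem_mul.1 hw
    rw [mul_inv_rev, pow_succ']
    exact Set.mul_mem_mul (hsymm _ hy) (ih hx)

/-- There is a nontrivial swap in `W ^ 2` below any nonzero element: among the uncountably many swaps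
`ρ a` along a fixed `σ`, indexed by `a : Set ℕ`, two lie in the same translate of `W`, and
`(ρ a)⁻¹ * ρ b` is again one of these swaps. -/
theorem exists_swap_mem (hsymm : ∀ w ∈ W, w⁻¹ ∈ W) (hk : ∀ g, ∃ i, (k i)⁻¹ * g ∈ W) {z : B}
    (hz : z ≠ ⊥) : ∃ ρ d, IsSwap ρ d ∧ d ⊔ ρ • d ≤ z ∧ 0 < vol d ∧ 4 * vol d ≤ vol z ∧ ρ ∈ W ^ 2 := by
  have hzv := vol_pos hz
  obtain ⟨D, hD, hDv⟩ := exists_le_vol_eq z (vol z / 4) (by linarith) (by linarith)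
  obtain ⟨D', hD', hDv'⟩ := exists_le_vol_eq (z \ D) (vol z / 4) (by linarith)
    (by rw [vol_sdiff hD]; linarith)
  obtain ⟨σ, hσ⟩ := exists_smul_eq (hDv.trans hDv'.symm)
  have hDσ : Disjoint D (σ • D) := by rw [hσ]; exact disjoint_sdiff_self_right.mono_right hD'
  have hDz : D ⊔ σ • D ≤ z := by rw [hσ]; exact sup_le hD (hD'.trans sdiff_le)
  obtain ⟨F, hF, hFD, hFv⟩ := exists_disjoint_vol_eq D (v := fun n => vol D * (1 / 2) ^ (n + 1))
    (fun n => mul_nonneg (vol_nonneg _) (by positivity)) (s := vol D) (by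
      have := (hasSum_geometric_two' (vol D))
      refine this.congr_fun fun n => ?_
      rw [pow_succ, one_div_pow]; ring) le_rfl
  classical
  -- swaps along `σ` indexed by sets of natural numbers
  let E : Set ℕ → B := fun a => join fun n => if n ∈ a then F n else ⊥
  have hED : ∀ a, E a ≤ D := fun a => join_le_iff.2 fun n => by
    split_ifs
    exacts [hFD n, bot_le]
  have hFE : ∀ a n, n ∈ a → F n ≤ E a := fun a n h => by
    have := le_join (fun n => if n ∈ a then F n else ⊥) n
    rwa [if_pos h] at this
  choose ρ hρ hρσ _ using fun a => exists_isSwap_along (b := E a) σ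
    (hDσ.mono (hED a) (smul_le_smul (hED a)))
  have hEsup : ∀ a b, E (a ∪ b) = E a ⊔ E b := fun a b => by
    refine le_antisymm (join_le_iff.2 fun n => ?_) (sup_le ?_ ?_)
    · split_ifs with h
      · rcases h with h | h
        · exact le_sup_of_le_left (hFE a n h)
        · exact le_sup_of_le_right (hFE b n h)
      · exact bot_le
    · refine join_le_join_iff fun n => ⟨n, ?_⟩
      split_ifs with h1 h2 <;> simp_all
    · refine join_le_join_iff fun n => ⟨n, ?_⟩
      split_ifs with h1 h2 <;> simp_all
  have hEdisj : ∀ a b, Disjoint a b → Disjoint (E a) (E b) := fun a b hab => by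
    rw [disjoint_join_left]
    intro i
    rw [disjoint_join_right]
    intro j
    split_ifs with h1 h2
    · exact hF fun h => Set.disjoint_left.1 hab h1 (h ▸ h2)
    all_goals simp
  have hmul : ∀ a b, Disjoint a b → ρ (a ∪ b) = ρ a * ρ b := fun a b hab => by
    have h1 := hρ (a ∪ b)
    have h4 := hρσ (a ∪ b)
    rw [hEsup] at h1 h4
    obtain ⟨ρ₁, ρ₂, h, h₁, h₂, e₁, e₂⟩ := h1.split (hEdisj a b hab)
    rw [h, h₁.ext (hρ a) fun x hx => by rw [e₁ x hx, h4 x (le_sup_of_le_left hx), hρσ a x hx],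
      h₂.ext (hρ b) fun x hx => by rw [e₂ x hx, h4 x (le_sup_of_le_right hx), hρσ b x hx]]
  choose i hi using fun a => hk (ρ a)
  obtain ⟨a, b, hab, hne⟩ : ∃ a b, i a = i b ∧ a ≠ b := by
    have := Function.cantor_injective i
    simpa [Function.Injective] using this
  have hW : (ρ a)⁻¹ * ρ b ∈ W ^ 2 := by
    have h1 : (ρ a)⁻¹ * ρ b = ((k (i a))⁻¹ * ρ a)⁻¹ * ((k (i a))⁻¹ * ρ b) := by group
    rw [h1, pow_two]
    refine Set.mul_mem_mul (hsymm _ (hi a)) ?_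
    rw [hab]; exact hi b
  have ha : ρ a = ρ (a ∩ b) * ρ (a \ b) := by
    rw [← hmul _ _ (Set.disjoint_sdiff_right.mono_left Set.inter_subset_right), Set.inter_union_sdiff]
  have hb : ρ b = ρ (a ∩ b) * ρ (b \ a) := by
    rw [← hmul _ _ (Set.disjoint_sdiff_right.mono_left Set.inter_subset_left), Set.inter_comm,
      Set.inter_union_sdiff]
  have hsd : (ρ a)⁻¹ * ρ b = ρ (a \ b ∪ b \ a) := by
    rw [hmul _ _ disjoint_sdiff_sdiff, ha, hb, ← (hρ (a \ b)).inv_eq]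
    simp only [(hρ (a \ b)).inv_eq, mul_inv_rev]
    group
  refine ⟨_, _, hρ (a \ b ∪ b \ a), ?_, ?_, ?_, hsd ▸ hW⟩
  · rw [hρσ _ _ le_rfl]
    exact (sup_le_sup (hED _) (smul_le_smul (hED _))).trans hDz
  · obtain ⟨n, hn⟩ : ∃ n, n ∈ a \ b ∪ b \ a := by
      by_contra! h
      refine hne (Set.ext fun n => ?_)
      have := h n
      simp only [Set.mem_union, Set.mem_sdiff] at this
      tauto
    refine lt_of_lt_of_le ?_ (vol_mono (hFE _ n hn))
    rw [hFv, hDv]; positivity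
  · have := vol_mono (hED (a \ b ∪ b \ a))
    rw [hDv] at this
    linarith

/-- Some power of a symmetric set which covers the group by countably many translates contains all
swaps of small domain. -/
theorem exists_small_swap_mem (hsymm : ∀ w ∈ W, w⁻¹ ∈ W) (hk : ∀ g, ∃ i, (k i)⁻¹ * g ∈ W) :
    ∃ ε > 0, ∀ (ρ : Aut B) d, IsSwap ρ d → vol d < ε → ρ ∈ W ^ 14 := by
  have hgeo : HasSum (fun n => (1 / 2 : ℝ) ^ (n + 1)) 1 := by
    refine (hasSum_geometric_two' 1).congr_fun fun n => ?_
    rw [pow_succ, one_div_pow]; ring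
  obtain ⟨X, hX, -, hXv⟩ := exists_disjoint_vol_eq (⊤ : B) (fun n => by positivity) hgeo
    (by rw [vol_top])
  obtain ⟨n, hn⟩ := exists_full hsymm hk hX
  set z := X n with hz
  have hzv : 0 < vol z := by rw [hXv]; positivity
  obtain ⟨η, δ, hη, hηz, hδ, hδz, hηW⟩ := exists_swap_mem hsymm hk (z := z)
    (fun h => by rw [h, vol_bot] at hzv; exact lt_irrefl _ hzv)
  -- swaps in `z` of the size of `η` are conjugate to `η` by elements of `W ^ 2`
  have h6 : ∀ (ρ : Aut B) d, IsSwap ρ d → d ⊔ ρ • d ≤ z → vol d = vol δ → ρ ∈ W ^ 6 := by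
    intro ρ d hρ hd hv
    obtain ⟨f, hf, rfl⟩ := hη.exists_conj_eq hρ hηz hd hv.symm
    obtain ⟨w, hw, hwf⟩ := hn f hf
    have hwz : w • z = z := by rw [hwf z le_rfl, hf.smul_eq]
    have h1 : SuppIn (w * η * w⁻¹) z := by
      have := (hη.supp.mono hηz).conj w
      rwa [hwz] at this
    have h2 : SuppIn (f * η * f⁻¹) z := (hf.mul (hη.supp.mono hηz)).mul hf.inv
    have h3 : f * η * f⁻¹ = w * η * w⁻¹ := by
      refine h2.eq_of_agree (b := fun _ : Unit => z) (le_join _ ()) h1 fun _ x hx => ?_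
      have h4 : w⁻¹ • x ≤ z := smul_le_iff.2 (by rw [inv_inv, hwz]; exact hx)
      have h5 : f⁻¹ • x = w⁻¹ • x := by
        rw [inv_smul_eq_iff, ← hwf _ h4, smul_inv_smul]
      rw [mul_smul, mul_smul, mul_smul, mul_smul, h5]
      exact (hwf _ ((hη.supp.mono hηz).smul_le h4)).symm
    rw [h3, show (6 : ℕ) = 2 + 2 + 2 from rfl, pow_add, pow_add]
    exact Set.mul_mem_mul (Set.mul_mem_mul hw hηW) (inv_mem_pow hsymm hw)
  -- a smaller swap is the product of two of that size
  have h12 : ∀ (ρ : Aut B) d, IsSwap ρ d → d ⊔ ρ • d ≤ z → vol d ≤ vol δ → ρ ∈ W ^ 12 := by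
    intro ρ d hρ hd hv
    have hd0 := vol_nonneg d
    obtain ⟨e, he, hev⟩ := exists_le_vol_eq d (vol d / 2) (by linarith) (by linarith)
    have hee : d = e ⊔ d \ e := by rw [sup_sdiff_cancel_right he]
    have hev' : vol (d \ e) = vol d / 2 := by rw [vol_sdiff he, hev]; ring
    have hρ' := hρ
    rw [hee] at hρ'
    obtain ⟨ρ₁, ρ₂, hρρ, h₁, h₂, e₁, e₂⟩ := hρ'.split disjoint_sdiff_self_right
    have hvd : vol (z \ (d ⊔ ρ • d)) = vol z - 2 * vol d := by
      rw [vol_sdiff hd, vol_sup _ _ hρ.disj, vol_smul]; ring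
    obtain ⟨c, hc, hcv⟩ := exists_le_vol_eq (z \ (d ⊔ ρ • d)) (vol δ - vol d / 2) (by linarith)
      (by linarith)
    obtain ⟨c', hc', hcv'⟩ := exists_le_vol_eq ((z \ (d ⊔ ρ • d)) \ c) (vol δ - vol d / 2)
      (by linarith) (by rw [vol_sdiff hc]; linarith)
    obtain ⟨θ, hθ⟩ := exists_smul_eq (hcv.trans hcv'.symm)
    obtain ⟨τ, hτ, hτθ, -⟩ := exists_isSwap_along (b := c) θ
      (by rw [hθ]; exact disjoint_sdiff_self_right.mono_right hc')
    have hτc : c ⊔ τ • c ≤ z \ (d ⊔ ρ • d) := by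
      rw [hτθ c le_rfl, hθ]; exact sup_le hc (hc'.trans sdiff_le)
    have hd₁ : e ⊔ ρ₁ • e ≤ d ⊔ ρ • d := by
      rw [e₁ e le_rfl]; exact sup_le_sup he (smul_le_smul he)
    have hd₂ : d \ e ⊔ ρ₂ • (d \ e) ≤ d ⊔ ρ • d := by
      rw [e₂ _ le_rfl]; exact sup_le_sup sdiff_le (smul_le_smul sdiff_le)
    have hj : ∀ u ≤ d ⊔ ρ • d, Disjoint u (c ⊔ τ • c) := fun u hu =>
      disjoint_sdiff_self_right.mono hu hτc
    have key : ∀ (ρ₁ : Aut B) e, IsSwap ρ₁ e → e ⊔ ρ₁ • e ≤ d ⊔ ρ • d → vol e = vol d / 2 →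
        ρ₁ * τ ∈ W ^ 6 := by
      intro ρ₁ e h₁ hd₁ hev
      refine h6 _ _ (h₁.mul hτ (hj _ hd₁)) ?_ ?_
      · have a1 : (ρ₁ * τ) • e = ρ₁ • e := by
          rw [mul_smul, hτ.supp _ (hj _ (le_sup_left.trans hd₁))]
        have a2 : (ρ₁ * τ) • c = τ • c := by
          rw [mul_smul, h₁.supp]
          exact ((hj _ hd₁).mono_right le_sup_right).symm
        rw [smul_sup, a1, a2]
        exact sup_le (sup_le (le_sup_left.trans (hd₁.trans hd)) (le_sup_left.trans (hτc.trans sdiff_le)))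
          (sup_le (le_sup_right.trans (hd₁.trans hd)) (le_sup_right.trans (hτc.trans sdiff_le)))
      · rw [vol_sup _ _ ((hj _ (le_sup_left.trans hd₁)).mono_right le_sup_left), hev, hcv]; ring
    have hcomm : ρ₂ * τ = τ * ρ₂ := h₂.supp.commute hτ.supp (hj _ hd₂)
    have : ρ = (ρ₁ * τ) * (ρ₂ * τ) := by
      rw [hcomm, show ρ₁ * τ * (τ * ρ₂) = ρ₁ * (τ * τ) * ρ₂ by group, hτ.mul_self, hρρ, mul_one]
    rw [this, show (12 : ℕ) = 6 + 6 from rfl, pow_add]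
    exact Set.mul_mem_mul (key ρ₁ e h₁ hd₁ hev) (key ρ₂ _ h₂ hd₂ hev')
  -- otherwise there are arbitrarily small bad swaps, and a single automorphism moves suitable
  -- translates of all their supports into `z`
  by_contra! hne
  let ε : ℕ → ℝ := fun i => min (vol δ) (vol z / 2 * (1 / 2) ^ (i + 1))
  choose ρ d hρ hd hρW using fun i => hne (ε i) (lt_min hδ (by positivity))
  let b : B := join fun i => k i • (d i ⊔ ρ i • d i)
  have hb : vol b ≤ vol z := by
    have h1 : HasSum (fun i => vol z * (1 / 2 : ℝ) ^ (i + 1)) (vol z) := by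
      simpa using hgeo.mul_left (vol z)
    have h2 : ∀ i, vol (k i • (d i ⊔ ρ i • d i)) ≤ vol z * (1 / 2 : ℝ) ^ (i + 1) := fun i => by
      have h3 := (hd i).le.trans (min_le_right _ _)
      rw [vol_smul, vol_sup _ _ (hρ i).disj, vol_smul]
      linarith
    have h3 : Summable fun i => vol (k i • (d i ⊔ ρ i • d i)) :=
      h1.summable.of_nonneg_of_le (fun i => vol_nonneg _) h2
    exact (vol_join_le h3.hasSum).trans (hasSum_le h2 h3.hasSum h1)
  obtain ⟨c, hc, hcv⟩ := exists_le_vol_eq z (vol b) (vol_nonneg b) hb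
  obtain ⟨f, hf⟩ := exists_smul_eq hcv.symm
  obtain ⟨i, hi⟩ := hk f⁻¹
  have hw := hsymm _ hi
  set w := ((k i)⁻¹ * f⁻¹)⁻¹ with hwdef
  have hwd : w • (d i ⊔ ρ i • d i) ≤ z := by
    refine le_trans ?_ hc
    rw [← hf, hwdef, mul_inv_rev, inv_inv, inv_inv, mul_smul]
    exact smul_le_smul (le_join (fun i => k i • (d i ⊔ ρ i • d i)) i)
  have h1 := (hρ i).conj w
  have h2 : w * ρ i * w⁻¹ ∈ W ^ 12 := by
    refine h12 _ _ h1 ?_ ?_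
    · rw [mul_smul, mul_smul, inv_smul_smul, ← smul_sup]; exact hwd
    · rw [vol_smul]; exact (hd i).le.trans (min_le_left _ _)
  refine hρW i ?_
  rw [show ρ i = w⁻¹ * (w * ρ i * w⁻¹) * w by group, show (14 : ℕ) = 1 + 12 + 1 from rfl, pow_add,
    pow_add, pow_one]
  exact Set.mul_mem_mul (Set.mul_mem_mul (hsymm _ hw) h2) hw

/-- The 84th power of a symmetric set with countably many translates covering the group contains all
automorphisms of small support, these being products of six small swaps. -/
theorem exists_small_supp_mem (hsymm : ∀ w ∈ W, w⁻¹ ∈ W) (hk : ∀ g, ∃ i, (k i)⁻¹ * g ∈ W) :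
    ∃ ε > 0, ∀ (s : Aut B) e, SuppIn s e → vol e < ε → s ∈ W ^ 84 := by
  obtain ⟨ε, hε, h⟩ := exists_small_swap_mem hsymm hk
  refine ⟨min (ε / 3) (1 / 3), lt_min (by positivity) (by norm_num), fun s e hs he => ?_⟩
  have h1 := he.trans_le (min_le_left _ _)
  have h2 := he.trans_le (min_le_right _ _)
  have h3 := mem_of_suppIn h hs (by linarith) (by linarith)
  rwa [← pow_add, ← pow_add, ← pow_add] at h3

end ProbAlg

namespace ProbAlg

variable {B : Type*} [BooleanAlgebra B] [MetricSpace B] [ProbAlg B]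

/-! ### Automorphisms preserving a dyadic algebra -/

namespace Tree

variable (T : Tree (⊤ : B)) {n m : ℕ}

theorem vol_node' (w : Fin n → Bool) : vol (T.node n w) = 1 / 2 ^ n := by
  rw [T.vol_node, vol_top]

theorem node_ne_bot (w : Fin n → Bool) : T.node n w ≠ ⊥ := fun h => by
  have h1 := T.vol_node' w
  rw [h, vol_bot] at h1
  have : (0 : ℝ) < 1 / 2 ^ n := by positivity
  linarith

/-- The initial segment of a word. -/
def res (h : n ≤ m) (w : Fin m → Bool) : Fin n → Bool := fun i => w (Fin.castLE h i)

omit [ProbAlg B] in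
theorem node_succ_le (w : Fin (n + 1) → Bool) : T.node (n + 1) w ≤ T.node n (Fin.init w) := by
  rw [T.node_succ n (Fin.init w)]
  cases h : w (Fin.last n)
  · refine le_sup_of_le_right (le_of_eq ?_)
    rw [← h, Fin.snoc_init_self]
  · refine le_sup_of_le_left (le_of_eq ?_)
    rw [← h, Fin.snoc_init_self]

omit [ProbAlg B] in
theorem node_le_res (h : n ≤ m) (w : Fin m → Bool) : T.node m w ≤ T.node n (res h w) := by
  induction m, h using Nat.le_induction with
  | base => exact le_rfl
  | succ m hm ih => exact (T.node_succ_le w).trans (ih (Fin.init w))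

omit [ProbAlg B] in
/-- If each node of level `n` lies below a member of a disjoint family then the members of the
family are the suprema of the nodes below them. -/
theorem eq_sup_of_label {κ : Type*} [DecidableEq κ] {P : κ → B}
    (hP : Pairwise (Function.onFun Disjoint P)) {lab : (Fin n → Bool) → κ}
    (hlab : ∀ v, T.node n v ≤ P (lab v)) (x : κ) :
    P x = ({v | lab v = x} : Finset (Fin n → Bool)).sup (T.node n) := by
  refine le_antisymm ?_ (Finset.sup_le fun v hv => ?_)
  · have h1 : P x = P x ⊓ Finset.univ.sup (T.node n) := by rw [T.sup_node, inf_top_eq]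
    rw [h1, Finset.sup_inf_distrib_left]
    refine Finset.sup_le fun v _ => ?_
    by_cases hv : lab v = x
    · exact inf_le_right.trans (Finset.le_sup (f := T.node n) (by simpa using hv))
    · have : Disjoint (P x) (T.node n v) := (hP (Ne.symm hv)).mono_right (hlab v)
      rw [this.eq_bot]; exact bot_le
  · have : lab v = x := by simpa using hv
    rw [← this]; exact hlab v

theorem vol_eq_card {κ : Type*} [DecidableEq κ] {P : κ → B}
    (hP : Pairwise (Function.onFun Disjoint P)) {lab : (Fin n → Bool) → κ}
    (hlab : ∀ v, T.node n v ≤ P (lab v)) (x : κ) :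
    vol (P x) = Fintype.card {v // lab v = x} * (1 / 2 ^ n) := by
  rw [T.eq_sup_of_label hP hlab, vol_finset_sup _ _ fun i _ j _ h => T.disj n h, Fintype.card_subtype]
  simp only [T.vol_node', Finset.sum_const, nsmul_eq_mul]

/-- Two families of unions of nodes of level `n`, with the same measures, are matched by a permutation
of these nodes. -/
theorem exists_perm {κ : Type*} {P Q : κ → B}
    (hP : Pairwise (Function.onFun Disjoint P)) (hQ : Pairwise (Function.onFun Disjoint Q))
    {lab lab' : (Fin n → Bool) → κ} (hlab : ∀ v, T.node n v ≤ P (lab v))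
    (hlab' : ∀ v, T.node n v ≤ Q (lab' v)) (hv : ∀ x, vol (P x) = vol (Q x)) :
    ∃ σ : Equiv.Perm (Fin n → Bool), ∀ v, lab' (σ v) = lab v := by
  classical
  have hc : ∀ x, Fintype.card {v // lab v = x} = Fintype.card {v // lab' v = x} := fun x => by
    have h1 := hv x
    rw [T.vol_eq_card hP hlab, T.vol_eq_card hQ hlab'] at h1
    exact_mod_cast mul_right_cancel₀ (by positivity) h1
  exact ⟨Equiv.ofFiberEquiv fun x => Fintype.equivOfCardEq (hc x), Equiv.ofFiberEquiv_map _⟩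

/-- The algebra of finite unions of nodes. -/
def alg : Set B := {a | ∃ n, ∃ S : Finset (Fin n → Bool), S.sup (T.node n) = a}

omit [ProbAlg B] in
theorem node_mem_alg (w : Fin n → Bool) : T.node n w ∈ T.alg := ⟨n, {w}, by simp⟩

omit [ProbAlg B] in
theorem exists_level {a : B} (ha : a ∈ T.alg) :
    ∃ N, ∀ n, N ≤ n → ∃ S : Finset (Fin n → Bool), S.sup (T.node n) = a := by
  obtain ⟨n, S, rfl⟩ := ha
  exact ⟨n, fun m hm => T.exists_sup_eq hm S⟩

omit [ProbAlg B] in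
theorem countable_alg : T.alg.Countable := by
  have : T.alg = Set.range fun i : Σ n, Finset (Fin n → Bool) => i.2.sup (T.node i.1) := by
    ext a
    constructor
    · rintro ⟨n, S, h⟩; exact ⟨⟨n, S⟩, h⟩
    · rintro ⟨⟨n, S⟩, h⟩; exact ⟨n, S, h⟩
  rw [this]
  exact Set.countable_range _

omit [ProbAlg B] in
theorem exists_dense_seq : ∃ d : ℕ → B, DenseRange d ∧ Set.range d = T.alg := by
  obtain ⟨d, hd⟩ := T.countable_alg.exists_eq_range ⟨⊥, 0, ∅, Finset.sup_empty⟩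
  refine ⟨d, fun x => ?_, hd.symm⟩
  rw [← hd, Metric.mem_closure_iff]
  intro ε hε
  obtain ⟨n, S, hS⟩ := T.dense x le_top ε hε
  exact ⟨_, ⟨n, S, rfl⟩, hS⟩

/-- Every permutation of the nodes of a level extends to an automorphism permuting the nodes of each
later level. -/
theorem exists_lift (σ : Equiv.Perm (Fin n → Bool)) : ∃ g : Aut B,
    (∀ w, g • T.node n w = T.node n (σ w)) ∧ (∀ a ∈ T.alg, g • a ∈ T.alg) ∧
      ∀ a ∈ T.alg, g⁻¹ • a ∈ T.alg := by
  classical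
  let κ : ℕ → Type := fun k => (Fin n → Bool) × (Fin k → Bool)
  let q : ∀ k, κ k → B := fun k x => T.node (n + k) (Fin.append x.1 x.2)
  let σ' : ∀ k, Equiv.Perm (κ k) := fun k => σ.prodCongr (Equiv.refl _)
  have hinj : ∀ k, Function.Injective fun x : κ k => Fin.append x.1 x.2 := fun k =>
    (Fin.appendEquiv n k).injective
  have hq : ∀ k, Pairwise (Function.onFun Disjoint (q k)) := fun k x y hxy =>
    T.disj (n + k) fun h => hxy (hinj k h)
  have hqπ : ∀ k x, q k x = ({y | (y.1, (Fin.init y.2 : Fin k → Bool)) = x} :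
      Set (κ (k + 1))).toFinset.sup (q (k + 1)) := by
    rintro k ⟨w, u⟩
    have : ({y | (y.1, (Fin.init y.2 : Fin k → Bool)) = (w, u)} : Set (κ (k + 1))).toFinset =
        {(w, Fin.snoc u true), (w, Fin.snoc u false)} := by
      ext ⟨w', u'⟩
      rw [Set.mem_toFinset, Finset.mem_insert, Finset.mem_singleton]
      constructor
      · intro h
        obtain rfl : w' = w := congrArg Prod.fst h
        obtain rfl : (Fin.init u' : Fin k → Bool) = u := congrArg Prod.snd h
        cases h : u' (Fin.last k)
        · exact Or.inr (congrArg (Prod.mk w') (by rw [← h, Fin.snoc_init_self]))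
        · exact Or.inl (congrArg (Prod.mk w') (by rw [← h, Fin.snoc_init_self]))
      · rintro (h | h) <;> cases h <;> exact congrArg (Prod.mk w) (Fin.init_snoc _ _)
    rw [this, Finset.sup_insert, Finset.sup_singleton]
    simp only [q, Fin.append_snoc]
    exact T.node_succ (n + k) (Fin.append w u)
  have hsup : ∀ k (S : Finset (Fin (n + k) → Bool)), ∃ R : Finset (κ k),
      R.sup (q k) = S.sup (T.node (n + k)) := fun k S => by
    refine ⟨S.map (Fin.appendEquiv n k).symm.toEmbedding, ?_⟩
    rw [Finset.sup_map]
    refine Finset.sup_congr rfl fun w _ => ?_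
    simp only [q, Function.comp_apply, Equiv.coe_toEmbedding]
    exact congrArg (T.node (n + k)) ((Fin.appendEquiv n k).apply_symm_apply w)
  have hσsup : ∀ k (R : Finset (κ k)), ∃ R' : Finset (κ k),
      R'.sup (fun x => q k (σ' k x)) = R.sup (q k) := fun k R => by
    refine ⟨R.map (σ' k).symm.toEmbedding, ?_⟩
    rw [Finset.sup_map]
    refine Finset.sup_congr rfl fun w _ => ?_
    simp
  have hdense : DenseRange fun i : Σ k, Finset (κ k) => i.2.sup (q i.1) := by
    intro x
    rw [Metric.mem_closure_iff]
    intro ε hε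
    obtain ⟨m, S, hS⟩ := T.dense x le_top ε hε
    obtain ⟨S', hS'⟩ := T.exists_sup_eq (Nat.le_add_left m n) S
    obtain ⟨R, hR⟩ := hsup m S'
    exact ⟨_, ⟨⟨m, R⟩, rfl⟩, by dsimp only; rwa [hR, hS']⟩
  have hdense' : DenseRange fun i : Σ k, Finset (κ k) => i.2.sup fun x => q i.1 (σ' i.1 x) := by
    refine hdense.mono ?_
    rintro _ ⟨⟨k, R⟩, rfl⟩
    obtain ⟨R', hR'⟩ := hσsup k R
    exact ⟨⟨k, R'⟩, hR'⟩
  obtain ⟨g, hg⟩ := exists_aut_of_refining (κ := κ) (fun k y => (y.1, Fin.init y.2)) hq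
    (r := fun k x => q k (σ' k x)) (fun k x y hxy => hq k fun h => hxy ((σ' k).injective h)) hqπ
    (by
      rintro k ⟨w, u⟩
      rw [hqπ]
      have : ({y | (y.1, (Fin.init y.2 : Fin k → Bool)) = σ' k (w, u)} : Set (κ (k + 1))).toFinset =
          ({y | (y.1, (Fin.init y.2 : Fin k → Bool)) = (w, u)} : Set (κ (k + 1))).toFinset.map
            (σ' (k + 1)).toEmbedding := by
        ext ⟨w', u'⟩
        rw [Set.mem_toFinset, Finset.mem_map_equiv, Set.mem_toFinset]
        change (w', (Fin.init u' : Fin k → Bool)) = (σ w, u) ↔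
          (σ.symm w', (Fin.init u' : Fin k → Bool)) = (w, u)
        rw [Prod.mk.injEq, Prod.mk.injEq, Equiv.symm_apply_eq]
      rw [this, Finset.sup_map]
      rfl) hdense hdense'
    (fun k x => by simp only [q, T.vol_node'])
  have hgq : ∀ k (R : Finset (κ k)), g • R.sup (q k) = R.sup fun x => q k (σ' k x) := fun k R => by
    rw [smul_finset_sup]
    exact Finset.sup_congr rfl fun x _ => hg k x
  have hmem : ∀ k (R : Finset (κ k)), R.sup (q k) ∈ T.alg := fun k R => by
    refine ⟨n + k, R.map (Fin.appendEquiv n k).toEmbedding, ?_⟩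
    rw [Finset.sup_map]; rfl
  have hrep : ∀ a ∈ T.alg, ∃ k, ∃ R : Finset (κ k), R.sup (q k) = a := by
    rintro _ ⟨m, S, rfl⟩
    obtain ⟨S', hS'⟩ := T.exists_sup_eq (Nat.le_add_left m n) S
    obtain ⟨R, hR⟩ := hsup m S'
    exact ⟨m, R, hR.trans hS'⟩
  refine ⟨g, fun w => ?_, fun a ha => ?_, fun a ha => ?_⟩
  · have := hg 0 (w, Fin.elim0)
    have h0 : ∀ w : Fin n → Bool, q 0 (w, Fin.elim0) = T.node n w := fun w => by
      simp only [q, Fin.append_elim0]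
      rfl
    rw [h0] at this
    exact this.trans (h0 (σ w))
  · obtain ⟨k, R, rfl⟩ := hrep a ha
    rw [hgq]
    have : (R.sup fun x => q k (σ' k x)) = (R.map (σ' k).toEmbedding).sup (q k) := by
      rw [Finset.sup_map]; rfl
    rw [this]
    exact hmem k _
  · obtain ⟨k, R, rfl⟩ := hrep a ha
    obtain ⟨R', hR'⟩ := hσsup k R
    rw [← hR', ← hgq, inv_smul_smul]
    exact hmem k R'

end Tree

end ProbAlg

namespace ProbAlg

variable {B : Type*} [BooleanAlgebra B] [MetricSpace B]

/-- The group of automorphisms preserving the dyadic algebra of a tree. -/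
def treeSubgroup (T : Tree (⊤ : B)) : Subgroup (Aut B) where
  carrier := {g | ∀ a ∈ T.alg, g • a ∈ T.alg ∧ g⁻¹ • a ∈ T.alg}
  one_mem' := fun a ha => by simpa using ha
  mul_mem' := fun {g h} hg hh a ha => by
    rw [mul_inv_rev, mul_smul, mul_smul]
    exact ⟨(hg _ (hh a ha).1).1, (hh _ (hg a ha).2).2⟩
  inv_mem' := fun {g} hg a ha => by
    rw [inv_inv]; exact (hg a ha).symm

/-- The group `treeSubgroup T` as a type of its own, to be given the topology of pointwise
convergence on the discrete dyadic algebra instead of the subspace topology. -/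
def TreeAut (T : Tree (⊤ : B)) : Type _ := treeSubgroup T

namespace TreeAut

variable {T : Tree (⊤ : B)}

instance : Group (TreeAut T) := inferInstanceAs (Group (treeSubgroup T))

/-- The inclusion of the automorphisms preserving the dyadic algebra. -/
def toAut (T : Tree (⊤ : B)) : TreeAut T →* Aut B := (treeSubgroup T).subtype

instance : MulAction (TreeAut T) B := MulAction.compHom B (toAut T)

theorem toAut_smul (g : TreeAut T) (a : B) : toAut T g • a = g • a := rfl

theorem smul_mem (g : TreeAut T) {a : B} (ha : a ∈ T.alg) : g • a ∈ T.alg := (g.2 a ha).1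

theorem toAut_injective : Function.Injective (toAut T) := Subtype.val_injective

theorem exists_toAut_eq (g : Aut B) (h : ∀ a ∈ T.alg, g • a ∈ T.alg)
    (h' : ∀ a ∈ T.alg, g⁻¹ • a ∈ T.alg) : ∃ γ : TreeAut T, toAut T γ = g :=
  ⟨⟨g, fun a ha => ⟨h a ha, h' a ha⟩⟩, rfl⟩

/-- A code for the action of an automorphism and its inverse on the countable dyadic algebra. -/
noncomputable def code (g : TreeAut T) : (T.alg → ℕ) × (T.alg → ℕ) :=
  haveI : Countable T.alg := T.countable_alg
  (fun a => (exists_injective_nat T.alg).choose ⟨g • a.1, smul_mem g a.2⟩,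
    fun a => (exists_injective_nat T.alg).choose ⟨g⁻¹ • a.1, smul_mem g⁻¹ a.2⟩)

theorem code_fst_eq {g h : TreeAut T} (a : T.alg) : (code g).1 a = (code h).1 a ↔ g • a.1 = h • a.1 := by
  have : Countable T.alg := T.countable_alg
  exact (exists_injective_nat T.alg).choose_spec.eq_iff.trans Subtype.mk_eq_mk

theorem code_snd_eq {g h : TreeAut T} (a : T.alg) :
    (code g).2 a = (code h).2 a ↔ g⁻¹ • a.1 = h⁻¹ • a.1 := by
  have : Countable T.alg := T.countable_alg
  exact (exists_injective_nat T.alg).choose_spec.eq_iff.trans Subtype.mk_eq_mk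

/-- The topology of pointwise convergence on the dyadic algebra, taken with the discrete
topology. -/
noncomputable instance : TopologicalSpace (TreeAut T) := TopologicalSpace.induced code inferInstance

theorem tendsto_iff {ι : Type*} {l : Filter ι} {f : ι → TreeAut T} {g : TreeAut T} :
    Tendsto f l (𝓝 g) ↔ ∀ a ∈ T.alg, ∀ᶠ i in l, f i • a = g • a := by
  have h1 : Tendsto f l (𝓝 g) ↔ ∀ a : T.alg, (∀ᶠ i in l, f i • a.1 = g • a.1) ∧
      ∀ᶠ i in l, (f i)⁻¹ • a.1 = g⁻¹ • a.1 := by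
    rw [nhds_induced, tendsto_comap_iff, nhds_prod_eq, tendsto_prod_iff', tendsto_pi_nhds, tendsto_pi_nhds,
      ← forall_and]
    refine forall_congr' fun a => ?_
    rw [nhds_discrete, tendsto_pure, tendsto_pure]
    refine and_congr (eventually_congr (Eventually.of_forall fun i => code_fst_eq a))
      (eventually_congr (Eventually.of_forall fun i => code_snd_eq a))
  rw [h1]
  refine ⟨fun H a ha => (H ⟨a, ha⟩).1, fun H a => ⟨H a a.2, ?_⟩⟩
  filter_upwards [H _ (smul_mem g⁻¹ a.2)] with i hi
  rw [inv_smul_eq_iff, hi, smul_inv_smul]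

theorem eventually_smul_eq (g : TreeAut T) {a : B} (ha : a ∈ T.alg) :
    ∀ᶠ h in 𝓝 g, h • a = g • a := tendsto_iff.1 tendsto_id a ha

theorem isOpen_smul_eq {a b : B} (ha : a ∈ T.alg) : IsOpen {g : TreeAut T | g • a = b} := by
  rw [isOpen_iff_eventually]
  intro g hg
  filter_upwards [eventually_smul_eq g ha] with h hh
  exact hh.trans hg

instance : IsTopologicalGroup (TreeAut T) where
  continuous_mul := by
    rw [continuous_iff_continuousAt]
    rintro ⟨g, h⟩
    rw [ContinuousAt, tendsto_iff]
    intro a ha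
    have h1 : ∀ᶠ p : TreeAut T × TreeAut T in 𝓝 (g, h), p.1 • (h • a) = g • (h • a) :=
      continuous_fst.tendsto (g, h) |>.eventually (eventually_smul_eq g (smul_mem h ha))
    have h2 : ∀ᶠ p : TreeAut T × TreeAut T in 𝓝 (g, h), p.2 • a = h • a :=
      continuous_snd.tendsto (g, h) |>.eventually (eventually_smul_eq h ha)
    filter_upwards [h1, h2] with p hp1 hp2
    rw [mul_smul, mul_smul, hp2, hp1]
  continuous_inv := by
    rw [continuous_iff_continuousAt]
    intro g
    rw [ContinuousAt, tendsto_iff]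
    intro a ha
    filter_upwards [eventually_smul_eq g (smul_mem g⁻¹ ha)] with h hh
    rw [inv_smul_eq_iff, hh, smul_inv_smul]

theorem smul_finset_sup' {ι : Type*} (g : TreeAut T) (s : Finset ι) (f : ι → B) :
    g • s.sup f = s.sup fun i => g • f i := smul_finset_sup (toAut T g) s f

theorem disjoint_smul' {g : TreeAut T} {a b : B} : Disjoint (g • a) (g • b) ↔ Disjoint a b :=
  disjoint_smul (g := toAut T g)

theorem vol_smul' (g : TreeAut T) (a : B) : vol (g • a) = vol a := vol_smul (toAut T g) a

theorem mem_of_not_disjoint {n : ℕ} {S : Finset (Fin n → Bool)} {w : Fin n → Bool}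
    (h : ¬ Disjoint (T.node n w) (S.sup (T.node n))) : w ∈ S := by
  by_contra hw
  exact h (Finset.disjoint_sup_right.2 fun v hv => T.disj n fun hvw => hw (hvw ▸ hv))

section

variable [ProbAlg B]

omit [ProbAlg B] in
theorem ext_alg {g h : TreeAut T} (H : ∀ a ∈ T.alg, g • a = h • a) : g = h := by
  obtain ⟨d, hd, hda⟩ := T.exists_dense_seq
  refine toAut_injective (aut_ext fun a => ?_)
  exact congrFun (hd.equalizer ((toAut T g).1.isometry.continuous) ((toAut T h).1.isometry.continuous)
    (funext fun n => H (d n) (hda ▸ ⟨n, rfl⟩))) a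

/-- A sequence of automorphisms converges to an automorphism preserving the dyadic algebra if its
values and those of the inverses at each element of the algebra are eventually constant and in the
algebra. -/
theorem exists_tendsto {f : ℕ → Aut B}
    (h1 : ∀ a ∈ T.alg, ∃ N, f N • a ∈ T.alg ∧ ∀ i ≥ N, f i • a = f N • a)
    (h1' : ∀ a ∈ T.alg, ∃ N, (f N)⁻¹ • a ∈ T.alg ∧ ∀ i ≥ N, (f i)⁻¹ • a = (f N)⁻¹ • a) :
    ∃ γ : TreeAut T, Tendsto f atTop (𝓝 (toAut T γ)) ∧
      ∀ a ∈ T.alg, ∀ᶠ i in atTop, f i • a = γ • a := by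
  obtain ⟨d, hd, hda⟩ := T.exists_dense_seq
  have hdm : ∀ n, d n ∈ T.alg := fun n => hda ▸ ⟨n, rfl⟩
  have hconst : ∀ {f : ℕ → B} {N : ℕ}, (∀ i ≥ N, f i = f N) → Tendsto f atTop (𝓝 (f N)) :=
    fun hN => tendsto_const_nhds.congr' (eventually_atTop.2 ⟨_, fun i hi => (hN i hi).symm⟩)
  obtain ⟨g, hg⟩ := exists_tendsto_aut hd
    (fun n => (h1 _ (hdm n)).imp' (fun N => f N • d n) fun N hN => hconst hN.2)
    (fun n => (h1' _ (hdm n)).imp' (fun N => (f N)⁻¹ • d n) fun N hN => hconst hN.2)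
  obtain ⟨γ, rfl⟩ := exists_toAut_eq (T := T) g
    (fun a ha => by
      obtain ⟨N, hN, hN'⟩ := h1 a ha
      rwa [← tendsto_nhds_unique (hconst hN') (tendsto_aut_iff.1 hg a)])
    (fun a ha => by
      obtain ⟨N, hN, hN'⟩ := h1' a ha
      rwa [← tendsto_nhds_unique (hconst hN') (tendsto_aut_iff.1 hg.inv a)])
  refine ⟨γ, hg, fun a ha => ?_⟩
  obtain ⟨N, -, hN⟩ := h1 a ha
  refine eventually_atTop.2 ⟨N, fun i hi => (hN i hi).trans ?_⟩
  exact tendsto_nhds_unique (hconst hN) (tendsto_aut_iff.1 hg a)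

instance : PolishSpace (TreeAut T) := by
  have : Countable T.alg := T.countable_alg
  have hind : IsInducing (code (T := T)) := ⟨rfl⟩
  have hinj : Function.Injective (code (T := T)) := fun g h hgh =>
    ext_alg fun a ha => (code_fst_eq ⟨a, ha⟩).1 (congrFun (congrArg Prod.fst hgh) ⟨a, ha⟩)
  have hcl : IsClosed (Set.range (code (T := T))) := by
    refine IsSeqClosed.isClosed fun u p hu hp => ?_
    choose f hf using hu
    have hf' : ∀ i, code (f i) = u i := hf
    -- the actions on each element of the algebra are eventually constant
    obtain ⟨γ, -, hfγ⟩ := exists_tendsto (f := fun i => toAut T (f i)) (fun a ha => by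
        have h2 := ((continuous_apply (⟨a, ha⟩ : T.alg)).comp continuous_fst).continuousAt.tendsto.comp hp
        rw [nhds_discrete, tendsto_pure] at h2
        obtain ⟨N, hN⟩ := eventually_atTop.1 h2
        refine ⟨N, smul_mem (f N) ha, fun i hi => (code_fst_eq ⟨a, ha⟩).1 ?_⟩
        have h3 := hN i hi
        have h4 := hN N le_rfl
        simp only [Function.comp_apply, ← hf'] at h3 h4
        exact h3.trans h4.symm) (fun a ha => by
        have h2 := ((continuous_apply (⟨a, ha⟩ : T.alg)).comp continuous_snd).continuousAt.tendsto.comp hp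
        rw [nhds_discrete, tendsto_pure] at h2
        obtain ⟨N, hN⟩ := eventually_atTop.1 h2
        refine ⟨N, smul_mem (f N)⁻¹ ha, fun i hi => (code_snd_eq ⟨a, ha⟩).1 ?_⟩
        have h3 := hN i hi
        have h4 := hN N le_rfl
        simp only [Function.comp_apply, ← hf'] at h3 h4
        exact h3.trans h4.symm)
    replace hfγ : Tendsto f atTop (𝓝 γ) := tendsto_iff.2 hfγ
    exact ⟨γ, tendsto_nhds_unique ((hind.continuous.tendsto γ).comp hfγ)
      (hp.congr fun i => (hf' i).symm)⟩
  exact IsClosedEmbedding.polishSpace ⟨⟨hind, hinj⟩, hcl⟩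

/-- The automorphisms fixing the nodes of level `n`. -/
def stab (T : Tree (⊤ : B)) (n : ℕ) : Subgroup (TreeAut T) where
  carrier := {g | ∀ w, g • T.node n w = T.node n w}
  one_mem' := fun w => one_smul _ _
  mul_mem' := fun {g h} hg hh w => by rw [mul_smul, hh w, hg w]
  inv_mem' := fun {g} hg w => by rw [inv_smul_eq_iff, hg w]

/-- The automorphisms permuting the nodes of level `n`. -/
def norm (T : Tree (⊤ : B)) (n : ℕ) : Subgroup (TreeAut T) where
  carrier := {g | ∃ σ : Equiv.Perm (Fin n → Bool), ∀ w, g • T.node n w = T.node n (σ w)}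
  one_mem' := ⟨1, fun w => one_smul _ _⟩
  mul_mem' := by
    rintro g h ⟨σ, hσ⟩ ⟨τ, hτ⟩
    exact ⟨σ * τ, fun w => by rw [mul_smul, hτ, hσ]; rfl⟩
  inv_mem' := by
    rintro g ⟨σ, hσ⟩
    exact ⟨σ⁻¹, fun w => by rw [inv_smul_eq_iff, hσ]; simp⟩

/-- Two matching partitions into unions of nodes of level `n` are conjugate by an automorphism
permuting these nodes. -/
theorem exists_mem_norm {n : ℕ} {κ : Type*} {P Q : κ → B}
    (hP : Pairwise (Function.onFun Disjoint P)) (hQ : Pairwise (Function.onFun Disjoint Q))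
    {lab lab' : (Fin n → Bool) → κ} (hlab : ∀ v, T.node n v ≤ P (lab v))
    (hlab' : ∀ v, T.node n v ≤ Q (lab' v)) (hv : ∀ x, vol (P x) = vol (Q x)) :
    ∃ y ∈ norm T n, ∀ x, y • P x = Q x := by
  classical
  obtain ⟨σ, hσ⟩ := T.exists_perm hP hQ hlab hlab' hv
  obtain ⟨g, hg, h1, h2⟩ := T.exists_lift σ
  obtain ⟨y, rfl⟩ := exists_toAut_eq g h1 h2
  refine ⟨y, ⟨σ, hg⟩, fun x => ?_⟩
  refine eq_of_smul_le (g := toAut T y) ?_ (hv x).ge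
  rw [T.eq_sup_of_label hP hlab x, smul_finset_sup]
  refine Finset.sup_le fun v hv => ?_
  have hx : lab v = x := by simpa using hv
  rw [hg, ← hx, ← hσ]
  exact hlab' _

omit [ProbAlg B] in
theorem fixes_of_mem_stab {n : ℕ} {g : TreeAut T} (hg : g ∈ stab T n) {S : Finset (Fin n → Bool)} :
    g • S.sup (T.node n) = S.sup (T.node n) := by
  rw [smul_finset_sup']
  exact Finset.sup_congr rfl fun w _ => hg w

end

end TreeAut

end ProbAlg

/-! ### The level system of a dyadic algebra -/

namespace ProbAlg

variable {B : Type*} [BooleanAlgebra B] [MetricSpace B] [ProbAlg B]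

namespace Tree

variable (T : Tree (⊤ : B))

theorem res_eq_of_le {n m : ℕ} (h : n ≤ m) {w : Fin m → Bool} {z : Fin n → Bool}
    (hw : T.node m w ≤ T.node n z) : res h w = z := by
  by_contra hne
  have h1 : Disjoint (T.node n (res h w)) (T.node n z) := T.disj n hne
  exact T.node_ne_bot w (disjoint_self.1 (h1.mono (T.node_le_res h w) hw))

/-- If the members of a finite cover are unions of nodes of level `n` then every node of level `n`
lies below a member of the cover. -/
theorem exists_label {n : ℕ} {κ : Type*} [Fintype κ] {Q : κ → B} (hQ : Finset.univ.sup Q = ⊤)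
    (hS : ∀ x, ∃ S : Finset (Fin n → Bool), S.sup (T.node n) = Q x) (v : Fin n → Bool) :
    ∃ x, T.node n v ≤ Q x := by
  by_contra! hne
  have h1 : ∀ x, Disjoint (T.node n v) (Q x) := fun x => by
    obtain ⟨S, hS⟩ := hS x
    by_contra hd
    rw [← hS] at hd
    refine hne x ?_
    rw [← hS]
    exact Finset.le_sup (TreeAut.mem_of_not_disjoint hd)
  have h2 : Disjoint (T.node n v) (Finset.univ.sup Q) := Finset.disjoint_sup_right.2 fun x _ => h1 x
  rw [hQ] at h2
  exact T.node_ne_bot v (disjoint_top.1 h2)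

end Tree

namespace TreeAut

variable {T : Tree (⊤ : B)}

omit [ProbAlg B] in
theorem stab_anti : Antitone (stab T) := by
  intro n m h g hg w
  obtain ⟨S, hS⟩ := T.exists_sup_eq h {w}
  rw [Finset.sup_singleton] at hS
  rw [← hS]
  exact fixes_of_mem_stab hg

omit [ProbAlg B] in
theorem stab_basis (U : Set (TreeAut T)) (hU : U ∈ 𝓝 (1 : TreeAut T)) :
    ∃ n, (stab T n : Set (TreeAut T)) ⊆ U := by
  by_contra! hne
  choose g hg hgU using fun n => Set.not_subset.1 (hne n)
  have : Tendsto g atTop (𝓝 1) := tendsto_iff.2 fun a ha => by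
    obtain ⟨N, hN⟩ := T.exists_level ha
    refine eventually_atTop.2 ⟨N, fun n hn => ?_⟩
    obtain ⟨S, rfl⟩ := hN n hn
    rw [one_smul]
    exact fixes_of_mem_stab (hg n)
  obtain ⟨n, hn⟩ := (this.eventually hU).exists
  exact hgU n hn

omit [ProbAlg B] in
theorem stab_conj (n : ℕ) (a g : TreeAut T) (ha : a ∈ norm T n) (hg : g ∈ stab T n) :
    a * g * a⁻¹ ∈ stab T n := by
  obtain ⟨σ, hσ⟩ := inv_mem ha
  intro w
  rw [mul_smul, mul_smul, hσ, hg, ← hσ, smul_inv_smul]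

/-- The effect of an automorphism on a level of the tree is induced by permutations of the nodes of
each later level fine enough to resolve the images. -/
theorem exists_norm_near (x : TreeAut T) (k : ℕ) :
    ∃ M, k ≤ M ∧ ∀ n, M ≤ n → ∃ y ∈ norm T n, x⁻¹ * y ∈ stab T k := by
  choose N hN using fun w : Fin k → Bool => T.exists_level (smul_mem x (T.node_mem_alg w))
  refine ⟨max k (Finset.univ.sup N), le_max_left _ _, fun n hn => ?_⟩
  have hkn : k ≤ n := (le_max_left _ _).trans hn
  choose lab hlab using T.exists_label (n := n) (Q := fun w : Fin k → Bool => x • T.node k w)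
    (by
      rw [← smul_finset_sup', T.sup_node]
      exact smul_top (toAut T x))
    (fun w => hN w n ((Finset.le_sup (Finset.mem_univ w)).trans ((le_max_right _ _).trans hn)))
  obtain ⟨y, hy, hyx⟩ := exists_mem_norm (T := T) (T.disj k)
    (fun w w' h => disjoint_smul'.2 (T.disj k h)) (T.node_le_res hkn) hlab
    (fun w => (vol_smul' x _).symm)
  exact ⟨y, hy, fun w => by rw [mul_smul, hyx, inv_smul_smul]⟩

/-- Amalgamation: a copy of level `n'` can be placed independently of level `l` over their common
level `n`. -/
theorem exists_amalgam (n l n' : ℕ) (hl : n ≤ l) (hn' : n ≤ n') : ∃ L, l ≤ L ∧ ∃ c ∈ stab T n,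
    (∀ g ∈ stab T L, c * g * c⁻¹ ∈ stab T n') ∧
    ∀ a p, a ∈ norm T n → a ∈ norm T l → p ∈ norm T n → p ∈ norm T n' → p⁻¹ * a ∈ stab T n →
      ∃ e, e ∈ norm T l ∧ e ∈ norm T L ∧ a⁻¹ * e ∈ stab T l ∧
        p⁻¹ * (c * e * c⁻¹) ∈ stab T n' := by
  classical
  obtain ⟨d, rfl⟩ := Nat.exists_eq_add_of_le hn'
  have hL : l ≤ l + d := Nat.le_add_right l d
  -- a word of length `l + d` consists of a word of length `l` and of the `d` last letters of a word
  -- of length `n + d`, both words having the same initial segment of length `n`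
  let r : (Fin (l + d) → Bool) → Fin (n + d) → Bool := fun w j =>
    if h : j.1 < n then w ⟨j.1, by omega⟩ else w ⟨l + (j.1 - n), by omega⟩
  let paste : (Fin l → Bool) → (Fin (n + d) → Bool) → Fin (l + d) → Bool := fun v u j =>
    if h : j.1 < l then v ⟨j.1, h⟩ else u ⟨n + (j.1 - l), by omega⟩
  have hres_paste : ∀ v u, Tree.res hL (paste v u) = v := fun v u => by
    funext j
    simp [Tree.res, paste]
  have hr_paste : ∀ v u, Tree.res hl v = Tree.res hn' u → r (paste v u) = u := fun v u h => by
    funext j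
    by_cases hj : j.1 < n
    · have h1 := congrFun h ⟨j.1, hj⟩
      simp only [Tree.res, Fin.castLE_mk] at h1
      have hjl : j.1 < l := by omega
      simp only [r, paste, hj, hjl, dif_pos, h1]
    · have h1 : ¬ (l + (j.1 - n) < l) := by omega
      simp only [r, paste, hj, h1, dif_neg, not_false_eq_true]
      congr 1
      ext
      simp only
      omega
  have hcompat : ∀ w, Tree.res hl (Tree.res hL w) = Tree.res hn' (r w) := fun w => by
    funext j
    simp [Tree.res, r]
    rfl
  have hpaste : ∀ w, paste (Tree.res hL w) (r w) = w := fun w => by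
    funext j
    by_cases hj : j.1 < l
    · simp [paste, Tree.res, hj]
    · have h1 : ¬ (n + (j.1 - l) < n) := by omega
      simp only [paste, r, hj, h1, dif_neg, not_false_eq_true]
      congr 1
      ext
      simp only
      omega
  -- the copy of level `n + d` inside level `l + d`
  let Q : (Fin (n + d) → Bool) → B := fun u =>
    ({w | r w = u} : Finset (Fin (l + d) → Bool)).sup (T.node (l + d))
  have hrQ : ∀ w, T.node (l + d) w ≤ Q (r w) := fun w => Finset.le_sup (by simp)
  have hQdisj : Pairwise (Function.onFun Disjoint Q) := by
    intro u u' huu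
    refine Finset.disjoint_sup_left.2 fun w hw => Finset.disjoint_sup_right.2 fun w' hw' =>
      T.disj _ fun h => huu ?_
    have h1 : r w = u := by simpa using hw
    have h2 : r w' = u' := by simpa using hw'
    rw [← h1, ← h2, h]
  have hQvol : ∀ u, vol (Q u) = 1 / 2 ^ (n + d) := fun u => by
    have h1 : Fintype.card {w // r w = u} = Fintype.card {v // Tree.res hl v = Tree.res hn' u} :=
      Fintype.card_congr ⟨fun w => ⟨Tree.res hL w.1, by rw [hcompat, w.2]⟩,
        fun v => ⟨paste v.1 u, hr_paste _ _ v.2⟩,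
        fun w => Subtype.ext (by
          have := hpaste w.1
          rwa [w.2] at this), fun v => Subtype.ext (hres_paste _ _)⟩
    have h2 := T.vol_eq_card (T.disj n) (T.node_le_res hl) (Tree.res hn' u)
    rw [T.vol_node'] at h2
    rw [T.vol_eq_card hQdisj hrQ, h1]
    field_simp at h2 ⊢
    rw [pow_add, pow_add, h2]
    ring
  obtain ⟨c, -, hc⟩ := exists_mem_norm (T := T) (n := max (l + d) (n + d)) hQdisj (T.disj (n + d))
    (lab := fun v => r (Tree.res (le_max_left _ _) v)) (lab' := Tree.res (le_max_right _ _))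
    (fun v => (T.node_le_res (le_max_left _ _) v).trans (hrQ _)) (T.node_le_res _)
    (fun u => by rw [hQvol, T.vol_node'])
  have hc' : ∀ u, c⁻¹ • T.node (n + d) u = Q u := fun u => by rw [← hc, inv_smul_smul]
  have hcn : c ∈ stab T n := by
    refine inv_mem_iff.1 fun w => ?_
    refine eq_of_smul_le (g := toAut T c⁻¹) ?_ le_rfl
    rw [T.eq_sup_of_label (T.disj n) (T.node_le_res hn') w, smul_finset_sup]
    refine Finset.sup_le fun u hu => ?_
    have hu' : Tree.res hn' u = w := by simpa using hu
    rw [toAut_smul, hc', ← T.eq_sup_of_label (T.disj n) (T.node_le_res hn') w]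
    refine Finset.sup_le fun w' hw' => ?_
    have hw'' : r w' = u := by simpa using hw'
    rw [← hu', ← hw'', ← hcompat]
    exact (T.node_le_res hL w').trans (T.node_le_res hl _)
  refine ⟨l + d, hL, c, hcn, fun g hg u => ?_, ?_⟩
  · rw [mul_smul, mul_smul, hc', ← hc]
    exact congrArg (c • ·) (fixes_of_mem_stab hg)
  rintro a p ⟨α, hα⟩ ⟨σ, hσ⟩ - ⟨τ, hτ⟩ hpa
  have hpα : ∀ w, p • T.node n w = T.node n (α w) := fun w => by
    have := hpa w
    rw [mul_smul, inv_smul_eq_iff] at this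
    rw [← this, hα]
  have hσα : ∀ v, Tree.res hl (σ v) = α (Tree.res hl v) := fun v => T.res_eq_of_le hl (by
    rw [← hσ, ← hα]
    exact smul_le_smul (g := toAut T a) (T.node_le_res hl v))
  have hτα : ∀ u, Tree.res hn' (τ u) = α (Tree.res hn' u) := fun u => T.res_eq_of_le hn' (by
    rw [← hτ, ← hpα]
    exact smul_le_smul (g := toAut T p) (T.node_le_res hn' u))
  -- the common refinement of level `l` and the copy, on which `(σ, τ)` acts
  let P : (Fin l → Bool) × (Fin (n + d) → Bool) → B := fun x => T.node l x.1 ⊓ Q x.2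
  have hPdisj : Pairwise (Function.onFun Disjoint P) := by
    rintro ⟨v, u⟩ ⟨v', u'⟩ hne
    by_cases hv : v = v'
    · exact (hQdisj fun h => hne (Prod.ext hv h)).mono inf_le_right inf_le_right
    · exact (T.disj l hv).mono inf_le_left inf_le_left
  have hPlab : ∀ w, T.node (l + d) w ≤ P (Tree.res hL w, r w) := fun w =>
    le_inf (T.node_le_res hL w) (hrQ w)
  have hPvol : ∀ v u, vol (P (v, u)) = vol (P (σ v, τ u)) := fun v u => by
    have key : ∀ v u, Fintype.card {w // (Tree.res hL w, r w) = (v, u)} =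
        if Tree.res hl v = Tree.res hn' u then 1 else 0 := fun v u => by
      split_ifs with h
      · rw [Fintype.card_eq_one_iff]
        refine ⟨⟨paste v u, by rw [hres_paste, hr_paste _ _ h]⟩, fun w => Subtype.ext ?_⟩
        have h1 : Tree.res hL w.1 = v := congrArg Prod.fst w.2
        have h2 : r w.1 = u := congrArg Prod.snd w.2
        rw [← hpaste w.1, h1, h2]
      · rw [Fintype.card_eq_zero_iff]
        refine ⟨fun w => h ?_⟩
        have h1 : Tree.res hL w.1 = v := congrArg Prod.fst w.2
        have h2 : r w.1 = u := congrArg Prod.snd w.2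
        exact (congrArg (Tree.res hl) h1).symm.trans ((hcompat w.1).trans (congrArg (Tree.res hn') h2))
    rw [T.vol_eq_card hPdisj hPlab, T.vol_eq_card hPdisj hPlab, key, key, hσα, hτα]
    simp only [EmbeddingLike.apply_eq_iff_eq]
  obtain ⟨e, he, heP⟩ := exists_mem_norm (T := T) (n := l + d) hPdisj
    (Q := fun x => P (σ x.1, τ x.2)) (lab' := fun w => (σ.symm (Tree.res hL w), τ.symm (r w)))
    (fun x y hxy => hPdisj fun h => hxy (by
      have h1 := σ.injective (congrArg Prod.fst h)
      have h2 := τ.injective (congrArg Prod.snd h)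
      exact Prod.ext h1 h2)) hPlab (fun w => by simpa using hPlab w) (fun x => hPvol x.1 x.2)
  have hew : ∀ w, e • T.node (l + d) w ≤ P (σ (Tree.res hL w), τ (r w)) := fun w => by
    rw [← heP (Tree.res hL w, r w)]
    exact smul_le_smul (g := toAut T e) (hPlab w)
  have hel : ∀ v, e • T.node l v = T.node l (σ v) := fun v => by
    refine eq_of_smul_le (g := toAut T e) ?_ (by rw [T.vol_node', T.vol_node'])
    rw [T.eq_sup_of_label (T.disj l) (T.node_le_res hL) v, smul_finset_sup]
    refine Finset.sup_le fun w hw => ?_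
    have hw' : Tree.res hL w = v := by simpa using hw
    rw [← hw']
    exact (hew w).trans inf_le_left
  have heQ : ∀ u, e • Q u = Q (τ u) := fun u => by
    refine eq_of_smul_le (g := toAut T e) ?_ (by rw [hQvol, hQvol])
    rw [smul_finset_sup]
    refine Finset.sup_le fun w hw => ?_
    have hw' : r w = u := by simpa using hw
    rw [← hw']
    exact (hew w).trans inf_le_right
  refine ⟨e, ⟨σ, hel⟩, he, fun v => ?_, fun u => ?_⟩
  · rw [mul_smul, hel, ← hσ, inv_smul_smul]
  · rw [mul_smul, mul_smul, mul_smul, hc', heQ, hc, ← hτ, inv_smul_smul]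

/-- The groups `stab` and `norm` form a level system. -/
def levelSystem (T : Tree (⊤ : B)) : LevelSystem (TreeAut T) where
  stab := stab T
  norm := norm T
  anti := stab_anti
  isOpen_stab n := by
    have : (stab T n : Set (TreeAut T)) = ⋂ w, {g | g • T.node n w = T.node n w} := by
      ext g
      simp only [Set.mem_iInter]
      rfl
    rw [this]
    exact isOpen_iInter_of_finite fun w => isOpen_smul_eq (T.node_mem_alg w)
  basis := stab_basis
  stab_le_norm n g hg := ⟨1, hg⟩
  conj_mem := stab_conj
  approx := exists_norm_near
  amalg := exists_amalgam

end TreeAut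

end ProbAlg

namespace ProbAlg

variable {B : Type*} [BooleanAlgebra B] [MetricSpace B] [ProbAlg B]

/-! ### Approximation by automorphisms preserving the dyadic algebra -/

omit [MetricSpace B] [ProbAlg B] in
theorem eq_finset_sup_inf {κ : Type*} [Fintype κ] {Q : κ → B} (hQ : Finset.univ.sup Q = ⊤) (x : B) :
    x = Finset.univ.sup fun u => x ⊓ Q u := by
  rw [← Finset.sup_inf_distrib_left, hQ, inf_top_eq]

theorem SuppIn.dist_smul_le {g : Aut B} {b : B} (hg : SuppIn g b) (x : B) :
    dist (g • x) x ≤ 2 * vol b := by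
  have h1 : g • (x \ b) = x \ b := hg _ disjoint_sdiff_self_left
  have h2 := dist_sup_le (g • (x ⊓ b)) (g • (x \ b)) (x ⊓ b) (x \ b)
  rw [← smul_sup, sup_inf_sdiff, h1, dist_self, add_zero] at h2
  have h3 := dist_triangle_right (g • (x ⊓ b)) (x ⊓ b) ⊥
  have h4 : dist (g • (x ⊓ b)) ⊥ = vol (x ⊓ b) := vol_smul g _
  have h5 : dist (x ⊓ b) ⊥ = vol (x ⊓ b) := rfl
  have h6 := vol_mono (inf_le_right : x ⊓ b ≤ b)
  linarith

omit [MetricSpace B] [ProbAlg B] in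
theorem pairwise_option {κ : Type*} {f : κ → B} {b : B} (hf : Pairwise (Function.onFun Disjoint f))
    (hb : ∀ i, Disjoint b (f i)) :
    Pairwise (Function.onFun Disjoint fun i : Option κ => i.elim b f) := by
  rintro (_ | i) (_ | j) hij
  exacts [(hij rfl).elim, hb j, (hb i).symm, hf fun h => hij (congrArg some h)]

/-- An automorphism which almost maps a finite partition to another one can be corrected on a small
set so as to do so exactly. -/
theorem exists_correction {κ : Type} [Fintype κ] {Q C : κ → B}
    (hQ : Pairwise (Function.onFun Disjoint Q)) (hC : Pairwise (Function.onFun Disjoint C))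
    (hQ1 : Finset.univ.sup Q = ⊤) (hv : ∀ u, vol (C u) = vol (Q u)) (θ : Aut B) :
    ∃ θ' : Aut B, (∀ u, θ' • Q u = C u) ∧
      ∃ b : B, vol b ≤ ∑ u, dist (C u) (θ • Q u) ∧ ∀ x, Disjoint x b → θ' • x = θ • x := by
  have hC1 : Finset.univ.sup C = ⊤ := by
    refine eq_of_le_of_vol_le le_top ?_
    rw [← hQ1, vol_finset_sup _ _ fun i _ j _ h => hQ h, vol_finset_sup _ _ fun i _ j _ h => hC h]
    exact (Finset.sum_congr rfl fun u _ => hv u).ge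
  let b : κ × Bool → B := fun i => cond i.2 (Q i.1 ⊓ θ⁻¹ • C i.1) (Q i.1 \ θ⁻¹ • C i.1)
  let c : κ × Bool → B := fun i => cond i.2 (C i.1 ⊓ θ • Q i.1) (C i.1 \ θ • Q i.1)
  have hQb : ∀ u, b (u, true) ⊔ b (u, false) = Q u := fun u => sup_inf_sdiff _ _
  have hCc : ∀ u, c (u, true) ⊔ c (u, false) = C u := fun u => sup_inf_sdiff _ _
  have hb : Pairwise (Function.onFun Disjoint b) := by
    rintro ⟨u, i⟩ ⟨w, j⟩ hij
    by_cases huw : u = w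
    · subst huw
      exact pairwise_bool (f := fun i => b (u, i)) disjoint_inf_sdiff fun h => hij (by rw [h])
    · refine (hQ huw).mono ?_ ?_
      · cases i
        exacts [sdiff_le, inf_le_left]
      · cases j
        exacts [sdiff_le, inf_le_left]
  have hc : Pairwise (Function.onFun Disjoint c) := by
    rintro ⟨u, i⟩ ⟨w, j⟩ hij
    by_cases huw : u = w
    · subst huw
      exact pairwise_bool (f := fun i => c (u, i)) disjoint_inf_sdiff fun h => hij (by rw [h])
    · refine (hC huw).mono ?_ ?_
      · cases i
        exacts [sdiff_le, inf_le_left]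
      · cases j
        exacts [sdiff_le, inf_le_left]
  have hb1 : join b = ⊤ := top_le_iff.1 (hQ1 ▸ Finset.sup_le fun u _ =>
    hQb u ▸ sup_le (le_join b (u, true)) (le_join b (u, false)))
  have hc1 : join c = ⊤ := top_le_iff.1 (hC1 ▸ Finset.sup_le fun u _ =>
    hCc u ▸ sup_le (le_join c (u, true)) (le_join c (u, false)))
  have hθ : ∀ u, θ • b (u, true) = c (u, true) := fun u => by
    change θ • (Q u ⊓ θ⁻¹ • C u) = C u ⊓ θ • Q u
    rw [smul_inf, smul_inv_smul, inf_comm]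
  have hvol : ∀ u, vol (b (u, false)) = vol (c (u, false)) := fun u => by
    have h1 := vol_sup (b (u, true)) (b (u, false)) disjoint_inf_sdiff
    have h2 := vol_sup (c (u, true)) (c (u, false)) disjoint_inf_sdiff
    rw [hQb] at h1
    rw [hCc, ← hθ, vol_smul] at h2
    linarith [hv u]
  choose f hf using fun u => exists_smul_eq (hvol u)
  obtain ⟨θ', h'⟩ := exists_glue hb hc hb1 hc1 (fun i => cond i.2 θ (f i.1)) (by
    rintro ⟨u, i⟩
    cases i
    exacts [hf u, hθ u])
  refine ⟨θ', fun u => ?_, Finset.univ.sup fun u => b (u, false), ?_, fun x hx => ?_⟩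
  · rw [← hQb, smul_sup, h' (u, true) _ le_rfl, h' (u, false) _ le_rfl, ← hCc]
    exact congrArg₂ _ (hθ u) (hf u)
  · refine (vol_finset_sup_le _ _).trans (Finset.sum_le_sum fun u _ => ?_)
    rw [hvol, dist_eq_add]
    exact le_add_of_nonneg_right (vol_nonneg _)
  · rw [eq_finset_sup_inf hQ1 x, smul_finset_sup, smul_finset_sup]
    refine Finset.sup_congr rfl fun u _ => h' (u, true) _ ?_
    have h1 : Disjoint x (b (u, false)) := hx.mono_right (Finset.le_sup (f := fun u => b (u, false))
      (Finset.mem_univ u))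
    rw [← hQb, inf_sup_left, h1.eq_bot, sup_bot_eq]
    exact inf_le_right

namespace Tree

variable {T : Tree (⊤ : B)}

omit [ProbAlg B] in
theorem sup_mem_alg {a b : B} (ha : a ∈ T.alg) (hb : b ∈ T.alg) : a ⊔ b ∈ T.alg := by
  classical
  obtain ⟨N, hN⟩ := T.exists_level ha
  obtain ⟨M, hM⟩ := T.exists_level hb
  obtain ⟨S, rfl⟩ := hN (max N M) (le_max_left _ _)
  obtain ⟨R, rfl⟩ := hM (max N M) (le_max_right _ _)
  exact ⟨_, S ∪ R, Finset.sup_union⟩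

omit [ProbAlg B] in
theorem finset_sup_mem_alg {κ : Type*} {s : Finset κ} {f : κ → B} (h : ∀ i ∈ s, f i ∈ T.alg) :
    s.sup f ∈ T.alg :=
  Finset.sup_mem T.alg ⟨0, ∅, Finset.sup_empty⟩ (fun _ ha _ hb => sup_mem_alg ha hb) s f h

omit [ProbAlg B] in
theorem sdiff_mem_alg {a b : B} (ha : a ∈ T.alg) (hb : b ∈ T.alg) : a \ b ∈ T.alg := by
  classical
  obtain ⟨N, hN⟩ := T.exists_level ha
  obtain ⟨M, hM⟩ := T.exists_level hb
  obtain ⟨S, rfl⟩ := hN (max N M) (le_max_left _ _)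
  obtain ⟨R, rfl⟩ := hM (max N M) (le_max_right _ _)
  exact ⟨_, S \ R, (finset_sup_sdiff (T.disj _) S R).symm⟩

omit [ProbAlg B] in
theorem smul_mem_alg {n : ℕ} {g : Aut B} (h : ∀ w : Fin n → Bool, g • T.node n w ∈ T.alg)
    (S : Finset (Fin n → Bool)) : g • S.sup (T.node n) ∈ T.alg := by
  rw [smul_finset_sup]
  exact finset_sup_mem_alg fun w _ => h w

omit [ProbAlg B] in
theorem smul_mem_alg_of_le {n m : ℕ} (hnm : n ≤ m) {g : Aut B}
    (h : ∀ w : Fin m → Bool, g • T.node m w ∈ T.alg) (w : Fin n → Bool) :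
    g • T.node n w ∈ T.alg := by
  obtain ⟨S, hS⟩ := T.exists_sup_eq hnm {w}
  rw [Finset.sup_singleton] at hS
  rw [← hS]
  exact smul_mem_alg h S

theorem vol_sup_node {n : ℕ} (S : Finset (Fin n → Bool)) :
    vol (S.sup (T.node n)) = S.card * (1 / 2 ^ n) := by
  rw [vol_finset_sup _ _ fun i _ j _ h => T.disj n h]
  simp only [T.vol_node', Finset.sum_const, nsmul_eq_mul]

/-- An element of dyadic measure below a member of the dyadic algebra is approximated by members of
the dyadic algebra of the same measure. -/
theorem exists_rounding {F c : B} (hF : F ∈ T.alg) (hcF : c ≤ F) {n : ℕ} (hc : vol c = 1 / 2 ^ n)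
    {ε : ℝ} (hε : 0 < ε) : ∃ C ∈ T.alg, C ≤ F ∧ vol C = vol c ∧ dist C c < ε := by
  classical
  obtain ⟨N, S₀, hS₀⟩ := T.dense c le_top (ε / 2) (half_pos hε)
  obtain ⟨N', hN'⟩ := T.exists_level hF
  set M := max (max N N') n with hM
  obtain ⟨S, hS⟩ := T.exists_sup_eq (m := M) ((le_max_left _ _).trans (le_max_left _ _)) S₀
  obtain ⟨R, hR⟩ := hN' M ((le_max_right _ _).trans (le_max_left _ _))
  have hnM : n ≤ M := le_max_right _ _
  have hd : dist ((R ∩ S).sup (T.node M)) c < ε / 2 := by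
    rw [← finset_sup_inf (T.disj M), hR, hS]
    have h1 := dist_inf_le F (S₀.sup (T.node N)) F c
    rw [inf_eq_right.2 hcF] at h1
    refine h1.trans_lt ?_
    rw [dist_self, zero_add, dist_comm]
    exact hS₀
  have hpow : (1 / 2 ^ n : ℝ) = (2 ^ (M - n) : ℕ) * (1 / 2 ^ M) := by
    have : (2 : ℝ) ^ M = 2 ^ (M - n) * 2 ^ n := by rw [← pow_add, Nat.sub_add_cancel hnM]
    rw [this]
    push_cast
    field_simp
  have hpos : (0 : ℝ) < 1 / 2 ^ M := by positivity
  -- it suffices to find a set of nodes of the right cardinality containing, or contained in, `R ∩ S`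
  have key : ∀ R' ⊆ R, R'.card = 2 ^ (M - n) → (R' ⊆ R ∩ S ∨ R ∩ S ⊆ R') →
      ∃ C ∈ T.alg, C ≤ F ∧ vol C = vol c ∧ dist C c < ε := by
    intro R' hR' hcard hsub
    have hv : vol (R'.sup (T.node M)) = vol c := by rw [vol_sup_node, hc, hpow, hcard]
    refine ⟨R'.sup (T.node M), ⟨M, R', rfl⟩, hR ▸ Finset.sup_mono hR', hv, ?_⟩
    have h1 : dist (R'.sup (T.node M)) ((R ∩ S).sup (T.node M)) ≤
        dist ((R ∩ S).sup (T.node M)) c := by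
      have h2 := vol_le_add_dist ((R ∩ S).sup (T.node M)) c
      have h3 := vol_le_add_dist c ((R ∩ S).sup (T.node M))
      rw [dist_comm c] at h3
      rcases hsub with h | h
      · have h4 : R'.sup (T.node M) ≤ (R ∩ S).sup (T.node M) := Finset.sup_mono h
        rw [dist_eq_add, sdiff_eq_bot_iff.2 h4, vol_bot, vol_sdiff h4]
        linarith
      · have h4 : (R ∩ S).sup (T.node M) ≤ R'.sup (T.node M) := Finset.sup_mono h
        rw [dist_eq_add, sdiff_eq_bot_iff.2 h4, vol_bot, vol_sdiff h4]
        linarith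
    linarith [dist_triangle (R'.sup (T.node M)) ((R ∩ S).sup (T.node M)) c]
  rcases le_total (2 ^ (M - n)) (R ∩ S).card with h | h
  · obtain ⟨R', h1, h2⟩ := Finset.exists_subset_card_eq h
    exact key R' (h1.trans Finset.inter_subset_left) h2 (Or.inl h1)
  · have hRc : 2 ^ (M - n) ≤ R.card := by
      have h1 := vol_mono hcF
      rw [hc, hpow, ← hR, vol_sup_node] at h1
      exact_mod_cast le_of_mul_le_mul_right h1 hpos
    obtain ⟨R', h1, h2, h3⟩ := Finset.exists_subsuperset_card_eq Finset.inter_subset_left h hRc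
    exact key R' h2 h3 (Or.inr h1)

/-- A partition of a member of the dyadic algebra into elements of dyadic measure is approximated by
partitions inside the dyadic algebra. -/
theorem exists_rounding_partition {κ : Type*} (s : Finset κ) {n : ℕ} :
    ∀ {F : B} {E : κ → B}, F ∈ T.alg → (∀ i ∈ s, ∀ j ∈ s, i ≠ j → Disjoint (E i) (E j)) →
      s.sup E = F → (∀ i ∈ s, vol (E i) = 1 / 2 ^ n) → ∀ ε > 0, ∃ C : κ → B,
        (∀ i ∈ s, C i ∈ T.alg) ∧ (∀ i ∈ s, ∀ j ∈ s, i ≠ j → Disjoint (C i) (C j)) ∧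
        (∀ i ∈ s, C i ≤ F) ∧ (∀ i ∈ s, vol (C i) = 1 / 2 ^ n) ∧
        ∀ i ∈ s, dist (C i) (E i) < ε := by
  classical
  induction s using Finset.induction_on with
  | empty => intro F E _ _ _ _ ε _; exact ⟨E, by simp⟩
  | insert u s hu ih =>
    intro F E hF hE hEF hv ε hε
    have huF : E u ≤ F := hEF ▸ Finset.le_sup (Finset.mem_insert_self u s)
    have hvu := hv u (Finset.mem_insert_self u s)
    obtain ⟨c, hc, hcF, hcv, hcd⟩ := exists_rounding hF huF hvu (ε := ε / 8) (by positivity)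
    have hsF : s.sup E = F \ E u := by
      have h1 : Disjoint (E u) (s.sup E) := Finset.disjoint_sup_right.2 fun i hi =>
        hE u (Finset.mem_insert_self u s) i (Finset.mem_insert_of_mem hi) fun h => hu (h ▸ hi)
      rw [← hEF, Finset.sup_insert, sup_sdiff_left_self, h1.symm.sdiff_eq_left]
    -- move the other members of the partition out of the way of `c`
    obtain ⟨ψ, hψ, b, hb, hψb⟩ := exists_correction (κ := Option Bool)
      (Q := fun i => i.elim Fᶜ fun j => cond j (E u) (F \ E u))
      (C := fun i => i.elim Fᶜ fun j => cond j c (F \ c))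
      (pairwise_option (pairwise_bool disjoint_sdiff_self_right)
        (Bool.forall_bool.2 ⟨disjoint_compl_left.mono_right sdiff_le, disjoint_compl_left.mono_right huF⟩))
      (pairwise_option (pairwise_bool disjoint_sdiff_self_right)
        (Bool.forall_bool.2 ⟨disjoint_compl_left.mono_right sdiff_le, disjoint_compl_left.mono_right hcF⟩))
      (by
        refine top_le_iff.1 ?_
        have hle := fun i => Finset.le_sup (f := fun i : Option Bool => i.elim Fᶜ fun j => cond j (E u) (F \ E u))
          (Finset.mem_univ i)
        rw [← sup_compl_eq_top (x := F)]
        exact sup_le ((sup_sdiff_cancel_right huF).ge.trans (sup_le (hle (some true)) (hle (some false))))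
          (hle none))
      (by
        rintro (_ | _ | _)
        · rfl
        · change vol (F \ c) = vol (F \ E u)
          rw [vol_sdiff hcF, vol_sdiff huF, hcv]
        · exact hcv) 1
    have hψu : ψ • (F \ E u) = F \ c := hψ (some false)
    have hbε : vol b ≤ ε / 4 := by
      refine hb.trans ?_
      have h1 : dist (F \ c) (F \ E u) ≤ ε / 8 := by
        rw [sdiff_eq, sdiff_eq]
        refine (dist_inf_le _ _ _ _).trans ?_
        rw [dist_self, zero_add, dist_compl]
        exact hcd.le
      rw [Fintype.sum_option, Fintype.sum_bool]
      simp only [one_smul, Option.elim_none, Option.elim_some, cond_true, cond_false, dist_self]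
      linarith
    have hψd : ∀ x, dist (ψ • x) x ≤ ε / 2 := fun x => by
      have hψb' : SuppIn ψ b := fun x hx => (hψb x hx).trans (one_smul _ _)
      refine (hψb'.dist_smul_le x).trans ?_
      clear hv hvu
      linarith
    obtain ⟨C, h1, h2, h3, h4, h5⟩ := ih (F := F \ c) (E := fun i => ψ • E i) (sdiff_mem_alg hF hc)
      (fun i hi j hj hij => disjoint_smul.2 (hE i (Finset.mem_insert_of_mem hi) j
        (Finset.mem_insert_of_mem hj) hij)) (by rw [← smul_finset_sup, hsF, hψu])
      (fun i hi => by rw [vol_smul, hv i (Finset.mem_insert_of_mem hi)]) (ε / 2) (half_pos hε)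
    have hne : ∀ i ∈ s, i ≠ u := fun i hi h => hu (h ▸ hi)
    have hcC : ∀ i ∈ s, Disjoint c (C i) := fun i hi => disjoint_sdiff_self_right.mono_right (h3 i hi)
    refine ⟨Function.update C u c, ?_, ?_, ?_, ?_, ?_⟩
    · refine Finset.forall_mem_insert _ _ _ |>.2 ⟨by simpa using hc, fun i hi => ?_⟩
      rw [Function.update_of_ne (hne i hi)]
      exact h1 i hi
    · refine Finset.forall_mem_insert _ _ _ |>.2 ⟨Finset.forall_mem_insert _ _ _ |>.2
        ⟨fun h => (h rfl).elim, fun j hj _ => ?_⟩, fun i hi => Finset.forall_mem_insert _ _ _ |>.2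
        ⟨fun _ => ?_, fun j hj hij => ?_⟩⟩
      · rw [Function.update_self, Function.update_of_ne (hne j hj)]
        exact hcC j hj
      · rw [Function.update_self, Function.update_of_ne (hne i hi)]
        exact (hcC i hi).symm
      · rw [Function.update_of_ne (hne i hi), Function.update_of_ne (hne j hj)]
        exact h2 i hi j hj hij
    · refine Finset.forall_mem_insert _ _ _ |>.2 ⟨by simpa using hcF, fun i hi => ?_⟩
      rw [Function.update_of_ne (hne i hi)]
      exact (h3 i hi).trans sdiff_le
    · refine Finset.forall_mem_insert _ _ _ |>.2 ⟨by simpa [hvu] using hcv, fun i hi => ?_⟩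
      rw [Function.update_of_ne (hne i hi)]
      exact h4 i hi
    · refine Finset.forall_mem_insert _ _ _ |>.2 ⟨?_, fun i hi => ?_⟩
      · rw [Function.update_self]
        linarith
      · rw [Function.update_of_ne (hne i hi)]
        linarith [h5 i hi, hψd (E i), dist_triangle (C i) (ψ • E i) (E i)]

/-- One half of the back-and-forth: if the inverse of `θ` maps the nodes of level `m` into the
dyadic algebra then a correction of `θ` on a small set, whose inverse has the same values at these
nodes, maps the nodes of level `m'` into the dyadic algebra. -/
theorem exists_forth {θ : Aut B} {m : ℕ} (hθ : ∀ w : Fin m → Bool, θ⁻¹ • T.node m w ∈ T.alg)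
    (m' : ℕ) {ε : ℝ} (hε : 0 < ε) : ∃ θ' : Aut B, (∀ w, θ'⁻¹ • T.node m w = θ⁻¹ • T.node m w) ∧
      (∀ w : Fin m' → Bool, θ' • T.node m' w ∈ T.alg) ∧
      ∃ b : B, vol b ≤ ε ∧ ∀ x, Disjoint x b → θ' • x = θ • x := by
  classical
  choose N hN using fun w => T.exists_level (hθ w)
  set n := max m' (Finset.univ.sup N) with hn
  choose lab hlab using T.exists_label (n := n) (Q := fun w : Fin m → Bool => θ⁻¹ • T.node m w)
    (by rw [← smul_finset_sup, T.sup_node, smul_top])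
    (fun w => hN w n ((Finset.le_sup (Finset.mem_univ w)).trans (le_max_right _ _)))
  have hθlab : ∀ u, θ • T.node n u ≤ T.node m (lab u) := fun u => smul_le_iff.2 (hlab u)
  have hPdisj : Pairwise (Function.onFun Disjoint fun w : Fin m → Bool => θ⁻¹ • T.node m w) :=
    fun w w' h => disjoint_smul.2 (T.disj m h)
  choose C h1 h2 h3 h4 h5 using fun w : Fin m → Bool => exists_rounding_partition (T := T)
    ({u | lab u = w} : Finset (Fin n → Bool)) (n := n) (F := T.node m w)
    (E := fun u => θ • T.node n u) (T.node_mem_alg w)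
    (fun i _ j _ hij => disjoint_smul.2 (T.disj n hij))
    (by
      rw [← smul_finset_sup, ← T.eq_sup_of_label hPdisj hlab w]
      exact smul_inv_smul _ _)
    (fun i _ => by rw [vol_smul, T.vol_node']) (ε / 2 ^ n) (by positivity)
  have hmem : ∀ u, u ∈ ({u' | lab u' = lab u} : Finset (Fin n → Bool)) := fun u => by simp
  obtain ⟨θ', hθ', b, hb, hb'⟩ := exists_correction (Q := T.node n) (C := fun u => C (lab u) u)
    (T.disj n) (fun u u' huu => by
      by_cases h : lab u = lab u'
      · have := h2 (lab u) u (hmem u) u' (by simp [h]) huu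
        rwa [Function.onFun, ← h]
      · exact (T.disj m h).mono (h3 _ u (hmem u)) (h3 _ u' (hmem u')))
    (T.sup_node n) (fun u => by rw [h4 _ u (hmem u), T.vol_node']) θ
  refine ⟨θ', fun w => ?_, fun w => ?_, b, ?_, hb'⟩
  · rw [inv_smul_eq_iff]
    refine (eq_of_smul_le (g := θ') ?_ (by rw [vol_smul])).symm
    conv_lhs => rw [T.eq_sup_of_label hPdisj hlab w, smul_finset_sup]
    refine Finset.sup_le fun u hu => ?_
    have hu' : lab u = w := by simpa using hu
    rw [hθ', ← hu']
    exact h3 _ u (hmem u)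
  · refine smul_mem_alg_of_le (le_max_left m' (Finset.univ.sup N)) (fun u => ?_) w
    rw [hθ' u]
    exact h1 _ u (hmem u)
  · refine hb.trans ((Finset.sum_le_sum fun u _ => (h5 (lab u) u (hmem u)).le).trans ?_)
    rw [Finset.sum_const, Finset.card_univ, Fintype.card_fun, Fintype.card_bool, Fintype.card_fin,
      nsmul_eq_mul]
    push_cast
    rw [mul_div_cancel₀ _ (by positivity)]

/-- One step of the back-and-forth: `θ` maps the nodes of level `N` into the dyadic algebra; it is
corrected on a small set, keeping these values, so that the nodes of level `j` have inverse images
in the dyadic algebra, and the nodes of a level `N'` resolving these have images there. -/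
theorem exists_back_forth {θ : Aut B} {N : ℕ} (hθ : ∀ w : Fin N → Bool, θ • T.node N w ∈ T.alg)
    (j : ℕ) {ε : ℝ} (hε : 0 < ε) : ∃ θ' : Aut B, ∃ N' ≥ j, (∀ w, θ' • T.node N w = θ • T.node N w) ∧
      (∀ w : Fin N' → Bool, θ' • T.node N' w ∈ T.alg) ∧
      (∀ w : Fin j → Bool, ∃ S : Finset (Fin N' → Bool), S.sup (T.node N') = θ'⁻¹ • T.node j w) ∧
      ∃ b : B, vol b ≤ ε ∧ ∀ x, Disjoint x b → θ' • x = θ • x := by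
  choose n hn using fun w => T.exists_level (hθ w)
  set m := max j (Finset.univ.sup n)
  obtain ⟨θ₁, h1, h2, b₁, hb₁, h3⟩ := exists_forth (T := T) (θ := θ⁻¹) (m := N)
    (by rwa [inv_inv]) m (half_pos hε)
  rw [inv_inv] at h1
  choose n' hn' using fun w => T.exists_level (h2 w)
  obtain ⟨θ₂, h4, h5, b₂, hb₂, h6⟩ := exists_forth (T := T) (θ := θ₁⁻¹) (m := m)
    (by rwa [inv_inv]) (max j (Finset.univ.sup n')) (half_pos hε)
  rw [inv_inv] at h4
  have hS : ∀ S : Finset (Fin m → Bool), θ₂⁻¹ • S.sup (T.node m) = θ₁ • S.sup (T.node m) := fun S => by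
    rw [smul_finset_sup, smul_finset_sup]
    exact Finset.sup_congr rfl fun w _ => h4 w
  refine ⟨θ₂, _, le_max_left j (Finset.univ.sup n'), fun w => ?_, h5, fun w => ?_,
    θ⁻¹ • b₁ ⊔ b₂, ?_, fun x hx => ?_⟩
  · obtain ⟨S, hS'⟩ := hn w m ((Finset.le_sup (Finset.mem_univ w)).trans (le_max_right _ _))
    rw [← h1 w, smul_eq_iff_eq_inv_smul, h1 w, ← hS', hS, hS', ← h1 w, smul_inv_smul]
  · obtain ⟨S, hS'⟩ := T.exists_sup_eq (le_max_left j (Finset.univ.sup n)) {w}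
    rw [Finset.sup_singleton] at hS'
    choose R hR using fun v => hn' v (max j (Finset.univ.sup n'))
      ((Finset.le_sup (Finset.mem_univ v)).trans (le_max_right _ _))
    classical
    refine ⟨S.biUnion R, ?_⟩
    rw [Finset.sup_biUnion, ← hS', hS, smul_finset_sup]
    exact Finset.sup_congr rfl fun v _ => hR v
  · have := vol_sup_le (θ⁻¹ • b₁) b₂
    rw [vol_smul] at this
    linarith
  · rw [disjoint_sup_right] at hx
    rw [h6 x hx.2, inv_smul_eq_iff, h3 _ ?_, inv_smul_smul]
    have := disjoint_smul (g := θ).2 hx.1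
    rwa [smul_inv_smul] at this

/-- Every automorphism almost fixing the nodes of level `n` agrees, off a small set, with one
preserving the dyadic algebra and fixing these nodes. -/
theorem exists_stab_suppIn (T : Tree (⊤ : B)) (n : ℕ) {ε : ℝ} (hε : 0 < ε) {g : Aut B}
    (hg : ∑ w, dist (T.node n w) (g • T.node n w) < ε) :
    ∃ h ∈ TreeAut.stab T n, ∃ b : B, vol b < 2 * ε ∧ SuppIn ((TreeAut.toAut T h)⁻¹ * g) b := by
  obtain ⟨θ₀, hθ₀, b₀, hb₀, hgb⟩ := exists_correction (T.disj n) (T.disj n) (T.sup_node n)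
    (fun _ => rfl) g
  obtain ⟨s, hs0, hsP, hsR⟩ := exists_seq_of_step (α := Aut B × ℕ)
    (fun _ s => ∀ w : Fin s.2 → Bool, s.1 • T.node s.2 w ∈ T.alg)
    (fun j s s' => max j s.2 ≤ s'.2 ∧ (∀ w, s'.1 • T.node s.2 w = s.1 • T.node s.2 w) ∧
      (∀ w : Fin (max j s.2) → Bool, ∃ S : Finset (Fin s'.2 → Bool),
        S.sup (T.node s'.2) = s'.1⁻¹ • T.node _ w) ∧
      ∃ b : B, vol b ≤ ε / 2 / 2 ^ j ∧ ∀ x, Disjoint x b → s'.1 • x = s.1 • x) (θ₀, n)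
    (fun w => by rw [hθ₀]; exact T.node_mem_alg w) (by
      rintro j ⟨θ, N⟩ hθ
      obtain ⟨θ', N', hN', h1, h2, h3, h4⟩ := exists_back_forth hθ (max j N)
        (ε := ε / 2 / 2 ^ j) (by positivity)
      exact ⟨(θ', N'), h2, hN', h1, h3, h4⟩)
  choose hlev hagree hback b hb hsb using hsR
  have hmono : Monotone fun j => (s j).2 := monotone_nat_of_le_succ fun j =>
    (le_max_right _ _).trans (hlev j)
  -- the values at the nodes of level `(s j).2` do not change after stage `j`
  have hstable : ∀ j i, j ≤ i → ∀ S : Finset (Fin (s j).2 → Bool),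
      (s i).1 • S.sup (T.node _) = (s j).1 • S.sup (T.node _) := by
    intro j i hij S
    induction i, hij using Nat.le_induction with
    | base => rfl
    | succ i hij ih =>
      obtain ⟨R, hR⟩ := T.exists_sup_eq (hmono hij) S
      rw [← ih, ← hR, smul_finset_sup, smul_finset_sup]
      exact Finset.sup_congr rfl fun w _ => hagree i w
  obtain ⟨h, hlim, hev⟩ := TreeAut.exists_tendsto (T := T) (f := fun j => (s j).1)
    (fun a ha => by
      obtain ⟨K, hK⟩ := T.exists_level ha
      obtain ⟨S, rfl⟩ := hK (s (K + 1)).2 ((le_max_left _ _).trans (hlev K))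
      exact ⟨K + 1, smul_mem_alg (hsP _) S, fun i hi => hstable _ _ hi S⟩)
    (fun a ha => by
      classical
      obtain ⟨K, hK⟩ := T.exists_level ha
      obtain ⟨S, hS⟩ := hK (max K (s K).2) (le_max_left _ _)
      choose R hR using hback K
      have hp : (S.biUnion R).sup (T.node _) = (s (K + 1)).1⁻¹ • a := by
        rw [Finset.sup_biUnion, ← hS, smul_finset_sup]
        exact Finset.sup_congr rfl fun v _ => hR v
      refine ⟨K + 1, ⟨_, _, hp⟩, fun i hi => ?_⟩
      rw [inv_smul_eq_iff, ← hp, hstable _ _ hi, hp, smul_inv_smul])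
  refine ⟨h, fun w => ?_, b₀ ⊔ join b, ?_, fun x hx => ?_⟩
  · obtain ⟨i, hi⟩ := (hev _ (T.node_mem_alg w)).exists
    have h1 := hstable 0 i (Nat.zero_le i)
    rw [hs0] at h1
    have h2 := h1 {w}
    rw [Finset.sup_singleton] at h2
    rw [← hi]
    exact h2.trans (hθ₀ w)
  · have h1 : vol (join b) ≤ ε := by
      have h2 : Summable fun j => vol (b j) := Summable.of_nonneg_of_le (fun j => vol_nonneg _) hb
        (summable_geometric_two' ε)
      exact (vol_join_le h2.hasSum).trans (hasSum_le hb h2.hasSum (hasSum_geometric_two' ε))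
    linarith [vol_sup_le b₀ (join b)]
  · rw [disjoint_sup_right, disjoint_join_right] at hx
    have h1 : ∀ j, (s j).1 • x = g • x := fun j => by
      induction j with
      | zero => rw [hs0]; exact hgb x hx.1
      | succ j ih => rw [hsb j x (hx.2 j), ih]
    have h2 : TreeAut.toAut T h • x = g • x := by
      refine tendsto_nhds_unique (tendsto_aut_iff.1 hlim x) ?_
      simp only [h1]
      exact tendsto_const_nhds
    rw [mul_smul, ← h2, inv_smul_smul]

end Tree

end ProbAlg

namespace ProbAlg

/-! ### Automatic continuity -/

/-- The preimage of a neighbourhood of the identity under a homomorphism into a separable group has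
countably many translates covering the group. -/
theorem exists_seq_inv_mul_mem {G H : Type*} [Group G] [Group H] [TopologicalSpace H]
    [IsTopologicalGroup H] [SecondCountableTopology H] (π : G →* H) {V : Set H}
    (hV : V ∈ 𝓝 (1 : H)) : ∃ k : ℕ → G, ∀ g, ∃ i, (k i)⁻¹ * g ∈ π ⁻¹' V := by
  have : Nonempty (Set.range π) := ⟨⟨1, 1, map_one π⟩⟩
  choose k hk using fun i => (TopologicalSpace.denseSeq (Set.range π) i).2
  refine ⟨k, fun g => ?_⟩
  have h1 : ∀ᶠ y : Set.range π in 𝓝 ⟨π g, g, rfl⟩, (y : H)⁻¹ * π g ∈ V := by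
    have h2 : Tendsto (fun y : Set.range π => (y : H)⁻¹ * π g) (𝓝 ⟨π g, g, rfl⟩)
        (𝓝 ((π g)⁻¹ * π g)) :=
      (continuous_subtype_val.inv.mul continuous_const).tendsto _
    rw [inv_mul_cancel] at h2
    exact h2 hV
  obtain ⟨i, hi⟩ := (TopologicalSpace.denseRange_denseSeq (Set.range π)).exists_mem_open
    isOpen_interior ⟨_, mem_interior_iff_mem_nhds.2 h1⟩
  refine ⟨i, ?_⟩
  rw [Set.mem_preimage, map_mul, map_inv, hk]
  exact (interior_subset hi :)

theorem exists_nhds_one_pow_subset {H : Type*} [Group H] [TopologicalSpace H] [IsTopologicalGroup H]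
    {U : Set H} (hU : U ∈ 𝓝 (1 : H)) (n : ℕ) :
    ∃ V ∈ 𝓝 (1 : H), (∀ x ∈ V, x⁻¹ ∈ V) ∧ V ^ n ⊆ U := by
  suffices h : ∀ n : ℕ, ∃ V ∈ 𝓝 (1 : H), V ^ n ⊆ U by
    obtain ⟨V, hV, h⟩ := h n
    refine ⟨V ∩ V⁻¹, inter_mem hV (inv_mem_nhds_one H hV), fun x hx => ⟨hx.2, by simpa using hx.1⟩, ?_⟩
    exact (Set.pow_subset_pow_left Set.inter_subset_left).trans h
  intro n
  induction n generalizing U with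
  | zero => exact ⟨Set.univ, univ_mem, by simpa using mem_of_mem_nhds hU⟩
  | succ n ih =>
    obtain ⟨V, hVo, h1, hVU⟩ := exists_open_nhds_one_mul_subset hU
    obtain ⟨V', hV', h'⟩ := ih (hVo.mem_nhds h1)
    refine ⟨V' ∩ V, inter_mem hV' (hVo.mem_nhds h1), ?_⟩
    rw [pow_succ]
    exact (Set.mul_subset_mul ((Set.pow_subset_pow_left Set.inter_subset_left).trans h')
      Set.inter_subset_right).trans hVU

theorem map_pow_preimage_subset {G H : Type*} [Group G] [Group H] (π : G →* H) (V : Set H) (n : ℕ) {g : G}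
    (hg : g ∈ (π ⁻¹' V) ^ n) : π g ∈ V ^ n := by
  have := Set.mem_image_of_mem π hg
  rw [Set.image_pow] at this
  exact Set.pow_subset_pow_left (Set.image_preimage_subset _ _) this

variable {B : Type*} [BooleanAlgebra B] [MetricSpace B] [ProbAlg B]

/-- Every homomorphism from the automorphism group into a Polish group is continuous: an automorphism
close to the identity is a product of one stabilizing a level of a dyadic algebra and one of small
support. -/
theorem continuous_hom {H : Type*} [Group H] [TopologicalSpace H] [IsTopologicalGroup H]
    [PolishSpace H] (π : Aut B →* H) : Continuous π := by
  refine continuous_of_continuousAt_one π ?_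
  rw [ContinuousAt, map_one]
  intro U hU
  obtain ⟨V, hV, hVsymm, hVU⟩ := exists_nhds_one_pow_subset hU (8 + 84)
  have hsymm : ∀ w ∈ π ⁻¹' V, w⁻¹ ∈ π ⁻¹' V := fun w hw => by
    rw [Set.mem_preimage, map_inv]; exact hVsymm _ hw
  obtain ⟨k, hk⟩ := exists_seq_inv_mul_mem π hV
  obtain ⟨ε, hε, hsmall⟩ := exists_small_supp_mem hsymm hk
  obtain ⟨T⟩ := nonempty_tree (⊤ : B)
  obtain ⟨k', hk'⟩ := exists_seq_inv_mul_mem (π.comp (TreeAut.toAut T)) hV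
  obtain ⟨n, hn⟩ := (TreeAut.levelSystem T).exists_stab_subset_pow
    (W := (π.comp (TreeAut.toAut T)) ⁻¹' V) (fun w hw => hsymm _ hw) hk'
  have hnear : ∀ᶠ g : Aut B in 𝓝 1, ∑ w, dist (T.node n w) (g • T.node n w) < ε / 2 := by
    have h1 : Continuous fun g : Aut B => ∑ w, dist (T.node n w) (g • T.node n w) :=
      continuous_finsetSum _ fun w _ => continuous_const.dist (continuous_eval _)
    refine (h1.tendsto 1).eventually (gt_mem_nhds ?_)
    simpa using half_pos hε
  change ∀ᶠ g in 𝓝 1, π g ∈ U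
  filter_upwards [hnear] with g hg
  obtain ⟨h, hh, b, hb, hgb⟩ := T.exists_stab_suppIn n (half_pos hε) hg
  rw [mul_div_cancel₀ _ two_ne_zero] at hb
  refine hVU ?_
  rw [pow_add, ← mul_inv_cancel_left (TreeAut.toAut T h) g, map_mul]
  exact Set.mul_mem_mul (map_pow_preimage_subset (π.comp (TreeAut.toAut T)) V 8 (hn hh))
    (map_pow_preimage_subset π V 84 (hsmall _ b hgb hb))

end ProbAlg

/-! ### The measure algebra of an atomless standard probability space -/

namespace MeasAlg

variable {X : Type*} [MeasurableSpace X] (μ : Measure X) [IsProbabilityMeasure μ]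

theorem vol_mk {A : Set X} (hA : MeasurableSet A) : vol (mk A hA : MeasAlg μ) = μ.real A := by
  rw [vol, bot_def, dist_mk, Set.bot_eq_empty.symm, symmDiff_bot]

omit [IsProbabilityMeasure μ] in
theorem mk_le_mk {A C : Set X} (hA : MeasurableSet A) (hC : MeasurableSet C) :
    (mk A hA : MeasAlg μ) ≤ mk C hC ↔ μ (A \ C) = 0 := by
  rw [← sup_eq_right]
  refine (mk_eq_mk (hA.union hC) hC).trans ?_
  rw [symmDiff_of_ge (show C ≤ A ∪ C from Set.subset_union_right), Set.union_sdiff_right]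

omit [IsProbabilityMeasure μ] in
theorem disjoint_mk {A C : Set X} (hA : MeasurableSet A) (hC : MeasurableSet C) :
    Disjoint (mk A hA : MeasAlg μ) (mk C hC) ↔ μ (A ∩ C) = 0 := by
  rw [disjoint_iff]
  refine (mk_eq_mk (hA.inter hC) .empty).trans ?_
  rw [← Set.bot_eq_empty, symmDiff_bot]

omit [IsProbabilityMeasure μ] in
theorem isLUB_mk {ι : Type*} [Countable ι] {A : ι → Set X} (hA : ∀ i, MeasurableSet (A i)) :
    IsLUB (Set.range fun i => (mk (A i) (hA i) : MeasAlg μ)) (mk (⋃ i, A i) (.iUnion hA)) := by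
  refine ⟨?_, fun b hb => ?_⟩
  · rintro _ ⟨i, rfl⟩
    rw [mk_le_mk, Set.sdiff_eq_empty.2 (Set.subset_iUnion A i), measure_empty]
  · induction b using ind with
    | h C hC =>
      rw [mk_le_mk, Set.iUnion_sdiff, measure_iUnion_null_iff]
      exact fun i => (mk_le_mk μ (hA i) hC).1 (hb ⟨i, rfl⟩)

omit [IsProbabilityMeasure μ] in
/-- Representing sets for the members of a family. -/
theorem exists_rep {ι : Type*} (f : ι → MeasAlg μ) :
    ∃ A : ι → Set X, ∃ hA : ∀ i, MeasurableSet (A i), ∀ i, f i = mk (A i) (hA i) := by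
  have : ∀ i, ∃ A, ∃ hA : MeasurableSet A, f i = mk A hA := fun i =>
    ind (p := fun a => ∃ A, ∃ hA : MeasurableSet A, a = mk A hA) (fun A hA => ⟨A, hA, rfl⟩) (f i)
  choose A hA h using this
  exact ⟨A, hA, h⟩

theorem dist_eq_vol' (a b : MeasAlg μ) : dist a b = vol (a ∆ b) := by
  induction a using ind with
  | h A hA =>
    induction b using ind with
    | h C hC =>
      have : (mk A hA : MeasAlg μ) ∆ mk C hC = mk (A ∆ C) (hA.symmDiff hC) := by
        rw [symmDiff, sdiff_eq, sdiff_eq]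
        rfl
      rw [this, vol_mk, dist_mk]

theorem hasSum_vol' {ι : Type*} [Countable ι] (f : ι → MeasAlg μ) (s : MeasAlg μ)
    (hf : Pairwise (Function.onFun Disjoint f)) (hs : IsLUB (Set.range f) s) :
    HasSum (fun i => vol (f i)) (vol s) := by
  obtain ⟨A, hA, h⟩ := exists_rep μ f
  obtain rfl : f = fun i => mk (A i) (hA i) := funext h
  rw [hs.unique (isLUB_mk μ hA)]
  simp only [vol_mk]
  have h1 : μ (⋃ i, A i) = ∑' i, μ (A i) := measure_iUnion₀
    (fun i j hij => (disjoint_mk μ (hA i) (hA j)).1 (hf hij)) fun i => (hA i).nullMeasurableSet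
  have h2 : ∑' i, μ (A i) ≠ ⊤ := h1 ▸ measure_ne_top μ _
  have h3 := ENNReal.hasSum_toReal h2
  rw [← ENNReal.tsum_toReal_eq fun i => measure_ne_top μ _, ← h1] at h3
  exact h3

/-- A rapidly convergent sequence of sets converges to its upper limit. -/
theorem completeSpace : CompleteSpace (MeasAlg μ) := by
  refine Metric.complete_of_convergent_controlled_sequences (fun n => (1 / 2) ^ n) (fun n => by positivity)
    fun u hu => ?_
  obtain ⟨A, hA, h⟩ := exists_rep μ u
  obtain rfl : u = fun i => mk (A i) (hA i) := funext h
  have hd : ∀ n, μ.real (A n ∆ A (n + 1)) ≤ (1 / 2) ^ n := fun n => by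
    have := (hu n n (n + 1) le_rfl n.le_succ).le
    rwa [dist_mk] at this
  let L : Set X := ⋂ n, ⋃ k, A (n + k)
  have hL : MeasurableSet L := .iInter fun n => .iUnion fun k => hA _
  have hsub : ∀ n, A n ∆ L ⊆ ⋃ k, A (n + k) ∆ A (n + k + 1) := by
    intro n x hx
    by_contra hne
    simp only [Set.mem_iUnion, not_exists] at hne
    have h1 : ∀ k, x ∈ A (n + k) ↔ x ∈ A n := fun k => by
      induction k with
      | zero => rfl
      | succ k ih =>
        rw [← ih, ← add_assoc]
        have := hne k
        rw [Set.mem_symmDiff] at this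
        tauto
    have h2 : x ∈ L ↔ x ∈ A n := by
      simp only [L, Set.mem_iInter, Set.mem_iUnion]
      refine ⟨fun h => ?_, fun h m => ⟨n, ?_⟩⟩
      · obtain ⟨k, hk⟩ := h n
        exact (h1 k).1 hk
      · rw [add_comm]
        exact (h1 m).2 h
    rw [Set.mem_symmDiff] at hx
    tauto
  refine ⟨mk L hL, tendsto_iff_dist_tendsto_zero.2 ?_⟩
  refine squeeze_zero (g := fun n => (1 / 2 : ℝ) ^ n * 2) (fun n => dist_nonneg) (fun n => ?_) ?_
  · rw [dist_mk]
    have h1 : HasSum (fun k => (1 / 2 : ℝ) ^ (n + k)) ((1 / 2) ^ n * 2) := by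
      simp only [pow_add]
      exact hasSum_geometric_two.mul_left _
    have h2 : μ (A n ∆ L) ≤ ENNReal.ofReal ((1 / 2) ^ n * 2) := by
      refine (measure_mono (hsub n)).trans ((measure_iUnion_le _).trans ?_)
      rw [← h1.tsum_eq, ENNReal.ofReal_tsum_of_nonneg (fun k => by positivity) h1.summable]
      refine ENNReal.tsum_le_tsum fun k => ?_
      rw [← ofReal_measureReal]
      exact ENNReal.ofReal_le_ofReal (hd _)
    exact ENNReal.toReal_le_of_le_ofReal (by positivity) h2
  · simpa using (tendsto_pow_atTop_nhds_zero_of_lt_one (by norm_num : (0 : ℝ) ≤ 1 / 2)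
      (by norm_num)).mul_const 2

theorem separableSpace [MeasurableSpace.CountablyGenerated X] :
    TopologicalSpace.SeparableSpace (MeasAlg μ) := by
  obtain ⟨𝒜, hc, hd⟩ := exists_countable_measureDense μ
  have : Countable 𝒜 := hc
  refine ⟨⟨Set.range fun A : 𝒜 => (mk A.1 (hd.measurable _ A.2) : MeasAlg μ),
    Set.countable_range _, fun a => ?_⟩⟩
  induction a using ind with
  | h A hA =>
    rw [Metric.mem_closure_iff]
    intro ε hε
    obtain ⟨C, hC, hAC⟩ := hd.approx A hA (measure_ne_top _ _) ε hε
    refine ⟨_, ⟨⟨C, hC⟩, rfl⟩, ?_⟩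
    rw [dist_mk]
    exact (ENNReal.toReal_lt_of_lt_ofReal hAC)

/-- Measurable sets have measurable subsets of every smaller measure: after an embedding of the space
into `ℝ`, these are cut out by half-lines, as the distribution function is continuous. -/
theorem exists_measurable_subset_real_eq [StandardBorelSpace X] [NullSingletonClass μ] {A : Set X}
    (hA : MeasurableSet A) {t : ℝ} (h0 : 0 ≤ t) (ht : t ≤ μ.real A) :
    ∃ C ⊆ A, MeasurableSet C ∧ μ.real C = t := by
  let f := embeddingReal X
  have hf : MeasurableEmbedding f := measurableEmbedding_embeddingReal X
  let ν : Measure ℝ := (μ.restrict A).map f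
  have hν : ∀ r, ν.real (Set.Iic r) = μ.real (f ⁻¹' Set.Iic r ∩ A) := fun r => by
    rw [measureReal_def, hf.map_apply, Measure.restrict_apply (hf.measurable measurableSet_Iic)]
    rfl
  have hν0 : NullSingletonClass ν := ⟨fun x => by
    rw [hf.map_apply]
    exact (Set.subsingleton_singleton.preimage hf.injective).measure_zero _⟩
  have hcont : Continuous fun r => ν.real (Set.Iic r) := by
    have h1 : ∀ r, ν.real (Set.Iic r) = ∫ _ in Set.Iic r, (1 : ℝ) ∂ν := fun r => by simp
    simp only [h1]
    refine continuous_iff_continuousAt.2 fun r => ?_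
    exact (IntegrableOn.continuousOn_Iic_primitive_Iic (a₀ := r + 1)
      (integrableOn_const (by finiteness))).continuousAt
      (Iic_mem_nhds (by linarith))
  have hbot : Tendsto (fun r => ν.real (Set.Iic r)) atBot (𝓝 0) := by
    have h1 : ∀ r, ν.real (Set.Iic r) = ν.real Set.univ - ν.real (Set.Ici r) := fun r => by
      rw [← measureReal_compl measurableSet_Ici, Set.compl_Ici, measureReal_def, measureReal_def,
        measure_congr Iio_ae_eq_Iic]
    simp only [h1]
    have h2 : Tendsto (fun r => ν.real (Set.Ici r)) atBot (𝓝 (ν.real Set.univ)) :=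
      (ENNReal.tendsto_toReal (measure_ne_top _ _)).comp (tendsto_measure_Ici_atBot ν)
    have h3 := (tendsto_const_nhds (x := ν.real Set.univ)).sub h2
    rwa [sub_self] at h3
  have htop : Tendsto (fun r => ν.real (Set.Iic r)) atTop (𝓝 (μ.real A)) := by
    have h1 : ν Set.univ = μ A := by
      rw [hf.map_apply, Set.preimage_univ, Measure.restrict_apply_univ]
    rw [measureReal_def μ, ← h1]
    exact (ENNReal.tendsto_toReal (measure_ne_top _ _)).comp (tendsto_measure_Iic_atTop ν)
  rcases h0.eq_or_lt with rfl | h0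
  · exact ⟨∅, Set.empty_subset _, .empty, measureReal_empty⟩
  rcases ht.eq_or_lt with rfl | ht
  · exact ⟨A, subset_rfl, hA, rfl⟩
  obtain ⟨r, hr⟩ := mem_range_of_exists_le_of_exists_ge hcont
    ((hbot.eventually (gt_mem_nhds h0)).exists.imp fun _ => le_of_lt)
    ((htop.eventually (lt_mem_nhds ht)).exists.imp fun _ => le_of_lt)
  exact ⟨f ⁻¹' Set.Iic r ∩ A, Set.inter_subset_right, (hf.measurable measurableSet_Iic).inter hA,
    (hν r).symm.trans hr⟩

/-- The measure algebra of an atomless standard probability space is a separable atomless probability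
algebra. -/
instance [StandardBorelSpace X] [NullSingletonClass μ] : ProbAlg (MeasAlg μ) where
  dist_eq_vol := dist_eq_vol' μ
  vol_top := by rw [top_def, vol_mk, probReal_univ]
  vol_sup a b hab := by
    induction a using ind with
    | h A hA =>
      induction b using ind with
      | h C hC =>
        have h1 := (disjoint_mk μ hA hC).1 hab
        refine (vol_mk μ (hA.union hC)).trans ?_
        rw [vol_mk, vol_mk]
        have := measureReal_union_add_inter (μ := μ) (s := A) hC
        rw [measureReal_def μ (A ∩ C), h1] at this
        simpa using this
  exists_isLUB f := by
    obtain ⟨A, hA, h⟩ := exists_rep μ f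
    obtain rfl : f = fun i => mk (A i) (hA i) := funext h
    exact ⟨_, isLUB_mk μ hA⟩
  hasSum_vol := hasSum_vol' μ
  exists_le_vol_eq a t h0 ht := by
    induction a using ind with
    | h A hA =>
      rw [vol_mk] at ht
      obtain ⟨C, hCA, hC, hv⟩ := exists_measurable_subset_real_eq μ hA h0 ht
      exact ⟨mk C hC, (mk_le_mk μ hC hA).2 (by rw [Set.sdiff_eq_empty.2 hCA, measure_empty]),
        (vol_mk μ hC).trans hv⟩
  complete := completeSpace μ
  separable := separableSpace μ

end MeasAlg

theorem mainTheorem3 {X : Type u} [MeasurableSpace X] [StandardBorelSpace X]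
    (μ : Measure X) [IsProbabilityMeasure μ] [NullSingletonClass μ] :
    AutomaticContinuityProperty.{v} (MeasAlg.aut μ) where
  -- `MeasAlg.aut μ` and `ProbAlg.Aut (MeasAlg μ)` agree by definition, together with their topologies
  isTopologicalGroup := inferInstanceAs (IsTopologicalGroup (ProbAlg.Aut (MeasAlg μ)))
  polishSpace := inferInstanceAs (PolishSpace (ProbAlg.Aut (MeasAlg μ)))
  continuous_hom _ _ _ _ _ π := ProbAlg.continuous_hom (B := MeasAlg μ) π
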